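/- **Setting.** Let $X\subset\mathbb R^d$ be a finite set of arms, $|X|\ge 2$, and $\theta^*\in\mathbb R^d$. Pulling $x\in X$ returns $x^\top\theta^*+\epsilon$ with independent $\epsilon\sim\mathcal N(0,1)$. There is a unique best arm $x_*=\arg\max_{x\in X}x^\top\theta^*$; put $\Delta_x=(x_*-x)^\top\theta^*$ and $\Delta_2=\min_{x\ne x_*}\Delta_x>0$. Let $\Delta^X$ be the set of probability vectors on $X$, and for $\lambda\in\Delta^X$ let $A_\lambda=\sum_{x\in X}\lambda_x xx^\top$. For positive semidefinite $M$ let $\|y\|^2_{M^{-1}}=w^\top Mw$ for any $w$ with $Mw=y$, and $\|y\|^2_{M^{-1}}=\infty$ if $y\notin\operatorname{range}M$. For a finite $A\subset\mathbb R^d$ an optimal design $\lambda(A)$ is a minimizer over $\lambda\in\Delta^X$ of $\max_{y\in A}\|y\|^2_{A_\lambda^{-1}}$, and $\rho(A)$ is the minimal value. Let $\mathcal Y(S)=\{x-x':x,x'\in S,\ x\neq x'\}$, $\mathcal Y^*(X)=\{x_*-x:x\in X\setminus\{x_*\}\}$ and $$\psi^*=\min_{\lambda\in\Delta^X}\max_{x\in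 X\setminus\{x_*\}}\frac{\|x-x_*\|^2_{A_\lambda^{-1}}}{\Delta_x^2}.$$ **Rounding.** A rounding procedure is a function $\mathrm{Round}(\lambda,N,X,Y)$ which, for all finite $X,Y\subset\mathbb R^d$, all $\lambda\in\Delta^X$ and all integers $N\ge 4d$, returns $x^1,\dots,x^N\in X$ (repetitions allowed) with $\max_{y\in Y}\|y\|^2_{(\sum_i x^i(x^i)^\top)^{-1}}\le\frac4N\max_{y\in Y}\|y\|^2_{A_\lambda^{-1}}$. **Algorithm IS-RAGE** with $\beta_{\rm conf}=5$, $\beta_{\rm sample}=25$, $\beta_{\rm grid}=4$ and $\delta\in(0,1)$. Start with $S_1=X$, $L_1=4$. While $|S_r|>1$, run batch $r$: with $\delta_r=\delta/r^2$ let $N_r=\lceil4\max\{2\log_2(|S_r|^2/\delta_r)\,\rho(\mathcal Y(S_r))L_r,\ d\}\rceil$; pull the $N_r$ arms $\mathrm{Round}(\lambda(\mathcal Y(S_r)),N_r,X,\mathcal Y(S_r))$; let $\theta_r$ be a least squares estimate from these rewards; let $\epsilon^r_x=\max_{z\in S_r}\theta_r^\top z-\theta_r^\top x$ and $O_r=\{x\in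 S_r:\epsilon^r_x\ge5/\sqrt{L_r}\}$; put $\epsilon_x=\epsilon_x^r$ for $x\in O_r$ and $S_{r+1}=S_r\setminus O_r$; with $4^{T_r}\le L_r<4^{T_r+1}$ set $$L_{r+1}=4L_r+\frac{\sum_{t=1}^{T_r}4^t\rho\big(\mathcal Y(X\setminus\{x\in\bigcup_{s\le r}O_s:\epsilon_x>25\cdot2^{-t}\})\big)}{\rho(\mathcal Y(S_{r+1}))}.$$ At the end return the remaining arm. **Batch complexity.** Let $\bar L_1=4$ and, for $r\ge1$, $\bar L_r=4^{\bar T_r}$, $U_r=\{x\in X:\Delta_x>15/\sqrt{\bar L_r}\}$, $$\hat L_{r+1}=4\bar L_r+\frac{\sum_{t=1}^{\bar T_r}4^t\rho\big(\mathcal Y(X\setminus\{x\in U_r:\Delta_x>15\cdot2^{-t}\})\big)}{\rho(\mathcal Y(X\setminus U_r))},\qquad 4^{\bar T_{r+1}}\le\hat L_{r+1}<4^{\bar T_{r+1}+1}.$$ Let $R_I$ be the least $r\ge1$ with $U_r=X\setminus\{x_*\}$, and $\alpha$ the number of different sets among $U_1,\dots,U_{R_I}$. **Theorem.** Optimal designs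 (for nonempty $X$) and rounding procedures exist, and there is a universal constant $C$ such that for all instances as above the following holds. 1. For every $L>0$, $\ L\cdot\rho(\mathcal Y(\{z\in X:\Delta_z\le15/\sqrt L\}))\le900\,\psi^*$. 2. $R_I$ is finite. If $\Delta_2\le\frac12$ and $\Delta_x\le2$ for all $x\in X$ (the latter holds e.g. if $\|x\|_2\le1$ for all $x\in X$ and $\|\theta^*\|_2\le1$), then $$R_I\le\alpha+\log_{5/4}\frac{900\log_2(1/\Delta_2)\,\psi^*}{\rho(\mathcal Y^*(X))}.$$ 3. For every $\delta\in(0,1)$, every choice of optimal designs and every rounding procedure, with probability at least $1-\delta$ IS-RAGE stops and returns $x_*$, runs at most $R_I$ batches, and, if $\Delta_2\le\frac12$ and $\Delta_x\le2$ for all $x\in X$, uses in total at most $$C\big(\psi^*\log_2^2(1/\Delta_2)\log_2(|X|/\delta)+d\log_2(1/\Delta_2)\big)$$ arm pulls. -/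

import Mathlib

open MeasureTheory ProbabilityTheory Matrix
open scoped ENNReal

noncomputable section

namespace LinBandit

/-- Arms, parameters and measurement directions live in `ℝ^d`; only the dot product is used. -/
abbrev Vec (d : ℕ) : Type := Fin d → ℝ

variable {d : ℕ}

/-! ### Experimental design -/

/-- `‖y‖²_{M⁻¹} ∈ [0, ∞]` for a positive semidefinite `M`: the value `w ⬝ M w` for any `w` with
`M w = y`, and `∞` if `y` is not in the range of `M`. -/
def invNormSq (M : Matrix (Fin d) (Fin d) ℝ) (y : Vec d) : ℝ≥0∞ :=
  ⨅ (w : Vec d) (_ : M *ᵥ w = y), ENNReal.ofReal (w ⬝ᵥ M *ᵥ w)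

/-- For invertible `M` this is the usual `y ⬝ M⁻¹ y`. -/
theorem invNormSq_of_isUnit (M : Matrix (Fin d) (Fin d) ℝ) (h : IsUnit M.det) (y : Vec d) :
    invNormSq M y = ENNReal.ofReal (y ⬝ᵥ M⁻¹ *ᵥ y) := by
  have key : ∀ w : Vec d, M *ᵥ w = y ↔ w = M⁻¹ *ᵥ y := by
    intro w
    constructor
    · rintro rfl
      rw [mulVec_mulVec, nonsing_inv_mul _ h, one_mulVec]
    · rintro rfl
      rw [mulVec_mulVec, mul_nonsing_inv _ h, one_mulVec]
  unfold invNormSq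
  simp only [key, iInf_iInf_eq_left]
  rw [mulVec_mulVec, mul_nonsing_inv _ h, one_mulVec, dotProduct_comm]

/-- `max_{y ∈ A} ‖y‖²_{M⁻¹}` (equal to `0` for empty `A`). -/
def maxInvNormSq (M : Matrix (Fin d) (Fin d) ℝ) (A : Finset (Vec d)) : ℝ≥0∞ :=
  A.sup (invNormSq M)

/-- `p` is a probability vector on `X` (its values off `X` are irrelevant). -/
def IsDesign (X : Finset (Vec d)) (p : Vec d → ℝ) : Prop :=
  (∀ x ∈ X, 0 ≤ p x) ∧ ∑ x ∈ X, p x = 1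

/-- `∑_{x ∈ X} p_x x xᵀ`. -/
def designMatrix (X : Finset (Vec d)) (p : Vec d → ℝ) : Matrix (Fin d) (Fin d) ℝ :=
  ∑ x ∈ X, p x • vecMulVec x x

/-- `∑_{i ≤ N} x_i x_iᵀ` for a multiset `x_1, …, x_N`. -/
def sampleMatrix {N : ℕ} (x : Fin N → Vec d) : Matrix (Fin d) (Fin d) ℝ :=
  ∑ i, vecMulVec (x i) (x i)

/-- `p` is an optimal design on `X` for the test set `A`, i.e. it is a minimizer over all
probability vectors on `X`. -/
def IsOptimalDesign (X A : Finset (Vec d)) (p : Vec d → ℝ) : Prop :=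
  IsDesign X p ∧
    ∀ q, IsDesign X q → maxInvNormSq (designMatrix X p) A ≤ maxInvNormSq (designMatrix X q) A

/-- The optimal design value `ρ(A)` of the test set `A` (over designs on `X`). -/
def rho (X A : Finset (Vec d)) : ℝ :=
  (⨅ (p : Vec d → ℝ) (_ : IsDesign X p), maxInvNormSq (designMatrix X p) A).toReal

/-- `𝒴(S)`: differences of two distinct elements of `S`. -/
def diffs (S : Finset (Vec d)) : Finset (Vec d) :=
  S.offDiag.image fun z => z.1 - z.2

/-- `𝒴*(S)`: differences `x_* - x` with `x ∈ S`, `x ≠ x_*`. -/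
def diffsFrom (xs : Vec d) (S : Finset (Vec d)) : Finset (Vec d) :=
  (S.erase xs).image fun x => xs - x

/-- The type of rounding procedures: `rnd p N X Y` is a list of `N` vectors. -/
abbrev Rounding (d : ℕ) : Type :=
  (Vec d → ℝ) → (N : ℕ) → Finset (Vec d) → Finset (Vec d) → Fin N → Vec d

/-- The guarantee on a rounding procedure: for every design `p` on `X` and every `N ≥ 4 d` its
output consists of `N` elements of `X` (with repetitions), and
`max_{y ∈ Y} ‖y‖²_{(∑ x_i x_iᵀ)⁻¹} ≤ (4 / N) max_{y ∈ Y} ‖y‖²_{(∑ p_x x xᵀ)⁻¹}`. -/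
def IsRounding (rnd : Rounding d) : Prop :=
  ∀ (p : Vec d → ℝ) (N : ℕ) (X Y : Finset (Vec d)), IsDesign X p → 4 * d ≤ N →
    (∀ i, rnd p N X Y i ∈ X) ∧
      (N : ℝ≥0∞) * maxInvNormSq (sampleMatrix (rnd p N X Y)) Y
        ≤ 4 * maxInvNormSq (designMatrix X p) Y

/-! ### The instance -/

/-- The gap `Δ_x = (x_* - x) ⬝ θ*`. -/
def gap (θ xs x : Vec d) : ℝ := (xs - x) ⬝ᵥ θ

/-- The instance complexity
`ψ* = min_p max_{x ∈ X, x ≠ x_*} ‖x - x_*‖²_{(∑ p_x x xᵀ)⁻¹} / ((x_* - x) ⬝ θ*)²`. -/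
def psiStar (X : Finset (Vec d)) (θ xs : Vec d) : ℝ :=
  (⨅ (p : Vec d → ℝ) (_ : IsDesign X p),
    (X.erase xs).sup fun x =>
      invNormSq (designMatrix X p) (x - xs) / ENNReal.ofReal (gap θ xs x ^ 2)).toReal

/-! ### The instance-sensitive batch complexity -/

/-- The arms of gap larger than `15 / √L`. -/
def farArms (X : Finset (Vec d)) (θ xs : Vec d) (L : ℝ) : Finset (Vec d) :=
  {x ∈ X | 15 / √L < gap θ xs x}

/-- The exponents `T̄_r`, with `L̄_r = 4 ^ T̄_r`. They start from `L̄_0 = 1`, hence `L̄_1 = 4`. -/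
def Tbar (X : Finset (Vec d)) (θ xs : Vec d) : ℕ → ℕ
  | 0 => 0
  | r + 1 =>
    let T := Tbar X θ xs r
    let U := farArms X θ xs (4 ^ T)
    let Lhat : ℝ := 4 * 4 ^ T +
      (∑ t ∈ Finset.Icc 1 T,
        4 ^ t * rho X (diffs (X \ {x ∈ U | 15 * (2 ^ t : ℝ)⁻¹ < gap θ xs x})))
      / rho X (diffs (X \ U))
    ⌊Real.logb 4 Lhat⌋₊

/-- `U_r = {x ∈ X : Δ_x > 15 / √L̄_r}`. -/
def U (X : Finset (Vec d)) (θ xs : Vec d) (r : ℕ) : Finset (Vec d) :=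
  farArms X θ xs (4 ^ Tbar X θ xs r)

/-! ### The algorithm IS-RAGE -/

/-- The least squares estimate for design points `x_i` and rewards `c_i`: a solution of the normal
equations `(∑ x_i x_iᵀ) ϑ = ∑ c_i x_i`. -/
def olsEstimate {N : ℕ} (x : Fin N → Vec d) (c : Fin N → ℝ) : Vec d :=
  Classical.epsilon fun ϑ : Vec d => sampleMatrix x *ᵥ ϑ = ∑ i, c i • x i

/-- If `∑ x_i x_iᵀ` is invertible, this is `(∑ x_i x_iᵀ)⁻¹ ∑ c_i x_i`. -/
theorem olsEstimate_of_isUnit {N : ℕ} (x : Fin N → Vec d) (c : Fin N → ℝ)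
    (h : IsUnit (sampleMatrix x).det) :
    olsEstimate x c = (sampleMatrix x)⁻¹ *ᵥ ∑ i, c i • x i := by
  have hex : ∃ ϑ : Vec d, sampleMatrix x *ᵥ ϑ = ∑ i, c i • x i :=
    ⟨(sampleMatrix x)⁻¹ *ᵥ ∑ i, c i • x i, by
      rw [mulVec_mulVec, mul_nonsing_inv _ h, one_mulVec]⟩
  have hs : sampleMatrix x *ᵥ olsEstimate x c = ∑ i, c i • x i := Classical.epsilon_spec hex
  rw [← hs, mulVec_mulVec, nonsing_inv_mul _ h, one_mulVec]

/-- The state at the start of a batch: the surviving arms `S_r`, the budget `L_r`, the recorded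
estimates `ε_x` of the eliminated arms, and the numbers of completed batches and pulls. -/
structure State (d : ℕ) where
  active : Finset (Vec d)
  L : ℝ
  eps : Vec d → ℝ
  batches : ℕ
  pulls : ℕ

/-- The number of pulls of batch `r`:
`N_r = ⌈4 max {2 log₂(|S_r|² / δ_r) ρ(𝒴(S_r)) L_r, d}⌉` with `δ_r = δ / r²`. -/
def batchSize (X S : Finset (Vec d)) (δ L : ℝ) (r : ℕ) : ℕ :=
  ⌈4 * max (2 * Real.logb 2 ((S.card : ℝ) ^ 2 / (δ / (r : ℝ) ^ 2)) * rho X (diffs S) * L) d⌉₊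

/-- One pass through the loop. Nothing changes once at most one arm survives. Here `lam A` is the
optimal design used for the test set `A`, and `noise r i` is the noise of the `i`-th pull of
batch `r`. -/
def step (βconf βsample βgrid δ : ℝ) (lam : Finset (Vec d) → Vec d → ℝ) (rnd : Rounding d)
    (X : Finset (Vec d)) (θ : Vec d) (noise : ℕ → ℕ → ℝ) (s : State d) : State d :=
  if h : 1 < s.active.card then
    let S := s.active
    let r := s.batches + 1
    let N := batchSize X S δ s.L r
    let x : Fin N → Vec d := rnd (lam (diffs S)) N X (diffs S)
    let c : Fin N → ℝ := fun i => x i ⬝ᵥ θ + noise r i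
    let ϑ := olsEstimate x c
    let pHat : Vec d → ℝ := fun y => ϑ ⬝ᵥ y
    let pMax : ℝ := S.sup' (Finset.card_pos.mp (zero_lt_one.trans h)) pHat
    let e : Vec d → ℝ := fun y => pMax - pHat y
    let O := {y ∈ S | βconf / √s.L ≤ e y}
    let S' := S \ O
    let eps' : Vec d → ℝ := fun y => if y ∈ O then e y else s.eps y
    let T := ⌊Real.logb βgrid s.L⌋₊
    let L' : ℝ := βgrid * s.L +
      (∑ t ∈ Finset.Icc 1 T,
        βgrid ^ t * rho X (diffs (X \ {y ∈ X \ S' | βsample * √((βgrid ^ t)⁻¹) < eps' y})))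
      / rho X (diffs S')
    ⟨S', L', eps', r, s.pulls + N⟩
  else s

/-- The state after `n` passes through the loop, started with `S_1 = X` and `L_1 = β_grid`. -/
def run (βconf βsample βgrid δ : ℝ) (lam : Finset (Vec d) → Vec d → ℝ) (rnd : Rounding d)
    (X : Finset (Vec d)) (θ : Vec d) (noise : ℕ → ℕ → ℝ) (n : ℕ) : State d :=
  (step βconf βsample βgrid δ lam rnd X θ noise)^[n] ⟨X, βgrid, fun _ => 0, 0, 0⟩

end LinBandit

end

open LinBandit

namespace LinBandit

/-! ### Duality for the inverse norm, and optimal designs. -/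

section Design

variable {d : ℕ} {M : Matrix (Fin d) (Fin d) ℝ}

/-! Randomness enters through one event: in every batch the estimated gaps of all active arms are
within `1 / √L` of the true gaps. Once the active set and the batch size are fixed, the errors in
the directions of `diffs S` are centred Gaussians, with variance at most `4 ρ / N` by the rounding
guarantee. They depend only on the noise of the current batch, hence are independent of the past. A
union bound makes batch `r` fail with probability at most `0.6 δ / r²` (`measure_batchFailure_le`),
and these bounds sum to at most `δ`.

On this event the rest is deterministic. The best arm survives, survivors have gap at most `6 / √L`,
and since the elimination threshold is five times the error, a recorded estimate satisfies `4/5 ε ≤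
Δ ≤ 6/5 ε`. Hence the sets in the budget rule contain `{Δ ≤ 15 / 2^t}` and lie in `{Δ ≤ 30 / 2^t}`.
The first inclusion makes the actual budget dominate the idealized one
(`nextBudget_le_of_batchStep`), so that only `x_*` is left after `R` batches. The second, with
`ρ(𝒴(S)) ≤ 4 c² ψ*` for arms of gap at most `c` (`rho_diffs_le_psiStar`), bounds the cost of the
next batch (`budget_mul_rho_le`).

The number of batches is controlled by the potential `nearSum`: whenever `U_r` does not change it
grows by the factor `5/4` (`nearSum_growth`), while it stays below a multiple of `ψ* log₂(1 / Δ₂)`.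

For the pulls, let `g` be the ratio of consecutive budgets. A batch costs at most a multiple of `ψ*
min(g, K)` times the confidence logarithm, with `K = 8 log₂(1 / Δ₂)`. This is at most a multiple of
`log g`, which telescopes; the elementary inequality `log_mul_min_le` also absorbs the `log r` of
the confidence level.

Optimal designs exist because the inverse norm is a supremum of functions continuous in the design
(`invNormSq_eq_iSup`). Rounding is the lower barrier argument of Batson, Spielman and Srivastava,
applied after whitening the design. -/

lemma isHermitian_dotProduct_comm {n : Type*} [Fintype n] {M : Matrix n n ℝ}
    (hM : M.IsHermitian) (v w : n → ℝ) : v ⬝ᵥ M *ᵥ w = w ⬝ᵥ M *ᵥ v := by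
  have h : Mᵀ = M := by simpa [Matrix.IsHermitian] using hM
  rw [dotProduct_mulVec, ← mulVec_transpose, h, dotProduct_comm]

lemma posSemidef_quad_nonneg {n : Type*} [Fintype n] {M : Matrix n n ℝ}
    (hM : M.PosSemidef) (v : n → ℝ) : 0 ≤ v ⬝ᵥ M *ᵥ v := by
  simpa using hM.dotProduct_mulVec_nonneg v

/-- A vector outside the range of a symmetric matrix is detected by its kernel. -/
lemma exists_mulVec_eq_or (hM : M.IsHermitian) (y : Vec d) :
    (∃ w, M *ᵥ w = y) ∨ ∃ v, M *ᵥ v = 0 ∧ v ⬝ᵥ y ≠ 0 := by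
  by_cases h : y ∈ LinearMap.range M.mulVecLin
  · left
    obtain ⟨w, hw⟩ := h
    exact ⟨w, by simpa using hw⟩
  · right
    obtain ⟨f, hf, hf'⟩ := Submodule.exists_dual_map_eq_bot_of_notMem h inferInstance
    have key : ∀ z : Vec d, f z = (fun i => f (Pi.single i 1)) ⬝ᵥ z := by
      intro z
      conv_lhs => rw [← Finset.univ_sum_single z, map_sum]
      refine Finset.sum_congr rfl fun i _ => ?_
      have : (Pi.single i (z i) : Vec d) = z i • Pi.single i (1 : ℝ) := by
        rw [← Pi.single_smul]; simp
      rw [this, map_smul, smul_eq_mul, mul_comm]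
    refine ⟨fun i => f (Pi.single i 1), ?_, by rwa [← key]⟩
    have h0 : ∀ w, (fun i => f (Pi.single i 1)) ⬝ᵥ M *ᵥ w = 0 := by
      intro w
      rw [← key]
      have : f (M.mulVecLin w) ∈ (LinearMap.range M.mulVecLin).map f :=
        Submodule.mem_map_of_mem ⟨w, rfl⟩
      rw [hf'] at this
      simpa using this
    set v : Vec d := fun i => f (Pi.single i 1)
    -- Orthogonality to the range, tested on `M (M v)`, gives `|M v|² = 0`.
    have := h0 (M *ᵥ v)
    rw [isHermitian_dotProduct_comm hM] at this
    exact dotProduct_self_eq_zero.mp this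

/-- For symmetric `M` all solutions `w` of `M w = y` give the same value, so the infimum is over a
constant. -/
lemma invNormSq_of_mulVec_eq (hM : M.IsHermitian) {w y : Vec d} (h : M *ᵥ w = y) :
    invNormSq M y = ENNReal.ofReal (w ⬝ᵥ M *ᵥ w) := by
  apply le_antisymm
  · exact iInf₂_le w h
  · refine le_iInf₂ fun w' h' => ENNReal.ofReal_le_ofReal (le_of_eq ?_)
    rw [h, ← h', isHermitian_dotProduct_comm hM, h, h', dotProduct_comm]

/-- The dual description of `‖y‖²_{M⁻¹}`. -/
lemma invNormSq_eq_iSup (hM : M.PosSemidef) (y : Vec d) :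
    invNormSq M y = ⨆ v : Vec d, ENNReal.ofReal (2 * (v ⬝ᵥ y) - v ⬝ᵥ M *ᵥ v) := by
  apply le_antisymm
  · rcases exists_mulVec_eq_or hM.1 y with ⟨w, hw⟩ | ⟨v, hv, hvy⟩
    · rw [invNormSq_of_mulVec_eq hM.1 hw]
      refine le_iSup_of_le w (ENNReal.ofReal_le_ofReal ?_)
      rw [hw]; linarith
    · refine le_of_le_of_eq le_top (Eq.symm ?_)
      rw [iSup_eq_top]
      intro b hb
      refine ⟨((b.toReal + 1) / (2 * (v ⬝ᵥ y))) • v, ?_⟩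
      have : 2 * (((b.toReal + 1) / (2 * (v ⬝ᵥ y))) • v ⬝ᵥ y) = b.toReal + 1 := by
        rw [smul_dotProduct, smul_eq_mul]; field_simp
      rw [this, mulVec_smul, hv, smul_zero, dotProduct_zero, sub_zero,
        ENNReal.lt_ofReal_iff_toReal_lt hb.ne]
      linarith
  · refine iSup_le fun v => le_iInf₂ fun w hw => ENNReal.ofReal_le_ofReal ?_
    have := posSemidef_quad_nonneg hM (v - w)
    rw [mulVec_sub, dotProduct_sub, sub_dotProduct, sub_dotProduct,
      isHermitian_dotProduct_comm hM.1 w v] at this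
    rw [← hw]
    linarith

lemma le_invNormSq (hM : M.PosSemidef) (v y : Vec d) :
    ENNReal.ofReal (2 * (v ⬝ᵥ y) - v ⬝ᵥ M *ᵥ v) ≤ invNormSq M y := by
  rw [invNormSq_eq_iSup hM]
  exact le_iSup (fun v : Vec d => ENNReal.ofReal (2 * (v ⬝ᵥ y) - v ⬝ᵥ M *ᵥ v)) v

/-- `M ↦ ‖y‖²_{M⁻¹}` reverses the Loewner order. -/
lemma invNormSq_anti {A S : Matrix (Fin d) (Fin d) ℝ} (hA : A.PosSemidef) (hS : S.PosSemidef)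
    {c : ℝ} (hc : 0 ≤ c) (h : ∀ v, c * (v ⬝ᵥ A *ᵥ v) ≤ v ⬝ᵥ S *ᵥ v) (y : Vec d) :
    ENNReal.ofReal c * invNormSq S y ≤ invNormSq A y := by
  rw [invNormSq_eq_iSup hS, ENNReal.mul_iSup]
  refine iSup_le fun v => ?_
  rw [← ENNReal.ofReal_mul hc]
  refine le_trans (ENNReal.ofReal_le_ofReal ?_) (le_invNormSq hA (c • v) y)
  rw [mulVec_smul, dotProduct_smul, smul_dotProduct, smul_dotProduct]
  simp only [smul_eq_mul]
  have := mul_le_mul_of_nonneg_left (h v) hc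
  linarith

lemma invNormSq_neg (hM : M.PosSemidef) (y : Vec d) : invNormSq M (-y) = invNormSq M y := by
  have h : ∀ y, invNormSq M (-y) ≤ invNormSq M y := by
    intro y
    rw [invNormSq_eq_iSup hM]
    refine iSup_le fun v => le_trans (ENNReal.ofReal_le_ofReal ?_) (le_invNormSq hM (-v) y)
    simp [mulVec_neg]
  exact le_antisymm (h y) (by simpa using h (-y))

lemma invNormSq_add_le (hM : M.PosSemidef) (x y : Vec d) :
    invNormSq M (x + y) ≤ 2 * (invNormSq M x + invNormSq M y) := by
  rw [invNormSq_eq_iSup hM (x + y)]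
  refine iSup_le fun v => ?_
  have key : ∀ z : Vec d, ENNReal.ofReal (2 * (v ⬝ᵥ z) - (v ⬝ᵥ M *ᵥ v) / 2) ≤
      2 * invNormSq M z := by
    intro z
    -- Testing each summand with `v / 2` splits the quadratic term evenly; this is the source of the
    -- factor 2.
    have h1 := le_invNormSq hM ((1 / 2 : ℝ) • v) z
    have h2 := mul_le_mul_right h1 2
    refine le_trans (le_of_eq ?_) h2
    rw [show (2 : ℝ≥0∞) = ENNReal.ofReal 2 by norm_num, ← ENNReal.ofReal_mul (by norm_num)]
    congr 1
    rw [mulVec_smul, dotProduct_smul, smul_dotProduct, smul_dotProduct]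
    simp only [smul_eq_mul]
    ring
  rw [mul_add]
  refine le_trans ?_ (add_le_add (key x) (key y))
  refine le_trans (ENNReal.ofReal_le_ofReal ?_) ENNReal.ofReal_add_le
  rw [dotProduct_add]; linarith

lemma invNormSq_sub_le (hM : M.PosSemidef) (x y : Vec d) :
    invNormSq M (x - y) ≤ 2 * (invNormSq M x + invNormSq M y) := by
  rw [sub_eq_add_neg, ← invNormSq_neg hM y]
  exact invNormSq_add_le hM x (-y)

lemma invNormSq_pos (hM : M.PosSemidef) {y : Vec d} (hy : y ≠ 0) : 0 < invNormSq M y := by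
  have h0 : 0 < y ⬝ᵥ y := by
    have := dotProduct_star_self_pos_iff (v := y); simpa using this.mpr hy
  have hq := posSemidef_quad_nonneg hM y
  set a := y ⬝ᵥ y
  set q := y ⬝ᵥ M *ᵥ y with hqd
  -- The best multiple of `y` is `a / q`; adding `a` to the denominator keeps it legal when `q = 0`.
  refine lt_of_lt_of_le ?_ (le_invNormSq hM ((a / (q + a)) • y) y)
  rw [ENNReal.ofReal_pos, mulVec_smul, dotProduct_smul, smul_dotProduct, smul_dotProduct]
  simp only [smul_eq_mul]
  rw [← hqd]
  have h1 : 2 * (a / (q + a) * a) - a / (q + a) * (a / (q + a) * q) =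
      a ^ 2 / (q + a) ^ 2 * (q + 2 * a) := by
    field_simp; ring
  rw [h1]; positivity

lemma quad_vecMulVec {n : Type*} [Fintype n] (x v : n → ℝ) :
    v ⬝ᵥ vecMulVec x x *ᵥ v = (x ⬝ᵥ v) ^ 2 := by
  rw [vecMulVec_mulVec, dotProduct_smul, dotProduct_comm v x]
  simp [sq]

lemma quad_designMatrix (X : Finset (Vec d)) (p : Vec d → ℝ) (v : Vec d) :
    v ⬝ᵥ designMatrix X p *ᵥ v = ∑ x ∈ X, p x * (x ⬝ᵥ v) ^ 2 := by
  rw [designMatrix, sum_mulVec, dotProduct_sum]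
  refine Finset.sum_congr rfl fun x _ => ?_
  rw [smul_mulVec, dotProduct_smul, quad_vecMulVec, smul_eq_mul]

lemma quad_sampleMatrix {N : ℕ} (x : Fin N → Vec d) (v : Vec d) :
    v ⬝ᵥ sampleMatrix x *ᵥ v = ∑ i, (x i ⬝ᵥ v) ^ 2 := by
  rw [sampleMatrix, sum_mulVec, dotProduct_sum]
  exact Finset.sum_congr rfl fun i _ => quad_vecMulVec _ _

lemma posSemidef_vecMulVec {n : Type*} [Fintype n] (x : n → ℝ) :
    (vecMulVec x x).PosSemidef := by
  simpa using posSemidef_vecMulVec_self_star x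

lemma posSemidef_designMatrix {X : Finset (Vec d)} {p : Vec d → ℝ} (hp : IsDesign X p) :
    (designMatrix X p).PosSemidef :=
  posSemidef_sum _ fun x hx => (posSemidef_vecMulVec x).smul (hp.1 x hx)

lemma posSemidef_sampleMatrix {N : ℕ} (x : Fin N → Vec d) : (sampleMatrix x).PosSemidef :=
  posSemidef_sum _ fun i _ => posSemidef_vecMulVec (x i)

/-! ### Uniform designs -/

lemma isDesign_uniform {X : Finset (Vec d)} (hX : X.Nonempty) :
    IsDesign X fun _ => (X.card : ℝ)⁻¹ := by
  refine ⟨fun _ _ => by positivity, ?_⟩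
  have : (X.card : ℝ) ≠ 0 := by exact_mod_cast hX.card_pos.ne'
  simp [this]

/-- In the dual form, `x` alone contributes `u² / |X|` to the quadratic term, and `2 u - u² / |X| ≤
|X|` by completing the square. -/
lemma invNormSq_uniform_lt_top {X : Finset (Vec d)} {x : Vec d} (hx : x ∈ X) :
    invNormSq (designMatrix X fun _ => (X.card : ℝ)⁻¹) x < ∞ := by
  have hX : X.Nonempty := ⟨x, hx⟩
  have hc : (0 : ℝ) < X.card := by exact_mod_cast hX.card_pos
  rw [invNormSq_eq_iSup (posSemidef_designMatrix (isDesign_uniform hX))]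
  refine lt_of_le_of_lt (iSup_le fun v => ?_) (ENNReal.ofReal_lt_top (r := (X.card : ℝ)))
  refine ENNReal.ofReal_le_ofReal ?_
  rw [quad_designMatrix]
  have h1 : (X.card : ℝ)⁻¹ * (x ⬝ᵥ v) ^ 2 ≤ ∑ x ∈ X, (X.card : ℝ)⁻¹ * (x ⬝ᵥ v) ^ 2 :=
    Finset.single_le_sum (f := fun x : Vec d => (X.card : ℝ)⁻¹ * (x ⬝ᵥ v) ^ 2)
      (fun _ _ => by positivity) hx
  rw [dotProduct_comm v x]
  have h2 : 2 * (x ⬝ᵥ v) - (X.card : ℝ)⁻¹ * (x ⬝ᵥ v) ^ 2 ≤ X.card := by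
    have : X.card - (2 * (x ⬝ᵥ v) - (X.card : ℝ)⁻¹ * (x ⬝ᵥ v) ^ 2) =
        (X.card : ℝ)⁻¹ * (x ⬝ᵥ v - X.card) ^ 2 := by
      field_simp; ring
    nlinarith [inv_pos.mpr hc, sq_nonneg (x ⬝ᵥ v - X.card), mul_nonneg (inv_pos.mpr hc).le (sq_nonneg (x ⬝ᵥ v - X.card))]
  linarith

lemma invNormSq_sub_uniform_lt_top {X : Finset (Vec d)} {x y : Vec d} (hx : x ∈ X) (hy : y ∈ X) :
    invNormSq (designMatrix X fun _ => (X.card : ℝ)⁻¹) (x - y) < ∞ := by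
  refine lt_of_le_of_lt (invNormSq_sub_le
    (posSemidef_designMatrix (isDesign_uniform ⟨x, hx⟩)) x y) ?_
  exact ENNReal.mul_lt_top (by norm_num)
    (ENNReal.add_lt_top.mpr ⟨invNormSq_uniform_lt_top hx, invNormSq_uniform_lt_top hy⟩)

lemma mem_diffs {S : Finset (Vec d)} {y : Vec d} :
    y ∈ diffs S ↔ ∃ x ∈ S, ∃ x' ∈ S, x ≠ x' ∧ x - x' = y := by
  simp only [diffs, Finset.mem_image, Finset.mem_offDiag, Prod.exists]
  constructor
  · rintro ⟨a, b, ⟨ha, hb, hab⟩, h⟩; exact ⟨a, ha, b, hb, hab, h⟩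
  · rintro ⟨a, ha, b, hb, hab, h⟩; exact ⟨a, b, ⟨ha, hb, hab⟩, h⟩

lemma diffs_mono {S T : Finset (Vec d)} (h : S ⊆ T) : diffs S ⊆ diffs T := by
  intro y hy
  obtain ⟨a, ha, b, hb, hab, rfl⟩ := mem_diffs.mp hy
  exact mem_diffs.mpr ⟨a, h ha, b, h hb, hab, rfl⟩

/-! ### Existence of optimal designs -/

lemma continuous_quad_designMatrix (X : Finset (Vec d)) (v : Vec d) :
    Continuous fun p : Vec d → ℝ => v ⬝ᵥ designMatrix X p *ᵥ v := by
  simp only [quad_designMatrix]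
  fun_prop

/-- The designs on `X` that vanish off `X`. -/
def designSet (X : Finset (Vec d)) : Set (Vec d → ℝ) :=
  {p | IsDesign X p ∧ ∀ x ∉ X, p x = 0}

/-- Fixing the irrelevant values off `X` to zero makes this a closed subset of a product of compact
sets, so Tychonoff applies although the index set `Vec d` is infinite. -/
lemma isCompact_designSet (X : Finset (Vec d)) : IsCompact (designSet X) := by
  classical
  have hK : IsCompact (Set.univ.pi fun x : Vec d => if x ∈ X then Set.Icc (0 : ℝ) 1 else {0}) := by
    refine isCompact_univ_pi fun x => ?_
    split_ifs
    · exact isCompact_Icc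
    · exact isCompact_singleton
  have hC : IsClosed {p : Vec d → ℝ | ∑ x ∈ X, p x = 1} :=
    isClosed_eq (by fun_prop) continuous_const
  convert hK.inter_right hC using 1
  ext p
  simp only [designSet, IsDesign, Set.mem_ofPred_eq, Set.mem_inter_iff, Set.mem_pi, Set.mem_univ,
    true_implies]
  constructor
  · rintro ⟨⟨h0, h1⟩, h2⟩
    refine ⟨fun x => ?_, h1⟩
    split_ifs with hx
    · exact ⟨h0 x hx, h1 ▸ Finset.single_le_sum h0 hx⟩
    · exact h2 x hx
  · rintro ⟨h, h1⟩
    refine ⟨⟨fun x hx => ?_, h1⟩, fun x hx => ?_⟩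
    · have := h x; rw [if_pos hx] at this; exact this.1
    · have := h x; rw [if_neg hx] at this; exact this

/-- A supremum of continuous functions of `p`. The dual formula needs a positive semidefinite
matrix, hence the restriction to `designSet`. -/
lemma lowerSemicontinuousOn_invNormSq (X : Finset (Vec d)) (y : Vec d) :
    LowerSemicontinuousOn (fun p => invNormSq (designMatrix X p) y) (designSet X) := by
  have h : LowerSemicontinuousOn (fun p : Vec d → ℝ => ⨆ v : Vec d,
      ENNReal.ofReal (2 * (v ⬝ᵥ y) - v ⬝ᵥ designMatrix X p *ᵥ v)) (designSet X) := by
    refine lowerSemicontinuousOn_iSup fun v => ?_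
    have hc : Continuous fun p : Vec d → ℝ =>
        ENNReal.ofReal (2 * (v ⬝ᵥ y) - v ⬝ᵥ designMatrix X p *ᵥ v) :=
      ENNReal.continuous_ofReal.comp (continuous_const.sub (continuous_quad_designMatrix X v))
    exact hc.lowerSemicontinuous.lowerSemicontinuousOn _
  intro p hp
  have := h p hp
  intro c hc
  have h' : c < _ := hc
  simp only [invNormSq_eq_iSup (posSemidef_designMatrix hp.1)] at h'
  filter_upwards [this c h', self_mem_nhdsWithin] with q hq hqX
  rwa [invNormSq_eq_iSup (posSemidef_designMatrix hqX.1)]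

lemma designMatrix_congr {X : Finset (Vec d)} {p q : Vec d → ℝ} (h : ∀ x ∈ X, p x = q x) :
    designMatrix X p = designMatrix X q :=
  Finset.sum_congr rfl fun x hx => by rw [h x hx]

/-- A lower semicontinuous function attains its minimum on a compact set; truncating an arbitrary
design off `X` does not change its matrix. -/
theorem exists_isOptimalDesign {X : Finset (Vec d)} (hX : X.Nonempty) (A : Finset (Vec d)) :
    ∃ p, IsOptimalDesign X A p := by
  classical
  have trunc : ∀ q, IsDesign X q →
      (fun x => if x ∈ X then q x else 0) ∈ designSet X ∧
      designMatrix X (fun x => if x ∈ X then q x else 0) = designMatrix X q := by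
    intro q hq
    refine ⟨⟨⟨fun x hx => ?_, ?_⟩, fun x hx => if_neg hx⟩,
      designMatrix_congr fun x hx => if_pos hx⟩
    · simpa [hx] using hq.1 x hx
    · rw [← hq.2]; exact Finset.sum_congr rfl fun x hx => if_pos hx
  have hlsc : LowerSemicontinuousOn (fun p => maxInvNormSq (designMatrix X p) A)
      (designSet X) := by
    simp only [maxInvNormSq, Finset.sup_eq_iSup]
    exact lowerSemicontinuousOn_iSup fun y => lowerSemicontinuousOn_iSup fun _ =>
      lowerSemicontinuousOn_invNormSq X y
  obtain ⟨p, hp, hmin⟩ := hlsc.exists_isMinOn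
    ⟨_, (trunc _ (isDesign_uniform hX)).1⟩ (isCompact_designSet X)
  refine ⟨p, hp.1, fun q hq => ?_⟩
  have := hmin (trunc q hq).1
  simpa [(trunc q hq).2] using this

/-! ### The optimal value -/

lemma maxInvNormSq_mono {A B : Finset (Vec d)} (h : A ⊆ B) :
    maxInvNormSq M A ≤ maxInvNormSq M B := Finset.sup_mono h

lemma maxInvNormSq_diffs_uniform_lt_top {X S : Finset (Vec d)} (hS : S ⊆ X) :
    maxInvNormSq (designMatrix X fun _ => (X.card : ℝ)⁻¹) (diffs S) < ∞ := by
  refine (Finset.sup_lt_iff (by simp)).mpr fun y hy => ?_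
  obtain ⟨a, ha, b, hb, -, rfl⟩ := mem_diffs.mp hy
  exact invNormSq_sub_uniform_lt_top (hS ha) (hS hb)

/-- Sets of directions that a design on `X` can estimate. -/
def Estimable (X A : Finset (Vec d)) : Prop :=
  ∃ p, IsDesign X p ∧ maxInvNormSq (designMatrix X p) A < ∞

lemma estimable_diffs {X S : Finset (Vec d)} (hX : X.Nonempty) (hS : S ⊆ X) :
    Estimable X (diffs S) :=
  ⟨_, isDesign_uniform hX, maxInvNormSq_diffs_uniform_lt_top hS⟩

lemma Estimable.mono {X A B : Finset (Vec d)} (h : Estimable X B) (hAB : A ⊆ B) :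
    Estimable X A := by
  obtain ⟨p, hp, hf⟩ := h
  exact ⟨p, hp, (maxInvNormSq_mono hAB).trans_lt hf⟩

/-- `rho` is defined through `toReal`, which sends `∞` to `0`; estimability excludes this case. -/
lemma Estimable.ofReal_rho {X A : Finset (Vec d)} (h : Estimable X A) :
    ENNReal.ofReal (rho X A) =
      ⨅ (p : Vec d → ℝ) (_ : IsDesign X p), maxInvNormSq (designMatrix X p) A := by
  obtain ⟨p, hp, hf⟩ := h
  exact ENNReal.ofReal_toReal ((iInf₂_le p hp).trans_lt hf).ne

lemma IsOptimalDesign.eq_rho {X A : Finset (Vec d)} (h : Estimable X A) {p : Vec d → ℝ}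
    (hp : IsOptimalDesign X A p) :
    maxInvNormSq (designMatrix X p) A = ENNReal.ofReal (rho X A) := by
  rw [h.ofReal_rho]
  exact le_antisymm (le_iInf₂ fun q hq => hp.2 q hq) (iInf₂_le p hp.1)

lemma rho_nonneg (X A : Finset (Vec d)) : 0 ≤ rho X A := ENNReal.toReal_nonneg

lemma Estimable.rho_mono {X A B : Finset (Vec d)} (h : Estimable X B) (hAB : A ⊆ B) :
    rho X A ≤ rho X B := by
  rw [← ENNReal.ofReal_le_ofReal_iff (rho_nonneg X B), h.ofReal_rho, (h.mono hAB).ofReal_rho]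
  exact iInf₂_mono fun p _ => maxInvNormSq_mono hAB

lemma Estimable.rho_pos {X A : Finset (Vec d)} (h : Estimable X A) {y : Vec d} (hy : y ∈ A)
    (hy0 : y ≠ 0) : 0 < rho X A := by
  have hX : X.Nonempty := by
    obtain ⟨p, hp, -⟩ := h
    by_contra hX
    rw [Finset.not_nonempty_iff_eq_empty] at hX
    simpa [hX] using hp.2
  obtain ⟨p, hp⟩ := exists_isOptimalDesign hX A
  rw [← ENNReal.ofReal_pos, ← hp.eq_rho h]
  exact (invNormSq_pos (posSemidef_designMatrix hp.1) hy0).trans_le (Finset.le_sup hy)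

lemma rho_diffs_mono {X S T : Finset (Vec d)} (hST : S ⊆ T) (hT : T ⊆ X) :
    rho X (diffs S) ≤ rho X (diffs T) := by
  rcases X.eq_empty_or_nonempty with rfl | hX
  · rw [Finset.subset_empty.mp hT] at hST ⊢
    rw [Finset.subset_empty.mp hST]
  · exact (estimable_diffs hX hT).rho_mono (diffs_mono hST)

lemma rho_diffs_pos {X S : Finset (Vec d)} (hS : S ⊆ X) (h : 1 < S.card) :
    0 < rho X (diffs S) := by
  obtain ⟨a, ha, b, hb, hab⟩ := Finset.one_lt_card.mp h
  exact (estimable_diffs ⟨a, hS ha⟩ hS).rho_pos (mem_diffs.mpr ⟨a, ha, b, hb, hab, rfl⟩)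
    (sub_ne_zero.mpr hab)

lemma diffsFrom_subset_diffs {xs : Vec d} {X : Finset (Vec d)} (h : xs ∈ X) :
    diffsFrom xs X ⊆ diffs X := by
  intro y hy
  obtain ⟨x, hx, rfl⟩ := Finset.mem_image.mp hy
  obtain ⟨hne, hx⟩ := Finset.mem_erase.mp hx
  exact mem_diffs.mpr ⟨xs, h, x, hx, hne.symm, rfl⟩

lemma rho_diffsFrom_pos {xs x : Vec d} {X : Finset (Vec d)} (h : xs ∈ X) (hx : x ∈ X)
    (hne : x ≠ xs) : 0 < rho X (diffsFrom xs X) :=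
  ((estimable_diffs ⟨xs, h⟩ subset_rfl).mono (diffsFrom_subset_diffs h)).rho_pos
    (Finset.mem_image.mpr ⟨x, Finset.mem_erase.mpr ⟨hne, hx⟩, rfl⟩) (sub_ne_zero.mpr hne.symm)

lemma rho_diffsFrom_le {xs : Vec d} {X : Finset (Vec d)} (h : xs ∈ X) :
    rho X (diffsFrom xs X) ≤ rho X (diffs X) :=
  (estimable_diffs ⟨xs, h⟩ subset_rfl).rho_mono (diffsFrom_subset_diffs h)

end Design

/-! ### Rounding by the lower barrier method. -/

section Rounding

variable {κ : Type*} [Fintype κ] [DecidableEq κ]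

/-- The scalar inequality behind the lower barrier argument of Batson, Spielman and Srivastava. -/
lemma barrier_sum_le {κ : Type*} [Fintype κ] (a : κ → ℝ) (ha : ∀ i, 0 < a i) (hs : ∑ i, (a i)⁻¹ ≤ 1) :
    (∀ i, 1 ≤ a i) ∧
    0 ≤ ∑ i, (a i - 1 / 2)⁻¹ - ∑ i, (a i)⁻¹ ∧
    (∑ i, (a i - 1 / 2)⁻¹ - ∑ i, (a i)⁻¹) * (1 + ∑ i, (a i - 1 / 2)⁻¹) ≤
      ∑ i, ((a i - 1 / 2) ^ 2)⁻¹ := by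
  have h1 : ∀ i, 1 ≤ a i := by
    intro i
    have : (a i)⁻¹ ≤ 1 := (Finset.single_le_sum (f := fun i => (a i)⁻¹)
      (fun j _ => (inv_pos.mpr (ha j)).le) (Finset.mem_univ i)).trans hs
    exact (inv_le_one₀ (ha i)).mp this
  have hb : ∀ i, 0 < a i - 1 / 2 := fun i => by linarith [h1 i]
  have aux₁ : ∀ {x : ℝ}, x ≠ 0 → x - 1 / 2 ≠ 0 →
      (x - 1 / 2)⁻¹ - x⁻¹ = x⁻¹ * (x - 1 / 2)⁻¹ / 2 := by
    intro x hx hy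
    rw [inv_sub_inv hy hx, ← mul_inv, sub_sub_cancel]
    ring
  have aux₂ : ∀ {x : ℝ}, x ≠ 0 → x - 1 / 2 ≠ 0 →
      ((x - 1 / 2) ^ 2)⁻¹ = x⁻¹ * (x - 1 / 2)⁻¹ + x⁻¹ * ((x - 1 / 2) ^ 2)⁻¹ / 2 := by
    intro x hx hy
    rw [sq, mul_inv]
    linear_combination (x - 1 / 2)⁻¹ * aux₁ hx hy
  have hg : ∑ i, (a i - 1 / 2)⁻¹ - ∑ i, (a i)⁻¹ =
      (∑ i, (a i)⁻¹ * (a i - 1 / 2)⁻¹) / 2 := by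
    rw [← Finset.sum_sub_distrib, Finset.sum_div]
    refine Finset.sum_congr rfl fun i _ => ?_
    exact aux₁ (ha i).ne' (hb i).ne'
  have hP : 0 ≤ ∑ i, (a i)⁻¹ * (a i - 1 / 2)⁻¹ :=
    Finset.sum_nonneg fun i _ => mul_nonneg (inv_pos.mpr (ha i)).le (inv_pos.mpr (hb i)).le
  refine ⟨h1, by rw [hg]; positivity, ?_⟩
  have hsq : ∑ i, ((a i - 1 / 2) ^ 2)⁻¹ = ∑ i, (a i)⁻¹ * (a i - 1 / 2)⁻¹ +
      (∑ i, (a i)⁻¹ * ((a i - 1 / 2) ^ 2)⁻¹) / 2 := by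
    rw [Finset.sum_div, ← Finset.sum_add_distrib]
    refine Finset.sum_congr rfl fun i _ => ?_
    exact aux₂ (ha i).ne' (hb i).ne'
  -- Write `b = a - 1/2`, `P = ∑ 1/(a b)` and `Q = ∑ 1/(a b²)`. The claim follows from `(P/2)(2 +
  -- P/2) ≤ P + Q/2`, that is `P² ≤ 2 Q`, and Cauchy–Schwarz with weights `1/a` of total at most 1
  -- gives `P² ≤ Q`.
  have hcs : (∑ i, (a i)⁻¹ * (a i - 1 / 2)⁻¹) ^ 2 ≤
      (∑ i, (a i)⁻¹) * ∑ i, (a i)⁻¹ * ((a i - 1 / 2) ^ 2)⁻¹ := by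
    refine Finset.sum_sq_le_sum_mul_sum_of_sq_le_mul _ (fun i _ => (inv_pos.mpr (ha i)).le)
      (fun i _ => ?_) fun i _ => ?_
    · have := ha i; have := hb i; positivity
    · rw [← inv_pow]; exact le_of_eq (by ring)
  have hQ : 0 ≤ ∑ i, (a i)⁻¹ * ((a i - 1 / 2) ^ 2)⁻¹ :=
    Finset.sum_nonneg fun i _ => by have := ha i; have := hb i; positivity
  have hsum : ∑ i, (a i - 1 / 2)⁻¹ ≤ (∑ i, (a i)⁻¹ * (a i - 1 / 2)⁻¹) / 2 + 1 := by linarith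
  rw [hg, hsq]
  nlinarith

/-- Diagonalization of a symmetric real matrix. -/
lemma exists_diagonalization {M : Matrix κ κ ℝ} (hM : M.IsHermitian) :
    ∃ V : Matrix κ κ ℝ, V * Vᵀ = 1 ∧ Vᵀ * V = 1 ∧ M = V * diagonal hM.eigenvalues * Vᵀ := by
  have h1 := Unitary.coe_star_mul_self hM.eigenvectorUnitary
  have h2 := Unitary.coe_mul_star_self hM.eigenvectorUnitary
  have h3 := hM.spectral_theorem
  rw [Unitary.conjStarAlgAut_apply] at h3
  rw [Unitary.coe_star] at h2
  rw [star_eq_conjTranspose, conjTranspose_eq_transpose_of_trivial] at h1 h2 h3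
  exact ⟨_, h2, h1, h3⟩

lemma conj_diagonal_mul {V : Matrix κ κ ℝ} (h : Vᵀ * V = 1) (a b : κ → ℝ) :
    V * diagonal a * Vᵀ * (V * diagonal b * Vᵀ) = V * diagonal (fun i => a i * b i) * Vᵀ := by
  calc V * diagonal a * Vᵀ * (V * diagonal b * Vᵀ)
      = V * diagonal a * (Vᵀ * V) * diagonal b * Vᵀ := by simp only [Matrix.mul_assoc]
    _ = _ := by rw [h, Matrix.mul_one, Matrix.mul_assoc V, diagonal_mul_diagonal]

lemma trace_conj_diagonal {V : Matrix κ κ ℝ} (h : Vᵀ * V = 1) (a : κ → ℝ) :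
    (V * diagonal a * Vᵀ).trace = ∑ i, a i := by
  rw [Matrix.mul_assoc, trace_mul_comm, Matrix.mul_assoc, h, Matrix.mul_one, trace_diagonal]

/-- Lowering a matrix with `tr B⁻¹ ≤ 1` by half the identity. -/
lemma barrier_shift {B : Matrix κ κ ℝ} (hB : B.PosDef) (ht : B⁻¹.trace ≤ 1) :
    (B - (1 / 2 : ℝ) • 1).PosDef ∧
    0 ≤ (B - (1 / 2 : ℝ) • 1)⁻¹.trace - B⁻¹.trace ∧
    ((B - (1 / 2 : ℝ) • 1)⁻¹.trace - B⁻¹.trace) * (1 + (B - (1 / 2 : ℝ) • 1)⁻¹.trace) ≤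
      ((B - (1 / 2 : ℝ) • 1)⁻¹ * (B - (1 / 2 : ℝ) • 1)⁻¹).trace := by
  obtain ⟨V, hV1, hV2, hBV⟩ := exists_diagonalization hB.1
  set a := hB.1.eigenvalues with ha_def
  have ha : ∀ i, 0 < a i := hB.eigenvalues_pos
  have hBi : B⁻¹ = V * diagonal (fun i => (a i)⁻¹) * Vᵀ := by
    refine inv_eq_right_inv ?_
    conv_lhs => rw [hBV]
    rw [conj_diagonal_mul hV2]
    simp only [mul_inv_cancel₀ (ha _).ne', diagonal_one, Matrix.mul_one, hV1]
  have htB : B⁻¹.trace = ∑ i, (a i)⁻¹ := by rw [hBi, trace_conj_diagonal hV2]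
  obtain ⟨h1, h2, h3⟩ := barrier_sum_le a ha (htB ▸ ht)
  have hb : ∀ i, 0 < a i - 1 / 2 := fun i => by linarith [h1 i]
  have hC : B - (1 / 2 : ℝ) • 1 = V * diagonal (fun i => a i - 1 / 2) * Vᵀ := by
    have : diagonal (fun i => a i - 1 / 2) = diagonal a - (1 / 2 : ℝ) • (1 : Matrix κ κ ℝ) := by
      rw [smul_one_eq_diagonal, diagonal_sub]
    rw [this, Matrix.mul_sub, Matrix.sub_mul, ← hBV, mul_smul_comm, smul_mul_assoc,
      Matrix.mul_one, hV1]
  have hCi : (B - (1 / 2 : ℝ) • 1)⁻¹ = V * diagonal (fun i => (a i - 1 / 2)⁻¹) * Vᵀ := by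
    refine inv_eq_right_inv ?_
    rw [hC, conj_diagonal_mul hV2]
    simp only [mul_inv_cancel₀ (hb _).ne', diagonal_one, Matrix.mul_one, hV1]
  refine ⟨?_, ?_, ?_⟩
  · rw [hC]
    have := (PosDef.diagonal (fun i => hb i) : (diagonal fun i => a i - 1 / 2).PosDef)
    have h' := this.mul_mul_conjTranspose_same (B := V) ?_
    · simpa using h'
    · refine vecMul_injective_of_isUnit (IsUnit.of_mul_eq_one _ hV1)
  · rw [htB, hCi, trace_conj_diagonal hV2]; exact h2
  · rw [htB, hCi, trace_conj_diagonal hV2, conj_diagonal_mul hV2, trace_conj_diagonal hV2]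
    simpa only [inv_pow, ← sq] using h3

lemma trace_mul_vecMulVec_self {n : Type*} [Fintype n] (K : Matrix n n ℝ) (z : n → ℝ) :
    (K * vecMulVec z z).trace = z ⬝ᵥ K *ᵥ z := by
  rw [mul_vecMulVec, trace_vecMulVec, dotProduct_comm]

/-- The Sherman–Morrison formula. -/
lemma inv_add_vecMulVec {C : Matrix κ κ ℝ} (hC : C.PosDef) (z : κ → ℝ) :
    (C + vecMulVec z z)⁻¹ = C⁻¹ -
      (1 + z ⬝ᵥ C⁻¹ *ᵥ z)⁻¹ • vecMulVec (C⁻¹ *ᵥ z) (C⁻¹ *ᵥ z) := by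
  have hq : 0 ≤ z ⬝ᵥ C⁻¹ *ᵥ z := posSemidef_quad_nonneg hC.inv.posSemidef z
  have hu : IsUnit C.det := (isUnit_iff_isUnit_det _).mp hC.isUnit
  have hsym : z ᵥ* C⁻¹ = C⁻¹ *ᵥ z := by
    rw [← mulVec_transpose]; congr 1
    simpa [Matrix.IsHermitian] using hC.inv.1
  refine inv_eq_right_inv ?_
  rw [Matrix.add_mul, Matrix.mul_sub, Matrix.mul_sub, mul_nonsing_inv _ hu, mul_smul_comm,
    mul_smul_comm, mul_vecMulVec, mulVec_mulVec, mul_nonsing_inv _ hu, one_mulVec,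
    vecMulVec_mul, hsym, vecMulVec_mul_vecMulVec, vecMulVec_smul]
  rw [show ∀ P Q R : Matrix κ κ ℝ, 1 - P + (Q - R) = 1 + (Q - P - R) by intros; abel]
  rw [smul_smul]
  have : ∀ W : Matrix κ κ ℝ, W - (1 + z ⬝ᵥ C⁻¹ *ᵥ z)⁻¹ • W -
      ((1 + z ⬝ᵥ C⁻¹ *ᵥ z)⁻¹ * (z ⬝ᵥ C⁻¹ *ᵥ z)) • W = 0 := by
    intro W
    have h : (1 + z ⬝ᵥ C⁻¹ *ᵥ z)⁻¹ + (1 + z ⬝ᵥ C⁻¹ *ᵥ z)⁻¹ * (z ⬝ᵥ C⁻¹ *ᵥ z) = 1 := by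
      field_simp
    rw [sub_sub, ← add_smul, h, one_smul, sub_self]
  rw [this, add_zero]

variable {ι : Type*}

/-- Averaging over an isotropic design turns a quadratic form into a trace, so a trace inequality
yields a good point. -/
lemma sum_mul_quad_of_isotropic {X : Finset ι} {p : ι → ℝ} {z : ι → κ → ℝ}
    (hz : ∑ x ∈ X, p x • vecMulVec (z x) (z x) = 1) (K : Matrix κ κ ℝ) :
    ∑ x ∈ X, p x * (z x ⬝ᵥ K *ᵥ z x) = K.trace := by
  conv_rhs => rw [← Matrix.mul_one K, ← hz, Matrix.mul_sum, trace_sum]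
  refine Finset.sum_congr rfl fun x _ => ?_
  rw [mul_smul_comm, trace_smul, trace_mul_vecMulVec_self, smul_eq_mul]

/-- One step of the lower barrier argument. -/
lemma barrier_step {X : Finset ι} {p : ι → ℝ} {z : ι → κ → ℝ} (hp : ∀ x ∈ X, 0 ≤ p x)
    (hp1 : ∑ x ∈ X, p x = 1) (hz : ∑ x ∈ X, p x • vecMulVec (z x) (z x) = 1)
    {B : Matrix κ κ ℝ} (hB : B.PosDef) (ht : B⁻¹.trace ≤ 1) :
    ∃ x ∈ X, (B - (1 / 2 : ℝ) • 1 + vecMulVec (z x) (z x)).PosDef ∧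
      (B - (1 / 2 : ℝ) • 1 + vecMulVec (z x) (z x))⁻¹.trace ≤ 1 := by
  obtain ⟨hC, h2, h3⟩ := barrier_shift hB ht
  set C := B - (1 / 2 : ℝ) • (1 : Matrix κ κ ℝ)
  set g := C⁻¹.trace - B⁻¹.trace
  have hX : X.Nonempty := by
    by_contra h
    rw [Finset.not_nonempty_iff_eq_empty] at h
    simp [h] at hp1
  have hsum : ∑ x ∈ X, 0 ≤
      ∑ x ∈ X, p x * (z x ⬝ᵥ (C⁻¹ * C⁻¹) *ᵥ z x - g * (1 + z x ⬝ᵥ C⁻¹ *ᵥ z x)) := by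
    have : ∑ x ∈ X, p x * (z x ⬝ᵥ (C⁻¹ * C⁻¹) *ᵥ z x - g * (1 + z x ⬝ᵥ C⁻¹ *ᵥ z x)) =
        (C⁻¹ * C⁻¹).trace - g * (1 + C⁻¹.trace) := by
      rw [← sum_mul_quad_of_isotropic hz (C⁻¹ * C⁻¹)]
      conv_rhs => rw [← sum_mul_quad_of_isotropic hz C⁻¹, ← hp1]
      rw [← Finset.sum_add_distrib, Finset.mul_sum, ← Finset.sum_sub_distrib]
      exact Finset.sum_congr rfl fun x _ => by ring
    rw [this, Finset.sum_const_zero]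
    linarith
  -- By Sherman–Morrison, adding `z zᵀ` to `C` lowers `tr C⁻¹` by `zᵀC⁻²z / (1 + zᵀC⁻¹z)`. This must
  -- make up for the increase `g` caused by the shift. The required inequality holds on average over
  -- `p`, hence at some point.
  have hex : ∃ x ∈ X, 0 ≤ z x ⬝ᵥ (C⁻¹ * C⁻¹) *ᵥ z x - g * (1 + z x ⬝ᵥ C⁻¹ *ᵥ z x) := by
    by_contra! hcon
    have hle : ∀ x ∈ X, p x * (z x ⬝ᵥ (C⁻¹ * C⁻¹) *ᵥ z x - g * (1 + z x ⬝ᵥ C⁻¹ *ᵥ z x)) ≤ 0 :=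
      fun x hx => mul_nonpos_of_nonneg_of_nonpos (hp x hx) (hcon x hx).le
    rw [Finset.sum_const_zero] at hsum
    have heq := (Finset.sum_eq_zero_iff_of_nonpos hle).mp
      (le_antisymm (Finset.sum_nonpos hle) hsum)
    have : ∑ x ∈ X, p x = 0 := Finset.sum_eq_zero fun x hx => by
      rcases mul_eq_zero.mp (heq x hx) with h | h
      · exact h
      · exact absurd h (hcon x hx).ne
    linarith
  obtain ⟨x, hx, hf⟩ := hex
  refine ⟨x, hx, hC.add_posSemidef (posSemidef_vecMulVec _), ?_⟩
  have hq : 0 ≤ z x ⬝ᵥ C⁻¹ *ᵥ z x := posSemidef_quad_nonneg hC.inv.posSemidef _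
  rw [inv_add_vecMulVec hC, trace_sub, trace_smul, trace_vecMulVec, smul_eq_mul]
  have hu : (C⁻¹ *ᵥ z x) ⬝ᵥ (C⁻¹ *ᵥ z x) = z x ⬝ᵥ (C⁻¹ * C⁻¹) *ᵥ z x := by
    rw [← mulVec_mulVec, isHermitian_dotProduct_comm hC.inv.1, dotProduct_comm]
  rw [hu]
  have : g ≤ (1 + z x ⬝ᵥ C⁻¹ *ᵥ z x)⁻¹ * (z x ⬝ᵥ (C⁻¹ * C⁻¹) *ᵥ z x) := by
    rw [inv_mul_eq_div, le_div_iff₀ (by linarith)]; linarith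
  have hg : g = C⁻¹.trace - B⁻¹.trace := rfl
  linarith

/-- The invariant is `tr B⁻¹ ≤ 1`. It starts at `B = dim • 1`, whose inverse has trace 1 (or 0 in
dimension zero), and each step moves the barrier by `1/2` and adds one point. Positivity of the
final matrix bounds the sample matrix below by `N/2 - dim`, which is at least `N/4` once `N ≥ 4
dim`. -/
lemma barrier_iterate {X : Finset ι} {p : ι → ℝ} {z : ι → κ → ℝ} (hp : ∀ x ∈ X, 0 ≤ p x)
    (hp1 : ∑ x ∈ X, p x = 1) (hz : ∑ x ∈ X, p x • vecMulVec (z x) (z x) = 1) (N : ℕ) :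
    ∃ x : Fin N → ι, (∀ i, x i ∈ X) ∧
      (((Fintype.card κ : ℝ) - N / 2) • (1 : Matrix κ κ ℝ) +
        ∑ i, vecMulVec (z (x i)) (z (x i))).PosDef ∧
      (((Fintype.card κ : ℝ) - N / 2) • (1 : Matrix κ κ ℝ) +
        ∑ i, vecMulVec (z (x i)) (z (x i)))⁻¹.trace ≤ 1 := by
  induction N with
  | zero =>
    refine ⟨Fin.elim0, fun i => i.elim0, ?_, ?_⟩
    · simp only [Nat.cast_zero, zero_div, sub_zero, Finset.univ_eq_empty, Finset.sum_empty,
        add_zero, smul_one_eq_diagonal]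
      refine PosDef.diagonal fun i => ?_
      have : Nonempty κ := ⟨i⟩
      exact_mod_cast Fintype.card_pos
    · simp only [Nat.cast_zero, zero_div, sub_zero, Finset.univ_eq_empty, Finset.sum_empty,
        add_zero]
      rcases isEmpty_or_nonempty κ with h | h
      · simp [Matrix.trace]
      · have hk : (Fintype.card κ : ℝ) ≠ 0 := by exact_mod_cast Fintype.card_pos.ne'
        rw [inv_eq_right_inv (B := (Fintype.card κ : ℝ)⁻¹ • (1 : Matrix κ κ ℝ))
          (by rw [smul_mul_smul_comm, mul_inv_cancel₀ hk, one_smul, Matrix.mul_one]),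
          trace_smul, trace_one, smul_eq_mul, inv_mul_cancel₀ hk]
  | succ N ih =>
    obtain ⟨x, hx, hB, ht⟩ := ih
    obtain ⟨y, hy, h1, h2⟩ := barrier_step hp hp1 hz hB ht
    refine ⟨Fin.snoc x y, fun i => ?_, ?_⟩
    · refine Fin.lastCases ?_ (fun j => ?_) i
      · simpa using hy
      · simpa using hx j
    · have : ((Fintype.card κ : ℝ) - ((N + 1 : ℕ) : ℝ) / 2) • (1 : Matrix κ κ ℝ) +
          ∑ i, vecMulVec (z ((Fin.snoc x y : Fin (N + 1) → ι) i))
            (z ((Fin.snoc x y : Fin (N + 1) → ι) i)) =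
          ((Fintype.card κ : ℝ) - N / 2) • (1 : Matrix κ κ ℝ) +
          ∑ i, vecMulVec (z (x i)) (z (x i)) - (1 / 2 : ℝ) • 1 + vecMulVec (z y) (z y) := by
        rw [Fin.sum_univ_castSucc]
        simp only [Fin.snoc_castSucc, Fin.snoc_last]
        rw [show (Fintype.card κ : ℝ) - ((N + 1 : ℕ) : ℝ) / 2 =
          (Fintype.card κ - N / 2) - 1 / 2 by push_cast; ring, sub_smul _ (1 / 2 : ℝ)]
        abel
      rw [this]
      exact ⟨h1, h2⟩

/-- An isotropic design has, for every `N ≥ 4 dim`, a sample of size `N` whose sample matrix is at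
least `N / 4` times the identity. -/
lemma exists_sample_of_isotropic {X : Finset ι} {p : ι → ℝ} {z : ι → κ → ℝ}
    (hp : ∀ x ∈ X, 0 ≤ p x) (hp1 : ∑ x ∈ X, p x = 1)
    (hz : ∑ x ∈ X, p x • vecMulVec (z x) (z x) = 1) (N : ℕ) (hN : 4 * Fintype.card κ ≤ N) :
    ∃ x : Fin N → ι, (∀ i, x i ∈ X) ∧
      ∀ w : κ → ℝ, N / 4 * (w ⬝ᵥ w) ≤ ∑ i, (z (x i) ⬝ᵥ w) ^ 2 := by
  obtain ⟨x, hx, hB, -⟩ := barrier_iterate hp hp1 hz N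
  refine ⟨x, hx, fun w => ?_⟩
  have h := posSemidef_quad_nonneg hB.posSemidef w
  rw [add_mulVec, dotProduct_add, sum_mulVec, dotProduct_sum, smul_mulVec, one_mulVec,
    dotProduct_smul, smul_eq_mul] at h
  simp only [quad_vecMulVec] at h
  have hw : 0 ≤ w ⬝ᵥ w := by simpa using dotProduct_star_self_nonneg w
  have hN' : 4 * (Fintype.card κ : ℝ) ≤ N := by exact_mod_cast hN
  nlinarith

/-- Every design can be rounded to a sample of size `N ≥ 4 d` that loses a factor four. -/
lemma exists_sample_of_isDesign {d : ℕ} {X : Finset (Vec d)} {p : Vec d → ℝ}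
    (hp : IsDesign X p) (N : ℕ) (hN : 4 * d ≤ N) :
    ∃ x : Fin N → Vec d, (∀ i, x i ∈ X) ∧
      ∀ v, N / 4 * (v ⬝ᵥ designMatrix X p *ᵥ v) ≤ v ⬝ᵥ sampleMatrix x *ᵥ v := by
  classical
  have hA := posSemidef_designMatrix hp
  obtain ⟨V, hV1, hV2, hAV⟩ := exists_diagonalization hA.1
  set a := hA.1.eigenvalues with ha_def
  have ha : ∀ i, 0 ≤ a i := hA.eigenvalues_nonneg
  have hdiag : Vᵀ * designMatrix X p * V = diagonal a := by
    rw [hAV, show Vᵀ * (V * diagonal a * Vᵀ) * V = (Vᵀ * V) * diagonal a * (Vᵀ * V) by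
      simp only [Matrix.mul_assoc], hV2, Matrix.one_mul, Matrix.mul_one]
  have hentry : ∀ i j, ∑ x ∈ X, p x * ((Vᵀ *ᵥ x) i * (Vᵀ *ᵥ x) j) = diagonal a i j := by
    intro i j
    rw [← hdiag, designMatrix, Matrix.mul_sum, Matrix.sum_mul, Matrix.sum_apply]
    refine Finset.sum_congr rfl fun x _ => ?_
    rw [mul_smul_comm, smul_mul_assoc, mul_vecMulVec, vecMulVec_mul, ← mulVec_transpose,
      Matrix.smul_apply, vecMulVec_apply, smul_eq_mul]
  -- Points of positive weight lie in the range of the design matrix. Dropping the others allows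
  -- whitening on the nonzero eigenvalues only, even if the matrix is singular.
  set X' := {x ∈ X | p x ≠ 0} with hX'
  have hsub : ∀ f : Vec d → ℝ, ∑ x ∈ X', p x * f x = ∑ x ∈ X, p x * f x := by
    intro f
    refine Finset.sum_filter_of_ne fun x _ h h0 => h (by rw [h0, zero_mul])
  have hker : ∀ x ∈ X', ∀ i, a i = 0 → (Vᵀ *ᵥ x) i = 0 := by
    intro x hx i hi
    obtain ⟨hxX, hx0⟩ := Finset.mem_filter.mp hx
    have h := hentry i i
    rw [diagonal_apply_eq, hi, Finset.sum_eq_zero_iff_of_nonneg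
      (fun x hx => mul_nonneg (hp.1 x hx) (mul_self_nonneg _))] at h
    rcases mul_eq_zero.mp (h x hxX) with h | h
    · exact absurd h hx0
    · exact mul_self_eq_zero.mp h
  let κ := {i : Fin d // a i ≠ 0}
  let z : Vec d → κ → ℝ := fun x i => (Vᵀ *ᵥ x) i / √(a i)
  have hsq : ∀ i : κ, √(a i) * √(a i) = a i := fun i => Real.mul_self_sqrt (ha i)
  have hz : ∑ x ∈ X', p x • vecMulVec (z x) (z x) = 1 := by
    ext i j
    rw [Matrix.sum_apply]
    have h1 : ∑ x ∈ X', (p x • vecMulVec (z x) (z x)) i j =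
        (∑ x ∈ X, p x * ((Vᵀ *ᵥ x) i * (Vᵀ *ᵥ x) j)) / (√(a i) * √(a j)) := by
      rw [← hsub, Finset.sum_div]
      refine Finset.sum_congr rfl fun x _ => ?_
      simp only [Matrix.smul_apply, vecMulVec_apply, smul_eq_mul, z]
      rw [div_mul_div_comm, mul_div_assoc']
    rw [h1, hentry]
    by_cases hij : i = j
    · subst hij
      rw [diagonal_apply_eq, hsq, one_apply_eq, div_self i.2]
    · rw [diagonal_apply_ne _ (fun h => hij (Subtype.ext h)), one_apply_ne hij, zero_div]
  have hdot : ∀ x ∈ X', ∀ v : Vec d,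
      x ⬝ᵥ v = z x ⬝ᵥ fun i : κ => √(a i) * (Vᵀ *ᵥ v) i := by
    intro x hx v
    have h1 : x ⬝ᵥ v = (Vᵀ *ᵥ x) ⬝ᵥ (Vᵀ *ᵥ v) := by
      rw [dotProduct_comm, dotProduct_comm (Vᵀ *ᵥ x), dotProduct_mulVec, vecMul_transpose,
        mulVec_mulVec, hV1, one_mulVec]
    rw [h1]
    simp only [dotProduct]
    have h2 : ∀ i : κ, (Vᵀ *ᵥ x) i / √(a i) * (√(a i) * (Vᵀ *ᵥ v) i) =
        (Vᵀ *ᵥ x) i * (Vᵀ *ᵥ v) i := fun i => by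
      rw [← mul_assoc, div_mul_cancel₀]
      exact (Real.sqrt_pos.mpr (lt_of_le_of_ne (ha i) i.2.symm)).ne'
    simp only [z, h2]
    rw [← Finset.sum_subtype {i | a i ≠ 0} (by simp) fun i => (Vᵀ *ᵥ x) i * (Vᵀ *ᵥ v) i]
    refine (Finset.sum_filter_of_ne fun i _ h => ?_).symm
    exact fun h0 => h (by rw [hker x hx i h0, zero_mul])
  have hp1 : ∑ x ∈ X', p x = 1 := by
    have := hsub fun _ => 1
    simp only [mul_one] at this
    rw [this, hp.2]
  have hcard : 4 * Fintype.card κ ≤ N := by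
    refine le_trans ?_ hN
    have := Fintype.card_subtype_le fun i : Fin d => a i ≠ 0
    rw [Fintype.card_fin] at this
    exact Nat.mul_le_mul_left 4 this
  obtain ⟨x, hx, h⟩ := exists_sample_of_isotropic
    (fun x hx => hp.1 x (Finset.mem_filter.mp hx).1) hp1 hz N hcard
  refine ⟨x, fun i => (Finset.mem_filter.mp (hx i)).1, fun v => ?_⟩
  rw [quad_sampleMatrix, quad_designMatrix, ← hsub fun x => (x ⬝ᵥ v) ^ 2]
  have h1 : ∑ x ∈ X', p x * (x ⬝ᵥ v) ^ 2 = (fun i : κ => √(a i) * (Vᵀ *ᵥ v) i) ⬝ᵥ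
      fun i : κ => √(a i) * (Vᵀ *ᵥ v) i := by
    set w := fun i : κ => √(a i) * (Vᵀ *ᵥ v) i
    have h2 : w ⬝ᵥ (∑ x ∈ X', p x • vecMulVec (z x) (z x)) *ᵥ w = w ⬝ᵥ w := by
      rw [hz, one_mulVec]
    rw [← h2, sum_mulVec, dotProduct_sum]
    refine Finset.sum_congr rfl fun x hx => ?_
    rw [smul_mulVec, dotProduct_smul, quad_vecMulVec, smul_eq_mul, hdot x hx]
  rw [h1]
  refine (h _).trans (le_of_eq (Finset.sum_congr rfl fun i _ => ?_))
  rw [hdot _ (hx i)]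

/-- The sample dominates `N/4` times the design matrix in the Loewner order, which settles all
directions at once, whatever `Y` is. -/
theorem exists_isRounding (d : ℕ) : ∃ rnd : Rounding d, IsRounding rnd := by
  classical
  have h : ∀ (p : Vec d → ℝ) (N : ℕ) (X Y : Finset (Vec d)), ∃ x : Fin N → Vec d,
      IsDesign X p → 4 * d ≤ N → (∀ i, x i ∈ X) ∧
        ∀ v, N / 4 * (v ⬝ᵥ designMatrix X p *ᵥ v) ≤ v ⬝ᵥ sampleMatrix x *ᵥ v := by
    intro p N X Y
    by_cases hc : IsDesign X p ∧ 4 * d ≤ N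
    · obtain ⟨x, hx⟩ := exists_sample_of_isDesign hc.1 N hc.2
      exact ⟨x, fun _ _ => hx⟩
    · exact ⟨fun _ => 0, fun h1 h2 => absurd ⟨h1, h2⟩ hc⟩
  choose rnd hrnd using h
  refine ⟨rnd, fun p N X Y hp hN => ⟨(hrnd p N X Y hp hN).1, ?_⟩⟩
  rcases Y.eq_empty_or_nonempty with rfl | hY
  · simp [maxInvNormSq]
  obtain ⟨y, hy, he⟩ := Finset.exists_mem_eq_sup Y hY (invNormSq (sampleMatrix (rnd p N X Y)))
  have h1 := invNormSq_anti (posSemidef_designMatrix hp) (posSemidef_sampleMatrix (rnd p N X Y))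
    (by positivity : (0 : ℝ) ≤ N / 4) (hrnd p N X Y hp hN).2 y
  have h2 : (N : ℝ≥0∞) = 4 * ENNReal.ofReal (N / 4) := by
    rw [show (4 : ℝ≥0∞) = ENNReal.ofReal 4 by norm_num, ← ENNReal.ofReal_mul (by norm_num),
      mul_div_cancel₀ _ (by norm_num : (4 : ℝ) ≠ 0), ENNReal.ofReal_natCast]
  rw [maxInvNormSq, he, h2, mul_assoc]
  exact mul_le_mul_right (h1.trans (Finset.le_sup hy)) 4

end Rounding

/-! ### Instance complexity and batch complexity. -/

section Instance

variable {d : ℕ} {X : Finset (Vec d)} {θ xs : Vec d} {Δ₂ : ℝ}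

@[simp] lemma gap_self (θ xs : Vec d) : gap θ xs xs = 0 := by simp [gap]

lemma minGap_le_gap (hΔ : IsLeast ((gap θ xs) '' {x | x ∈ X ∧ x ≠ xs}) Δ₂) {x : Vec d}
    (hx : x ∈ X) (hne : x ≠ xs) : Δ₂ ≤ gap θ xs x :=
  hΔ.2 ⟨x, ⟨hx, hne⟩, rfl⟩

lemma exists_gap_eq_minGap (hΔ : IsLeast ((gap θ xs) '' {x | x ∈ X ∧ x ≠ xs}) Δ₂) :
    ∃ x ∈ X, x ≠ xs ∧ gap θ xs x = Δ₂ := by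
  obtain ⟨x, ⟨hx, hne⟩, h⟩ := hΔ.1
  exact ⟨x, hx, hne, h⟩

lemma gap_nonneg (hΔ : IsLeast ((gap θ xs) '' {x | x ∈ X ∧ x ≠ xs}) Δ₂) (h0 : 0 < Δ₂)
    {x : Vec d} (hx : x ∈ X) : 0 ≤ gap θ xs x := by
  by_cases h : x = xs
  · simp [h]
  · exact h0.le.trans (minGap_le_gap hΔ hx h)

/-- The value of the design `p` for the instance complexity. -/
noncomputable def psiValue (X : Finset (Vec d)) (θ xs : Vec d) (p : Vec d → ℝ) : ℝ≥0∞ :=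
  (X.erase xs).sup fun x =>
    invNormSq (designMatrix X p) (x - xs) / ENNReal.ofReal (gap θ xs x ^ 2)

lemma psiStar_nonneg (X : Finset (Vec d)) (θ xs : Vec d) : 0 ≤ psiStar X θ xs :=
  ENNReal.toReal_nonneg

lemma ofReal_psiStar (hxs : xs ∈ X) (hΔ : IsLeast ((gap θ xs) '' {x | x ∈ X ∧ x ≠ xs}) Δ₂)
    (h0 : 0 < Δ₂) :
    ENNReal.ofReal (psiStar X θ xs) =
      ⨅ (p : Vec d → ℝ) (_ : IsDesign X p), psiValue X θ xs p := by
  refine ENNReal.ofReal_toReal (ne_of_lt ?_)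
  refine (iInf₂_le _ (isDesign_uniform ⟨xs, hxs⟩)).trans_lt ?_
  refine (Finset.sup_lt_iff (by simp)).mpr fun x hx => ?_
  obtain ⟨hne, hx⟩ := Finset.mem_erase.mp hx
  refine ENNReal.div_lt_top (invNormSq_sub_uniform_lt_top hx hxs).ne (ne_of_gt ?_)
  rw [ENNReal.ofReal_pos]
  have := h0.trans_le (minGap_le_gap hΔ hx hne)
  positivity

/-- If the arms of `S` have gap at most `c`, then `ρ(𝒴(S)) ≤ 4 c² ψ*`. -/
lemma rho_diffs_le_psiStar (hxs : xs ∈ X)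
    (hΔ : IsLeast ((gap θ xs) '' {x | x ∈ X ∧ x ≠ xs}) Δ₂) (h0 : 0 < Δ₂)
    {S : Finset (Vec d)} (hS : S ⊆ X) {c : ℝ} (hc : 0 < c) (h : ∀ x ∈ S, gap θ xs x ≤ c) :
    rho X (diffs S) ≤ 4 * c ^ 2 * psiStar X θ xs := by
  have hX : X.Nonempty := ⟨xs, hxs⟩
  have key : ∀ p, IsDesign X p →
      maxInvNormSq (designMatrix X p) (diffs S) ≤
        psiValue X θ xs p * ENNReal.ofReal (4 * c ^ 2) := by
    intro p hp
    have hM := posSemidef_designMatrix hp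
    have h1 : ∀ x ∈ S, invNormSq (designMatrix X p) (x - xs) ≤
        psiValue X θ xs p * ENNReal.ofReal (c ^ 2) := by
      intro x hx
      by_cases hne : x = xs
      · rw [hne, sub_self, invNormSq_of_mulVec_eq hM.1 (mulVec_zero _)]
        simp
      · have hg := h0.trans_le (minGap_le_gap hΔ (hS hx) hne)
        have h2 : invNormSq (designMatrix X p) (x - xs) / ENNReal.ofReal (gap θ xs x ^ 2) ≤
            psiValue X θ xs p :=
          Finset.le_sup (f := fun x => invNormSq (designMatrix X p) (x - xs) /
            ENNReal.ofReal (gap θ xs x ^ 2)) (Finset.mem_erase.mpr ⟨hne, hS hx⟩)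
        rw [ENNReal.div_le_iff (ENNReal.ofReal_pos.mpr (by positivity)).ne'
          ENNReal.ofReal_ne_top] at h2
        refine h2.trans (mul_le_mul_right (ENNReal.ofReal_le_ofReal ?_) _)
        exact pow_le_pow_left₀ hg.le (h x hx) 2
    refine Finset.sup_le fun y hy => ?_
    obtain ⟨a, ha, b, hb, -, rfl⟩ := mem_diffs.mp hy
    -- Comparing both arms with `xs` costs `2 (c² + c²)`, hence the 4.
    rw [show a - b = (a - xs) - (b - xs) by abel]
    refine (invNormSq_sub_le hM _ _).trans ?_
    refine (mul_le_mul_right (add_le_add (h1 a ha) (h1 b hb)) 2).trans (le_of_eq ?_)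
    rw [ENNReal.ofReal_mul (by norm_num), ENNReal.ofReal_ofNat]
    ring
  have hk : ENNReal.ofReal (4 * c ^ 2) ≠ 0 := (ENNReal.ofReal_pos.mpr (by positivity)).ne'
  have h2 : ENNReal.ofReal (rho X (diffs S)) ≤
      ENNReal.ofReal (psiStar X θ xs) * ENNReal.ofReal (4 * c ^ 2) := by
    rw [← ENNReal.div_le_iff hk ENNReal.ofReal_ne_top, ofReal_psiStar hxs hΔ h0]
    refine le_iInf₂ fun p hp => ?_
    rw [ENNReal.div_le_iff hk ENNReal.ofReal_ne_top, (estimable_diffs hX hS).ofReal_rho]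
    exact (iInf₂_le p hp).trans (key p hp)
  rw [← ENNReal.ofReal_mul (psiStar_nonneg X θ xs),
    ENNReal.ofReal_le_ofReal_iff (mul_nonneg (psiStar_nonneg X θ xs) (by positivity))] at h2
  linarith

/-- The source of the numerical constants: it is used with `c = 15`, `6` and `30`, giving 900, 144
and 3600. -/
lemma mul_rho_diffs_le_psiStar (hxs : xs ∈ X)
    (hΔ : IsLeast ((gap θ xs) '' {x | x ∈ X ∧ x ≠ xs}) Δ₂) (h0 : 0 < Δ₂)
    {S : Finset (Vec d)} (hS : S ⊆ X) {c L : ℝ} (hc : 0 < c) (hL : 0 < L)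
    (h : ∀ x ∈ S, gap θ xs x ≤ c / √L) :
    L * rho X (diffs S) ≤ 4 * c ^ 2 * psiStar X θ xs := by
  have h1 := rho_diffs_le_psiStar hxs hΔ h0 hS (div_pos hc (Real.sqrt_pos.mpr hL)) h
  rw [div_pow, Real.sq_sqrt hL.le] at h1
  calc L * rho X (diffs S) ≤ L * (4 * (c ^ 2 / L) * psiStar X θ xs) :=
        mul_le_mul_of_nonneg_left h1 hL.le
    _ = 4 * c ^ 2 * psiStar X θ xs := by field_simp

lemma sqrt_four_pow (t : ℕ) : √((4 : ℝ) ^ t) = 2 ^ t := by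
  rw [show (4 : ℝ) ^ t = (2 ^ t) ^ 2 by rw [← pow_mul, mul_comm, pow_mul]; norm_num]
  exact Real.sqrt_sq (by positivity)

/-- The arms of gap at most `15 / 2 ^ t`. -/
noncomputable def nearArms (X : Finset (Vec d)) (θ xs : Vec d) (t : ℕ) : Finset (Vec d) :=
  {x ∈ X | gap θ xs x ≤ 15 / 2 ^ t}

lemma mem_nearArms {t : ℕ} {x : Vec d} :
    x ∈ nearArms X θ xs t ↔ x ∈ X ∧ gap θ xs x ≤ 15 / 2 ^ t := Finset.mem_filter

lemma nearArms_subset (t : ℕ) : nearArms X θ xs t ⊆ X := Finset.filter_subset _ _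

lemma mem_farArms_pow {t : ℕ} {x : Vec d} :
    x ∈ farArms X θ xs (4 ^ t) ↔ x ∈ X ∧ 15 / 2 ^ t < gap θ xs x := by
  rw [farArms, Finset.mem_filter, sqrt_four_pow]

lemma sdiff_farArms (t : ℕ) : X \ farArms X θ xs (4 ^ t) = nearArms X θ xs t := by
  ext x
  rw [Finset.mem_sdiff, mem_farArms_pow, mem_nearArms]
  constructor
  · rintro ⟨h, h'⟩; exact ⟨h, not_lt.mp fun hlt => h' ⟨h, hlt⟩⟩
  · rintro ⟨h, h'⟩; exact ⟨h, fun hh => absurd hh.2 (not_lt.mpr h')⟩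

/-- For `t ≤ T` an arm of gap above `15 / 2^t` is already far at level `T`, so the restriction to
far arms has no effect. -/
lemma sdiff_filter_farArms {t T : ℕ} (h : t ≤ T) :
    X \ {x ∈ farArms X θ xs (4 ^ T) | 15 * (2 ^ t : ℝ)⁻¹ < gap θ xs x} =
      nearArms X θ xs t := by
  rw [← sdiff_farArms]
  congr 1
  ext x
  rw [Finset.mem_filter, mem_farArms_pow, mem_farArms_pow, ← div_eq_mul_inv]
  constructor
  · rintro ⟨⟨h1, -⟩, h2⟩; exact ⟨h1, h2⟩
  · rintro ⟨h1, h2⟩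
    refine ⟨⟨h1, lt_of_le_of_lt ?_ h2⟩, h2⟩
    gcongr
    norm_num

/-- `∑_{t ≤ T} 4^t ρ(𝒴({x : Δ_x ≤ 15 / 2^t}))`. -/
noncomputable def nearSum (X : Finset (Vec d)) (θ xs : Vec d) (T : ℕ) : ℝ :=
  ∑ t ∈ Finset.Icc 1 T, 4 ^ t * rho X (diffs (nearArms X θ xs t))

/-- The next budget `L̂` after the exponent `T`. -/
noncomputable def nextBudget (X : Finset (Vec d)) (θ xs : Vec d) (T : ℕ) : ℝ :=
  4 * 4 ^ T + nearSum X θ xs T / rho X (diffs (nearArms X θ xs T))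

lemma Tbar_succ (r : ℕ) :
    Tbar X θ xs (r + 1) = ⌊Real.logb 4 (nextBudget X θ xs (Tbar X θ xs r))⌋₊ := by
  have h : ∑ t ∈ Finset.Icc 1 (Tbar X θ xs r), (4 : ℝ) ^ t * rho X (diffs
      (X \ {x ∈ farArms X θ xs (4 ^ Tbar X θ xs r) | 15 * (2 ^ t : ℝ)⁻¹ < gap θ xs x})) =
      nearSum X θ xs (Tbar X θ xs r) :=
    Finset.sum_congr rfl fun t ht => by rw [sdiff_filter_farArms (Finset.mem_Icc.mp ht).2]
  rw [Tbar, nextBudget, ← h, ← sdiff_farArms]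

lemma nearSum_nonneg (T : ℕ) : 0 ≤ nearSum X θ xs T :=
  Finset.sum_nonneg fun t _ => mul_nonneg (by positivity) (rho_nonneg _ _)

lemma le_nextBudget (T : ℕ) : 4 ^ (T + 1) ≤ nextBudget X θ xs T := by
  rw [nextBudget, pow_succ, mul_comm]
  have := div_nonneg (nearSum_nonneg (X := X) (θ := θ) (xs := xs) T)
    (rho_nonneg X (diffs (nearArms X θ xs T)))
  linarith

lemma nextBudget_pos (T : ℕ) : 0 < nextBudget X θ xs T :=
  lt_of_lt_of_le (by positivity) (le_nextBudget T)

lemma pow_floor_logb_le {L : ℝ} (hL : 1 ≤ L) : (4 : ℝ) ^ ⌊Real.logb 4 L⌋₊ ≤ L := by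
  have h := Nat.floor_le (Real.logb_nonneg (b := 4) (by norm_num) hL)
  rw [Real.le_logb_iff_rpow_le (by norm_num) (by linarith)] at h
  exact_mod_cast h

lemma lt_pow_floor_logb {L : ℝ} (hL : 0 < L) : L < (4 : ℝ) ^ (⌊Real.logb 4 L⌋₊ + 1) := by
  have h := Nat.lt_floor_add_one (Real.logb 4 L)
  rw [Real.logb_lt_iff_lt_rpow (by norm_num) hL] at h
  exact_mod_cast h

lemma le_floor_logb {L : ℝ} {k : ℕ} (h : 4 ^ k ≤ L) : k ≤ ⌊Real.logb 4 L⌋₊ := by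
  refine Nat.le_floor ?_
  rw [Real.le_logb_iff_rpow_le (by norm_num) (lt_of_lt_of_le (by positivity) h)]
  exact_mod_cast h

lemma pow_Tbar_succ_le (r : ℕ) :
    (4 : ℝ) ^ Tbar X θ xs (r + 1) ≤ nextBudget X θ xs (Tbar X θ xs r) := by
  rw [Tbar_succ]
  exact pow_floor_logb_le ((one_le_pow₀ (by norm_num)).trans (le_nextBudget _))

lemma lt_pow_Tbar_succ (r : ℕ) :
    nextBudget X θ xs (Tbar X θ xs r) < (4 : ℝ) ^ (Tbar X θ xs (r + 1) + 1) := by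
  rw [Tbar_succ]
  exact lt_pow_floor_logb (nextBudget_pos _)

lemma Tbar_lt_succ (r : ℕ) : Tbar X θ xs r < Tbar X θ xs (r + 1) := by
  rw [Tbar_succ]
  exact le_floor_logb (le_nextBudget _)

lemma le_Tbar (r : ℕ) : r ≤ Tbar X θ xs r := by
  induction r with
  | zero => exact Nat.zero_le _
  | succ r ih => exact Nat.succ_le_of_lt (ih.trans_lt (Tbar_lt_succ r))

lemma Tbar_zero : Tbar X θ xs 0 = 0 := rfl

lemma Tbar_one : Tbar X θ xs 1 = 1 := by
  rw [Tbar_succ, Tbar_zero, nextBudget, nearSum]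
  norm_num

lemma mem_U {r : ℕ} {x : Vec d} :
    x ∈ U X θ xs r ↔ x ∈ X ∧ 15 / 2 ^ Tbar X θ xs r < gap θ xs x := mem_farArms_pow

lemma sdiff_U (r : ℕ) : X \ U X θ xs r = nearArms X θ xs (Tbar X θ xs r) := sdiff_farArms _

lemma U_subset (r : ℕ) : U X θ xs r ⊆ X := fun _ hx => (mem_U.mp hx).1

lemma Tbar_mono {r s : ℕ} (h : r ≤ s) : Tbar X θ xs r ≤ Tbar X θ xs s :=
  monotone_nat_of_le_succ (fun r => (Tbar_lt_succ r).le) h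

lemma U_mono {r s : ℕ} (h : r ≤ s) : U X θ xs r ⊆ U X θ xs s := by
  intro x hx
  obtain ⟨h1, h2⟩ := mem_U.mp hx
  refine mem_U.mpr ⟨h1, lt_of_le_of_lt ?_ h2⟩
  have := Tbar_mono (X := X) (θ := θ) (xs := xs) h
  gcongr
  norm_num

lemma mem_nearArms_self (hxs : xs ∈ X) (t : ℕ) : xs ∈ nearArms X θ xs t :=
  mem_nearArms.mpr ⟨hxs, by rw [gap_self]; positivity⟩

lemma U_eq_erase (hΔ : IsLeast ((gap θ xs) '' {x | x ∈ X ∧ x ≠ xs}) Δ₂) {r : ℕ}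
    (h : 15 / 2 ^ Tbar X θ xs r < Δ₂) : U X θ xs r = X.erase xs := by
  ext x
  rw [mem_U, Finset.mem_erase]
  constructor
  · rintro ⟨h1, h2⟩
    refine ⟨fun he => ?_, h1⟩
    rw [he, gap_self] at h2
    exact absurd h2 (not_lt.mpr (by positivity))
  · rintro ⟨hne, hx⟩
    exact ⟨hx, h.trans_le (minGap_le_gap hΔ hx hne)⟩

theorem exists_isLeast_batches
    (hΔ : IsLeast ((gap θ xs) '' {x | x ∈ X ∧ x ≠ xs}) Δ₂) (h0 : 0 < Δ₂) :
    ∃ R, IsLeast {r : ℕ | 1 ≤ r ∧ U X θ xs r = X.erase xs} R := by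
  classical
  have hex : ∃ r : ℕ, 1 ≤ r ∧ U X θ xs r = X.erase xs := by
    obtain ⟨n, hn⟩ := pow_unbounded_of_one_lt (15 / Δ₂) (by norm_num : (1 : ℝ) < 2)
    refine ⟨n + 1, by omega, U_eq_erase hΔ ?_⟩
    have h2 : (2 : ℝ) ^ n ≤ 2 ^ Tbar X θ xs (n + 1) :=
      pow_le_pow_right₀ (by norm_num) ((Nat.le_succ n).trans (le_Tbar _))
    rw [div_lt_comm₀ (by positivity) h0]
    exact hn.trans_le h2
  exact ⟨Nat.find hex, Nat.find_spec hex, fun r hr => Nat.find_min' hex hr⟩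

lemma exists_mem_nearArms_ne {r : ℕ} (h : U X θ xs r ≠ X.erase xs) :
    ∃ x ∈ nearArms X θ xs (Tbar X θ xs r), x ≠ xs := by
  by_contra! hcon
  refine h ?_
  ext x
  rw [Finset.mem_erase]
  constructor
  · intro hx
    refine ⟨fun he => ?_, U_subset r hx⟩
    have := (mem_U.mp hx).2
    rw [he, gap_self] at this
    exact absurd this (not_lt.mpr (by positivity))
  · rintro ⟨hne, hx⟩
    by_contra hU
    exact hne (hcon x (sdiff_U r ▸ Finset.mem_sdiff.mpr ⟨hx, hU⟩))

/-- If the near set `V` stays the same, then `L̂_{r+1} < 4 · 4^T` with the new exponent `T` bounds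
the old sum by `4 · 4^T ρ(𝒴(V))`. The last term of the new sum is `4^T ρ(𝒴(V))`, and the exponents
strictly increase, so that it is an additional term. -/
lemma nearSum_growth (hxs : xs ∈ X) {r : ℕ} (h : U X θ xs r ≠ X.erase xs)
    (heq : U X θ xs (r + 1) = U X θ xs r) :
    5 / 4 * nearSum X θ xs (Tbar X θ xs r) ≤ nearSum X θ xs (Tbar X θ xs (r + 1)) := by
  have hV : nearArms X θ xs (Tbar X θ xs (r + 1)) = nearArms X θ xs (Tbar X θ xs r) := by
    rw [← sdiff_U, ← sdiff_U, heq]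
  obtain ⟨x, hx, hne⟩ := exists_mem_nearArms_ne h
  have hρ : 0 < rho X (diffs (nearArms X θ xs (Tbar X θ xs r))) :=
    rho_diffs_pos (nearArms_subset _)
      (Finset.one_lt_card.mpr ⟨x, hx, xs, mem_nearArms_self hxs _, hne⟩)
  have h1 := lt_pow_Tbar_succ (X := X) (θ := θ) (xs := xs) r
  have h2 : nearSum X θ xs (Tbar X θ xs r) ≤
      4 * (4 ^ Tbar X θ xs (r + 1) * rho X (diffs (nearArms X θ xs (Tbar X θ xs r)))) := by
    rw [nextBudget, pow_succ] at h1
    have h3 : nearSum X θ xs (Tbar X θ xs r) / rho X (diffs (nearArms X θ xs (Tbar X θ xs r))) ≤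
        4 ^ Tbar X θ xs (r + 1) * 4 := by
      have : (0 : ℝ) ≤ 4 * 4 ^ Tbar X θ xs r := by positivity
      linarith
    rw [div_le_iff₀ hρ] at h3
    linarith
  have hlt := Tbar_lt_succ (X := X) (θ := θ) (xs := xs) r
  set T := Tbar X θ xs r
  obtain ⟨k, hk⟩ : ∃ k, Tbar X θ xs (r + 1) = k + 1 := ⟨Tbar X θ xs (r + 1) - 1, by omega⟩
  rw [hk] at h2 hV hlt ⊢
  have h4 : nearSum X θ xs (k + 1) = nearSum X θ xs k +
      4 ^ (k + 1) * rho X (diffs (nearArms X θ xs T)) := by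
    rw [nearSum, Finset.sum_Icc_succ_top (by omega), hV]; rfl
  have h5 : nearSum X θ xs T ≤ nearSum X θ xs k := by
    refine Finset.sum_le_sum_of_subset_of_nonneg (Finset.Icc_subset_Icc_right (by omega))
      fun t _ _ => mul_nonneg (by positivity) (rho_nonneg _ _)
  linarith

lemma card_image_U_le (n : ℕ) : ((Finset.Icc 1 n).image (U X θ xs)).card ≤ n := by
  have := Finset.card_image_le (s := Finset.Icc 1 n) (f := U X θ xs)
  simpa using this

lemma nearArms_one_eq (h2 : ∀ x ∈ X, gap θ xs x ≤ 2) : nearArms X θ xs 1 = X := by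
  refine Finset.filter_true_of_mem fun x hx => ?_
  have := h2 x hx
  norm_num
  linarith

/-- Every repetition among `U_1, U_2, …` multiplies the near sum by `5 / 4`. -/
lemma pow_mul_rho_le_nearSum (hxs : xs ∈ X) (h2 : ∀ x ∈ X, gap θ xs x ≤ 2) (n : ℕ)
    (hn : ∀ r ∈ Finset.Icc 1 (n + 1), U X θ xs r ≠ X.erase xs) :
    (5 / 4 : ℝ) ^ (n + 1 - ((Finset.Icc 1 (n + 1)).image (U X θ xs)).card) *
      (4 * rho X (diffs X)) ≤ nearSum X θ xs (Tbar X θ xs (n + 1)) := by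
  induction n with
  | zero => simp [Tbar_one, nearSum, nearArms_one_eq h2]
  | succ n ih =>
    have ih := ih fun r hr => hn r (Finset.Icc_subset_Icc_right (by omega) hr)
    have hcard := card_image_U_le (X := X) (θ := θ) (xs := xs) (n + 1)
    have hins : Finset.Icc 1 (n + 1 + 1) = insert (n + 1 + 1) (Finset.Icc 1 (n + 1)) :=
      (Finset.insert_Icc_right_eq_Icc_add_one (by omega)).symm
    rw [hins, Finset.image_insert]
    by_cases heq : U X θ xs (n + 1 + 1) = U X θ xs (n + 1)
    · have hmem : U X θ xs (n + 1 + 1) ∈ (Finset.Icc 1 (n + 1)).image (U X θ xs) :=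
        Finset.mem_image.mpr ⟨n + 1, by simp, heq.symm⟩
      rw [Finset.insert_eq_of_mem hmem, Nat.sub_add_comm hcard, pow_succ]
      have := nearSum_growth hxs (hn (n + 1) (by simp)) heq
      linarith
    · have hmem : U X θ xs (n + 1 + 1) ∉ (Finset.Icc 1 (n + 1)).image (U X θ xs) := by
        -- The sets increase, so agreeing with any earlier `U_j` would force agreement with the
        -- immediate predecessor.
        intro hm
        obtain ⟨j, hj, hje⟩ := Finset.mem_image.mp hm
        refine heq (Finset.Subset.antisymm ?_ (U_mono (by omega)))
        rw [← hje]
        exact U_mono (Finset.mem_Icc.mp hj).2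
      rw [Finset.card_insert_of_notMem hmem, Nat.add_sub_add_right]
      refine ih.trans ?_
      exact Finset.sum_le_sum_of_subset_of_nonneg
        (Finset.Icc_subset_Icc_right (Tbar_lt_succ _).le)
        fun t _ _ => mul_nonneg (by positivity) (rho_nonneg _ _)

lemma pow_mul_rho_nearArms_le (hxs : xs ∈ X)
    (hΔ : IsLeast ((gap θ xs) '' {x | x ∈ X ∧ x ≠ xs}) Δ₂) (h0 : 0 < Δ₂) (t : ℕ) :
    4 ^ t * rho X (diffs (nearArms X θ xs t)) ≤ 900 * psiStar X θ xs := by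
  have := mul_rho_diffs_le_psiStar hxs hΔ h0 (nearArms_subset (θ := θ) (xs := xs) t)
    (c := 15) (L := 4 ^ t) (by norm_num) (by positivity) fun x hx => by
      rw [sqrt_four_pow]; exact (mem_nearArms.mp hx).2
  linarith

/-- Each term costs at most `900 ψ*`, but gaps at most 2 give `ρ(𝒴(X)) ≤ 16 ψ*`, so the first two
terms together cost only `(4 + 16) · 16 = 320`. -/
lemma nearSum_le (hxs : xs ∈ X)
    (hΔ : IsLeast ((gap θ xs) '' {x | x ∈ X ∧ x ≠ xs}) Δ₂) (h0 : 0 < Δ₂)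
    (h2 : ∀ x ∈ X, gap θ xs x ≤ 2) (k : ℕ) :
    nearSum X θ xs (k + 2) ≤ (900 * k + 320) * psiStar X θ xs := by
  induction k with
  | zero =>
    have hX := rho_diffs_le_psiStar hxs hΔ h0 subset_rfl (by norm_num : (0 : ℝ) < 2) h2
    have hle := rho_diffs_mono (nearArms_subset (X := X) (θ := θ) (xs := xs) 2) subset_rfl
    simp only [nearSum, zero_add, Finset.sum_Icc_succ_top (by norm_num : 1 ≤ 1 + 1),
      Finset.Icc_self, Finset.sum_singleton, nearArms_one_eq h2]
    norm_num at hX hle ⊢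
    linarith
  | succ k ih =>
    have h := pow_mul_rho_nearArms_le hxs hΔ h0 (k + 1 + 2)
    rw [nearSum, Finset.sum_Icc_succ_top (by omega)]
    rw [nearSum] at ih
    push_cast
    linarith

theorem batches_le (hxs : xs ∈ X)
    (hΔ : IsLeast ((gap θ xs) '' {x | x ∈ X ∧ x ≠ xs}) Δ₂) (h0 : 0 < Δ₂) {R : ℕ}
    (hR : IsLeast {r : ℕ | 1 ≤ r ∧ U X θ xs r = X.erase xs} R)
    (hΔ2 : Δ₂ ≤ 1 / 2) (h2 : ∀ x ∈ X, gap θ xs x ≤ 2) :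
    (R : ℝ) ≤ (((Finset.Icc 1 R).image (U X θ xs)).card : ℝ) +
      Real.logb (5 / 4)
        (900 * Real.logb 2 (1 / Δ₂) * psiStar X θ xs / rho X (diffsFrom xs X)) := by
  obtain ⟨⟨hR1, hRU⟩, hmin⟩ := hR
  obtain ⟨x₀, hx₀, hne₀, -⟩ := exists_gap_eq_minGap hΔ
  -- `T̄_1 = 1` and `15 / 2` exceeds all gaps; consequently `R ≥ 2`.
  have hU1 : U X θ xs 1 = ∅ := by
    have := sdiff_U (X := X) (θ := θ) (xs := xs) 1
    rw [Tbar_one, nearArms_one_eq h2, Finset.sdiff_eq_self_iff_disjoint] at this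
    exact Finset.disjoint_self_iff_empty _ |>.mp (this.mono_left (U_subset 1))
  have hR2 : 2 ≤ R := by
    by_contra h
    obtain rfl : R = 1 := by omega
    rw [hU1] at hRU
    exact absurd (Finset.mem_erase.mpr ⟨hne₀, hx₀⟩) (hRU ▸ Finset.notMem_empty x₀)
  obtain ⟨n, rfl⟩ : ∃ n, R = n + 1 + 1 := ⟨R - 2, by omega⟩
  have hn : ∀ r ∈ Finset.Icc 1 (n + 1), U X θ xs r ≠ X.erase xs := by
    intro r hr he
    obtain ⟨h1, h3⟩ := Finset.mem_Icc.mp hr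
    have := hmin ⟨h1, he⟩
    omega
  have hpow := pow_mul_rho_le_nearSum hxs h2 n hn
  have hins : Finset.Icc 1 (n + 1 + 1) = insert (n + 1 + 1) (Finset.Icc 1 (n + 1)) :=
    (Finset.insert_Icc_right_eq_Icc_add_one (by omega)).symm
  have hnot : U X θ xs (n + 1 + 1) ∉ (Finset.Icc 1 (n + 1)).image (U X θ xs) := by
    intro hm
    obtain ⟨j, hj, hje⟩ := Finset.mem_image.mp hm
    exact hn j hj (hje.trans hRU)
  rw [hins, Finset.image_insert, Finset.card_insert_of_notMem hnot]
  have hcard := card_image_U_le (X := X) (θ := θ) (xs := xs) (n + 1)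
  set α := ((Finset.Icc 1 (n + 1)).image (U X θ xs)).card
  set T := Tbar X θ xs (n + 1) with hT
  have hT1 : 1 ≤ T := (by omega : 1 ≤ n + 1).trans (le_Tbar _)
  set ℓ := Real.logb 2 (1 / Δ₂) with hℓ
  have hℓ1 : 1 ≤ ℓ := by
    rw [hℓ, Real.le_logb_iff_rpow_le (by norm_num) (by positivity), Real.rpow_one,
      le_div_comm₀ (by norm_num) h0]
    exact hΔ2
  -- Before completion some suboptimal arm is near, so `Δ₂ ≤ 15 / 2^T ≤ 16 / 2^T`.
  have hTℓ : (T : ℝ) ≤ 4 + ℓ := by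
    obtain ⟨x, hx, hne⟩ := exists_mem_nearArms_ne (hn (n + 1) (by simp))
    obtain ⟨hxX, hg⟩ := mem_nearArms.mp hx
    have h3 : Δ₂ ≤ 15 / 2 ^ T := (minGap_le_gap hΔ hxX hne).trans hg
    have h4 : (2 : ℝ) ^ ((T : ℝ) - 4) ≤ 1 / Δ₂ := by
      rw [Real.rpow_sub (by norm_num), Real.rpow_natCast, div_le_div_iff₀ (by positivity) h0]
      rw [le_div_iff₀ (by positivity)] at h3
      norm_num
      linarith
    rw [← Real.le_logb_iff_rpow_le (by norm_num) (by positivity)] at h4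
    linarith
  have hψ := psiStar_nonneg X θ xs
  -- With `k = T - 2 ≤ ℓ + 2` the bound is `900 (ℓ + 2) + 320 ≤ 3600 ℓ`; charging 900 for each of `ℓ
  -- + 4` terms would be too much. Dividing by the initial factor 4 leaves 900.
  have hB : nearSum X θ xs T ≤ 3600 * ℓ * psiStar X θ xs := by
    rcases Nat.lt_or_ge T 2 with hlt | hge
    · obtain hT' : T = 1 := by omega
      have := pow_mul_rho_nearArms_le hxs hΔ h0 1
      rw [hT', nearSum, Finset.Icc_self, Finset.sum_singleton]
      nlinarith
    · obtain ⟨k, hk⟩ : ∃ k, T = k + 2 := ⟨T - 2, by omega⟩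
      have h3 := nearSum_le hxs hΔ h0 h2 k
      rw [hk]
      rw [hk] at hTℓ
      push_cast at hTℓ
      refine h3.trans (mul_le_mul_of_nonneg_right ?_ hψ)
      linarith
  have hρ : 0 < rho X (diffsFrom xs X) := rho_diffsFrom_pos hxs hx₀ hne₀
  have hρle := rho_diffsFrom_le hxs
  have hfin : (5 / 4 : ℝ) ^ (n + 1 - α) ≤ 900 * ℓ * psiStar X θ xs / rho X (diffsFrom xs X) := by
    rw [le_div_iff₀ hρ]
    have h3 : (5 / 4 : ℝ) ^ (n + 1 - α) * rho X (diffsFrom xs X) ≤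
        (5 / 4 : ℝ) ^ (n + 1 - α) * rho X (diffs X) :=
      mul_le_mul_of_nonneg_left hρle (by positivity)
    linarith
  have hlog : ((n + 1 - α : ℕ) : ℝ) ≤
      Real.logb (5 / 4) (900 * ℓ * psiStar X θ xs / rho X (diffsFrom xs X)) := by
    rw [Real.le_logb_iff_rpow_le (by norm_num) (lt_of_lt_of_le (by positivity) hfin),
      Real.rpow_natCast]
    exact hfin
  rw [Nat.cast_sub hcard] at hlog
  push_cast at hlog ⊢
  linarith

end Instance

/-! ### Deterministic analysis of a run with accurate estimates. -/

section Algorithm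

variable {d : ℕ} {X : Finset (Vec d)} {θ xs : Vec d} {Δ₂ δ : ℝ}

/-- The effect of a batch on the state, when the estimated gaps of the active arms are `e`. -/
structure BatchStep (X : Finset (Vec d)) (δ : ℝ) (e : Vec d → ℝ) (s s' : State d) : Prop where
  active : ∀ y, y ∈ s'.active ↔ y ∈ s.active ∧ e y < 5 / √s.L
  eps_of_eliminated : ∀ y ∈ s.active, 5 / √s.L ≤ e y → s'.eps y = e y
  eps_of_not_eliminated : ∀ y, ¬ (y ∈ s.active ∧ 5 / √s.L ≤ e y) → s'.eps y = s.eps y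
  budget : s'.L = 4 * s.L + (∑ t ∈ Finset.Icc 1 ⌊Real.logb 4 s.L⌋₊,
    4 ^ t * rho X (diffs (X \ {y ∈ X \ s'.active | 25 * √(((4 : ℝ) ^ t)⁻¹) < s'.eps y})))
      / rho X (diffs s'.active)
  batches : s'.batches = s.batches + 1
  pulls : s'.pulls = s.pulls + batchSize X s.active δ s.L (s.batches + 1)

/-- The least squares estimate of a batch with active set `S` and `N` pulls with noise `η`. -/
noncomputable def batchEstimate (lam : Finset (Vec d) → Vec d → ℝ) (rnd : Rounding d)
    (X : Finset (Vec d)) (θ : Vec d) (S : Finset (Vec d)) (N : ℕ) (η : ℕ → ℝ) : Vec d :=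
  olsEstimate (rnd (lam (diffs S)) N X (diffs S))
    fun i => rnd (lam (diffs S)) N X (diffs S) i ⬝ᵥ θ + η i

/-- The estimated gap of `y` in `S` for the parameter `ϑ`. -/
noncomputable def estGap (S : Finset (Vec d)) (ϑ y : Vec d) : ℝ :=
  if h : S.Nonempty then S.sup' h (fun z => ϑ ⬝ᵥ z) - ϑ ⬝ᵥ y else 0

lemma step_eq_self {lam : Finset (Vec d) → Vec d → ℝ} {rnd : Rounding d} {noise : ℕ → ℕ → ℝ}
    {s : State d} (h : ¬ 1 < s.active.card) :
    step 5 25 4 δ lam rnd X θ noise s = s := dif_neg h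

lemma batchStep_step {lam : Finset (Vec d) → Vec d → ℝ} {rnd : Rounding d} {noise : ℕ → ℕ → ℝ}
    {s : State d} (h : 1 < s.active.card) :
    BatchStep X δ (estGap s.active (batchEstimate lam rnd X θ s.active
      (batchSize X s.active δ s.L (s.batches + 1)) (noise (s.batches + 1)))) s
      (step 5 25 4 δ lam rnd X θ noise s) := by
  have hne : s.active.Nonempty := Finset.card_pos.mp (zero_lt_one.trans h)
  have hstep : step 5 25 4 δ lam rnd X θ noise s = _ := dif_pos h
  have hgap : ∀ ϑ y : Vec d, s.active.sup' hne (fun z => ϑ ⬝ᵥ z) - ϑ ⬝ᵥ y =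
      estGap s.active ϑ y := fun ϑ y => by rw [estGap, dif_pos hne]
  rw [hstep]
  simp only [hgap]
  constructor
  · intro y
    change y ∈ s.active \ _ ↔ _
    rw [Finset.mem_sdiff, Finset.mem_filter]
    constructor
    · rintro ⟨h1, h2⟩; exact ⟨h1, not_le.mp fun h3 => h2 ⟨h1, h3⟩⟩
    · rintro ⟨h1, h2⟩; exact ⟨h1, fun h3 => absurd h3.2 (not_le.mpr h2)⟩
  · intro y hy hle
    exact if_pos (Finset.mem_filter.mpr ⟨hy, hle⟩)
  · intro y hy
    exact if_neg fun h' => hy (Finset.mem_filter.mp h')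
  · rfl
  · rfl
  · rfl

/-- One-sided errors suffice because `diffs S` is symmetric. The error is `c`, not `2 c`: the lower
bound compares `x` with `xs`, the upper bound with the empirical maximizer, whose true gap is
nonnegative. -/
lemma abs_estGap_sub_gap_le {S : Finset (Vec d)} (hxs : xs ∈ S) (hgap : ∀ x ∈ S, 0 ≤ gap θ xs x)
    {ϑ : Vec d} {c : ℝ} (hc : 0 ≤ c) (h : ∀ y ∈ diffs S, y ⬝ᵥ (ϑ - θ) ≤ c) {x : Vec d}
    (hx : x ∈ S) : |estGap S ϑ x - gap θ xs x| ≤ c := by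
  have hne : S.Nonempty := ⟨x, hx⟩
  have h' : ∀ a ∈ S, ∀ b ∈ S, ϑ ⬝ᵥ a - ϑ ⬝ᵥ b ≤ gap θ xs b - gap θ xs a + c := by
    intro a ha b hb
    have hab : (a - b) ⬝ᵥ (ϑ - θ) ≤ c := by
      by_cases hab : a = b
      · simpa [hab] using hc
      · exact h _ (mem_diffs.mpr ⟨a, ha, b, hb, hab, rfl⟩)
    simp only [gap, sub_dotProduct, dotProduct_sub] at hab ⊢
    rw [dotProduct_comm ϑ a, dotProduct_comm ϑ b]
    linarith
  rw [estGap, dif_pos hne, abs_le]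
  constructor
  · have h1 := Finset.le_sup' (fun z => ϑ ⬝ᵥ z) hxs
    have h2 := h' x hx xs hxs
    rw [gap_self] at h2
    linarith
  · obtain ⟨z, hz, he⟩ := Finset.exists_mem_eq_sup' hne fun z => ϑ ⬝ᵥ z
    rw [he]
    have h1 := h' z hz x hx
    have h2 := hgap z hz
    linarith

/-- What is preserved by the batches of a run in which all gaps are well estimated. -/
structure GoodState (X : Finset (Vec d)) (θ xs : Vec d) (n : ℕ) (s : State d) : Prop where
  batches : s.batches = n
  mem : xs ∈ s.active
  sub : s.active ⊆ X
  budget : 4 ^ Tbar X θ xs (n + 1) ≤ s.L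
  -- Nothing is claimed before the first batch: level 0 would exclude arms of gap above 15.
  near : 1 ≤ n → s.active ⊆ nearArms X θ xs (Tbar X θ xs n)
  eps : ∀ x ∈ X, x ∉ s.active → 4 / 5 * s.eps x ≤ gap θ xs x ∧ gap θ xs x ≤ 6 / 5 * s.eps x

lemma sqrt_inv_four_pow (t : ℕ) : √(((4 : ℝ) ^ t)⁻¹) = 1 / 2 ^ t := by
  rw [Real.sqrt_inv, sqrt_four_pow, one_div]

lemma GoodState.one_le_budget {n : ℕ} {s : State d} (hs : GoodState X θ xs n s) : 1 ≤ s.L :=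
  (one_le_pow₀ (by norm_num)).trans hs.budget

section Step

variable {n : ℕ} {s s' : State d} {e : Vec d → ℝ} (hs : GoodState X θ xs n s)
  (hst : BatchStep X δ e s s') (he : ∀ x ∈ s.active, |e x - gap θ xs x| ≤ 1 / √s.L)

include hs hst he

lemma mem_active_of_batchStep : xs ∈ s'.active := by
  refine (hst.active xs).mpr ⟨hs.mem, ?_⟩
  have h := (abs_le.mp (he xs hs.mem)).2
  rw [gap_self, sub_zero] at h
  have hL : 0 < √s.L := Real.sqrt_pos.mpr (by linarith [hs.one_le_budget])
  refine h.trans_lt ?_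
  gcongr
  norm_num

omit hs in
lemma gap_le_of_batchStep {x : Vec d} (hx : x ∈ s'.active) : gap θ xs x ≤ 6 / √s.L := by
  obtain ⟨h1, h2⟩ := (hst.active x).mp hx
  have h := (abs_le.mp (he x h1)).1
  have : 6 / √s.L = 5 / √s.L + 1 / √s.L := by ring
  linarith

/-- At elimination `ε ≥ 5 / √L`, so the error `1 / √L` is at most `ε / 5`. Later batches leave the
record unchanged. -/
lemma eps_of_batchStep {x : Vec d} (hx : x ∈ X) (hn : x ∉ s'.active) :
    4 / 5 * s'.eps x ≤ gap θ xs x ∧ gap θ xs x ≤ 6 / 5 * s'.eps x := by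
  by_cases hxs : x ∈ s.active
  · have hle : 5 / √s.L ≤ e x := not_lt.mp fun h => hn ((hst.active x).mpr ⟨hxs, h⟩)
    rw [hst.eps_of_eliminated x hxs hle]
    have h := abs_le.mp (he x hxs)
    have : 5 / √s.L = 5 * (1 / √s.L) := by ring
    constructor <;> linarith [h.1, h.2]
  · rw [hst.eps_of_not_eliminated x fun h => hxs h.1]
    exact hs.eps x hx hxs

omit he in
lemma subset_of_batchStep : s'.active ⊆ X :=
  fun x hx => hs.sub ((hst.active x).mp hx).1

lemma active_subset_nearArms :
    s'.active ⊆ nearArms X θ xs (Tbar X θ xs (n + 1)) := by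
  intro x hx
  refine mem_nearArms.mpr ⟨subset_of_batchStep hs hst hx, ?_⟩
  refine (gap_le_of_batchStep hst he hx).trans ?_
  rw [← sqrt_four_pow]
  have := Real.sqrt_le_sqrt hs.budget
  have h2 : 0 < √((4 : ℝ) ^ Tbar X θ xs (n + 1)) := Real.sqrt_pos.mpr (by positivity)
  gcongr
  norm_num

/-- The budget rule is monotone in the right directions: the actual run has a larger budget, more
summands, larger sets in the numerator and a smaller one in the denominator, which is positive as
two arms survive. The numerator sets are larger because `Δ ≤ 15 / 2^t` implies `ε ≤ (5/4) · 15 / 2^t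
< 25 / 2^t`. -/
lemma nextBudget_le_of_batchStep (hcard : 1 < s'.active.card) :
    nextBudget X θ xs (Tbar X θ xs (n + 1)) ≤ s'.L := by
  rw [hst.budget, nextBudget, nearSum]
  have hρ : 0 < rho X (diffs s'.active) :=
    rho_diffs_pos (subset_of_batchStep hs hst) hcard
  have hρ' := rho_diffs_mono (active_subset_nearArms hs hst he) (nearArms_subset _)
  have hT := le_floor_logb hs.budget
  refine add_le_add (mul_le_mul_of_nonneg_left hs.budget (by norm_num))
    (div_le_div₀ ?_ ?_ hρ hρ')
  · exact Finset.sum_nonneg fun t _ => mul_nonneg (by positivity) (rho_nonneg _ _)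
  · refine (Finset.sum_le_sum fun t ht => ?_).trans
      (Finset.sum_le_sum_of_subset_of_nonneg (Finset.Icc_subset_Icc_right hT)
        fun t _ _ => mul_nonneg (by positivity) (rho_nonneg _ _))
    refine mul_le_mul_of_nonneg_left (rho_diffs_mono ?_ Finset.sdiff_subset) (by positivity)
    intro x hx
    obtain ⟨hxX, hg⟩ := mem_nearArms.mp hx
    refine Finset.mem_sdiff.mpr ⟨hxX, fun hm => ?_⟩
    obtain ⟨hm1, hm2⟩ := Finset.mem_filter.mp hm
    have h1 := (eps_of_batchStep hs hst he hxX (Finset.mem_sdiff.mp hm1).2).1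
    rw [sqrt_inv_four_pow] at hm2
    have : 15 / (2 : ℝ) ^ t = 15 * (1 / 2 ^ t) := by ring
    have : (0 : ℝ) < 1 / 2 ^ t := by positivity
    linarith

lemma goodState_of_batchStep (hcard : 1 < s'.active.card) : GoodState X θ xs (n + 1) s' where
  batches := by rw [hst.batches, hs.batches]
  mem := mem_active_of_batchStep hs hst he
  sub := subset_of_batchStep hs hst
  budget := (pow_Tbar_succ_le _).trans (nextBudget_le_of_batchStep hs hst he hcard)
  near := fun _ => active_subset_nearArms hs hst he
  eps := fun _ hx hn => eps_of_batchStep hs hst he hx hn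

/-- Multiplying by `ρ(𝒴(S'))` cancels the denominator of the budget rule. The first part is `4 · 144
ψ*`, as survivors have gap at most `6 / √L`. In each summand the arms have gap at most `(6/5) · 25 /
2^t = 30 / 2^t`, which costs `3600 ψ*`. -/
lemma budget_mul_rho_le (hxs : xs ∈ X)
    (hΔ : IsLeast ((gap θ xs) '' {x | x ∈ X ∧ x ≠ xs}) Δ₂) (h0 : 0 < Δ₂)
    (hcard : 1 < s'.active.card) :
    s'.L * rho X (diffs s'.active) ≤
      (576 + 3600 * ⌊Real.logb 4 s.L⌋₊) * psiStar X θ xs := by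
  have hL := hs.one_le_budget
  have hρ : 0 < rho X (diffs s'.active) :=
    rho_diffs_pos (subset_of_batchStep hs hst) hcard
  rw [hst.budget, add_mul, div_mul_cancel₀ _ hρ.ne']
  have h1 := mul_rho_diffs_le_psiStar hxs hΔ h0 (subset_of_batchStep hs hst)
    (by norm_num : (0 : ℝ) < 6) (by linarith : 0 < s.L)
    fun x hx => gap_le_of_batchStep hst he hx
  have h2 : ∀ t ∈ Finset.Icc 1 ⌊Real.logb 4 s.L⌋₊,
      4 ^ t * rho X (diffs (X \ {y ∈ X \ s'.active | 25 * √(((4 : ℝ) ^ t)⁻¹) < s'.eps y})) ≤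
        3600 * psiStar X θ xs := by
    intro t ht
    have ht' : (4 : ℝ) ^ t ≤ s.L :=
      (pow_le_pow_right₀ (by norm_num) (Finset.mem_Icc.mp ht).2).trans (pow_floor_logb_le hL)
    have h3 := mul_rho_diffs_le_psiStar hxs hΔ h0
      (S := X \ {y ∈ X \ s'.active | 25 * √(((4 : ℝ) ^ t)⁻¹) < s'.eps y})
      Finset.sdiff_subset (by norm_num : (0 : ℝ) < 30) (by positivity : (0 : ℝ) < 4 ^ t) ?_
    · linarith
    intro x hx
    obtain ⟨hxX, hx2⟩ := Finset.mem_sdiff.mp hx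
    by_cases hxa : x ∈ s'.active
    · refine (gap_le_of_batchStep hst he hxa).trans ?_
      have := Real.sqrt_le_sqrt ht'
      have h2 : 0 < √((4 : ℝ) ^ t) := Real.sqrt_pos.mpr (by positivity)
      gcongr
      norm_num
    · have h4 : s'.eps x ≤ 25 * √(((4 : ℝ) ^ t)⁻¹) := not_lt.mp fun hlt =>
        hx2 (Finset.mem_filter.mpr ⟨Finset.mem_sdiff.mpr ⟨hxX, hxa⟩, hlt⟩)
      have h5 := (eps_of_batchStep hs hst he hxX hxa).2
      rw [sqrt_inv_four_pow] at h4
      rw [sqrt_four_pow]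
      have : 30 / (2 : ℝ) ^ t = 30 * (1 / 2 ^ t) := by ring
      linarith
  have h3 := Finset.sum_le_sum h2
  rw [Finset.sum_const, Nat.card_Icc, Nat.add_sub_cancel, nsmul_eq_mul] at h3
  linarith

end Step

/-! ### Counting pulls -/

/-- For `g ≤ K` this is the decrease of `log x / x` beyond `e`; for `K ≤ g` it is monotonicity of
the logarithm. -/
lemma log_mul_min_le {g K : ℝ} (hg : 4 ≤ g) (hK : 8 ≤ K) :
    Real.logb 2 K * min g K ≤ K * Real.logb 2 g := by
  have hlog2 : 0 < Real.log 2 := Real.log_pos (by norm_num)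
  rw [Real.logb, Real.logb, div_mul_eq_mul_div, mul_div_assoc']
  refine div_le_div_of_nonneg_right ?_ hlog2.le
  rcases le_total g K with h | h
  · rw [min_eq_left h]
    have he : Real.exp 1 ≤ 4 := by linarith [Real.exp_one_lt_d9]
    have := Real.log_div_self_antitoneOn (Set.mem_Ici.mpr (he.trans hg))
      (Set.mem_Ici.mpr (he.trans (hg.trans h))) h
    simp only at this
    rw [div_le_div_iff₀ (by linarith) (by linarith)] at this
    linarith
  · rw [min_eq_right h, mul_comm]
    exact mul_le_mul_of_nonneg_left (Real.log_le_log (by linarith) h) (by linarith)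

/-- This removes the `log K` coming from `δ_r = δ / r²` without a further logarithmic factor. The
`3/2` is `1/2 + 1`, the half because `log₂ g ≥ 2`. -/
lemma add_log_mul_min_le {g K lam : ℝ} (hg : 4 ≤ g) (hK : 8 ≤ K) (hlam : 1 ≤ lam) :
    (lam + Real.logb 2 K) * min g K ≤ 3 / 2 * (lam * K) * Real.logb 2 g := by
  have h1 := log_mul_min_le hg hK
  have h2 : 2 ≤ Real.logb 2 g := by
    rw [Real.le_logb_iff_rpow_le (by norm_num) (by linarith)]
    norm_num; exact hg
  have h3 : lam * min g K ≤ lam * K * (Real.logb 2 g / 2) := by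
    have : lam * min g K ≤ lam * K := mul_le_mul_of_nonneg_left (min_le_right _ _) (by linarith)
    have hlK : 0 ≤ lam * K := by positivity
    nlinarith
  have h4 : K * Real.logb 2 g ≤ lam * (K * Real.logb 2 g) :=
    le_mul_of_one_le_left (by positivity) hlam
  linarith

lemma logb_two_le_self {K : ℝ} (hK : 0 < K) : Real.logb 2 K ≤ K := by
  rw [Real.logb, div_le_iff₀ (Real.log_pos (by norm_num))]
  have h1 := Real.log_le_sub_one_of_pos (show 0 < K / 2 by positivity)
  rw [Real.log_div hK.ne' (by norm_num)] at h1
  have := Real.log_two_gt_d9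
  have := Real.log_two_lt_d9
  nlinarith

lemma add_log_le {K lam : ℝ} (hK : 8 ≤ K) (hlam : 1 ≤ lam) :
    lam + Real.logb 2 K ≤ 3 / 2 * (lam * K) := by
  have := logb_two_le_self (show 0 < K by linarith)
  nlinarith

/-- Since `δ² ≤ δ`, the argument `|S|² r² / δ` is at most `(|X| r / δ)²`. The maximum is replaced by
a sum, and the rounding up by one is charged to `d ≥ 1`, giving `5 d`. -/
lemma batchSize_le {S : Finset (Vec d)} (hS : S ⊆ X) (hcard : 1 < S.card) (hd : 1 ≤ d)
    (hδ : 0 < δ) (hδ1 : δ < 1) {L : ℝ} (hL : 0 ≤ L) {r : ℕ} (hr : 1 ≤ r) :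
    (batchSize X S δ L r : ℝ) ≤
      16 * (Real.logb 2 (X.card / δ) + Real.logb 2 r) * (L * rho X (diffs S)) + 5 * d := by
  have hS0 : (0 : ℝ) < S.card := by exact_mod_cast (zero_lt_one.trans hcard)
  have hSX : (S.card : ℝ) ≤ X.card := by exact_mod_cast Finset.card_le_card hS
  have hr0 : (0 : ℝ) < r := by exact_mod_cast hr
  have hd' : (1 : ℝ) ≤ d := by exact_mod_cast hd
  have hlog : Real.logb 2 ((S.card : ℝ) ^ 2 / (δ / (r : ℝ) ^ 2)) ≤
      2 * (Real.logb 2 (X.card / δ) + Real.logb 2 r) := by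
    have hX0 : (0 : ℝ) < X.card := hS0.trans_le hSX
    rw [← Real.logb_mul (by positivity) hr0.ne', show (2 : ℝ) * Real.logb 2 (X.card / δ * r) =
      ((2 : ℕ) : ℝ) * Real.logb 2 (X.card / δ * r) by norm_num, ← Real.logb_pow]
    refine Real.logb_le_logb_of_le (by norm_num) (by positivity) ?_
    rw [div_div_eq_mul_div, mul_pow, div_pow, div_mul_eq_mul_div,
      div_le_div_iff₀ hδ (by positivity)]
    have h1 : (S.card : ℝ) ^ 2 * r ^ 2 ≤ (X.card : ℝ) ^ 2 * r ^ 2 := by gcongr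
    have h2 : δ ^ 2 ≤ δ := by nlinarith
    exact mul_le_mul h1 h2 (by positivity) (by positivity)
  have hρ := rho_nonneg X (diffs S)
  have hρL : 0 ≤ L * rho X (diffs S) := mul_nonneg hL hρ
  have hlog0 : 0 ≤ Real.logb 2 ((S.card : ℝ) ^ 2 / (δ / (r : ℝ) ^ 2)) := by
    refine Real.logb_nonneg (by norm_num) ?_
    rw [div_div_eq_mul_div, le_div_iff₀ hδ, one_mul]
    have h1 : (1 : ℝ) ≤ S.card := by exact_mod_cast hcard.le
    have h2 : (1 : ℝ) ≤ r := by exact_mod_cast hr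
    have : (1 : ℝ) ≤ (S.card : ℝ) ^ 2 * r ^ 2 :=
      one_le_mul_of_one_le_of_one_le (one_le_pow₀ h1) (one_le_pow₀ h2)
    linarith
  set Q := Real.logb 2 ((S.card : ℝ) ^ 2 / (δ / (r : ℝ) ^ 2))
  have hmax : max (2 * Q * rho X (diffs S) * L) (d : ℝ) ≤ 2 * Q * rho X (diffs S) * L + d :=
    max_le (by linarith) (by
      have : 0 ≤ 2 * Q * rho X (diffs S) * L := by positivity
      linarith)
  have hceil : (batchSize X S δ L r : ℝ) ≤ 4 * max (2 * Q * rho X (diffs S) * L) (d : ℝ) + 1 :=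
    (Nat.ceil_lt_add_one (by positivity)).le
  have h5 := mul_le_mul_of_nonneg_right hlog hρL
  linarith

/-- The bounds on the pulls made so far and on the cost of the next batch; `p` is the budget of the
previous batch. -/
def PullBound (X : Finset (Vec d)) (θ xs : Vec d) (D K : ℝ) (n : ℕ) (s : State d) : Prop :=
  ∃ p : ℝ, 4 ^ n ≤ p ∧ 4 * p ≤ s.L ∧ (∀ x ∈ s.active, gap θ xs x ≤ 6 / √p) ∧
    (s.pulls : ℝ) ≤ D * Real.logb 2 p + 5 * d * n ∧
    s.L * rho X (diffs s.active) ≤ 2000 * psiStar X θ xs * K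

/-- A suboptimal arm in `S` forces `√L ≤ 6 / Δ₂ ≤ 8 / Δ₂`, so `log₂ L ≤ 2 (3 + ℓ) ≤ 8 ℓ` with `ℓ =
log₂(1 / Δ₂) ≥ 1`. -/
lemma logb_budget_le (hΔ : IsLeast ((gap θ xs) '' {x | x ∈ X ∧ x ≠ xs}) Δ₂) (h0 : 0 < Δ₂)
    (hΔ2 : Δ₂ ≤ 1 / 2) {L : ℝ} (hL : 0 < L) {S : Finset (Vec d)} (hS : S ⊆ X)
    (hcard : 1 < S.card) (h : ∀ x ∈ S, gap θ xs x ≤ 6 / √L) :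
    1 ≤ Real.logb 2 (1 / Δ₂) ∧ Real.logb 2 L ≤ 8 * Real.logb 2 (1 / Δ₂) := by
  have hℓ1 : 1 ≤ Real.logb 2 (1 / Δ₂) := by
    rw [Real.le_logb_iff_rpow_le (by norm_num) (by positivity), Real.rpow_one,
      le_div_comm₀ (by norm_num) h0]
    exact hΔ2
  refine ⟨hℓ1, ?_⟩
  obtain ⟨x, hx, hne⟩ := Finset.exists_mem_ne hcard xs
  have h1 := (minGap_le_gap hΔ (hS hx) hne).trans (h x hx)
  have hsq : 0 < √L := Real.sqrt_pos.mpr hL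
  have h2 : √L ≤ 8 * (1 / Δ₂) := by
    rw [le_div_comm₀ h0 hsq] at h1
    refine h1.trans ?_
    rw [mul_one_div]
    gcongr
    norm_num
  have h3 := Real.logb_le_logb_of_le (b := 2) (by norm_num) hsq h2
  rw [Real.logb_mul (by norm_num) (by positivity), show (8 : ℝ) = 2 ^ (3 : ℕ) by norm_num,
    Real.logb_pow, Real.logb_self_eq_one (by norm_num)] at h3
  have h4 : Real.logb 2 L = 2 * Real.logb 2 √L := by
    conv_lhs => rw [← Real.sq_sqrt hL.le]
    rw [Real.logb_pow]; norm_num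
  rw [h4]
  push_cast at h3
  linarith

section PullStep

variable {n : ℕ} {s s' : State d} {e : Vec d → ℝ}

lemma one_le_logb_card_div (hcard : 1 < X.card) (hδ : 0 < δ) (hδ1 : δ < 1) :
    1 ≤ Real.logb 2 (X.card / δ) := by
  have h2 : (2 : ℝ) ≤ X.card := by exact_mod_cast hcard
  rw [Real.le_logb_iff_rpow_le (by norm_num) (by positivity), Real.rpow_one, le_div_iff₀ hδ]
  nlinarith

/-- The number of pulls of one batch. -/
lemma batchSize_le_of_pullBound (hxs : xs ∈ X)
    (hΔ : IsLeast ((gap θ xs) '' {x | x ∈ X ∧ x ≠ xs}) Δ₂) (h0 : 0 < Δ₂) (hΔ2 : Δ₂ ≤ 1 / 2)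
    (hd : 1 ≤ d) (hδ : 0 < δ) (hδ1 : δ < 1) {p K : ℝ} (hK : K = 8 * Real.logb 2 (1 / Δ₂))
    (hS : s.active ⊆ X) (hcard : 1 < s.active.card) (hp : 4 ^ n ≤ p) (hpL : 4 * p ≤ s.L)
    (hgap : ∀ x ∈ s.active, gap θ xs x ≤ 6 / √p)
    (hcost : s.L * rho X (diffs s.active) ≤ 2000 * psiStar X θ xs * K) :
    (n + 1 : ℝ) ≤ 5 * Real.logb 2 (1 / Δ₂) ∧ Real.logb 2 p ≤ K ∧
    (batchSize X s.active δ s.L (n + 1) : ℝ) ≤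
      48000 * psiStar X θ xs * (Real.logb 2 (X.card / δ) * K) *
        (Real.logb 2 s.L - Real.logb 2 p) + 5 * d ∧
    (batchSize X s.active δ s.L (n + 1) : ℝ) ≤
      48000 * psiStar X θ xs * (Real.logb 2 (X.card / δ) * K) * K + 5 * d := by
  have hp1 : 1 ≤ p := (one_le_pow₀ (by norm_num)).trans hp
  have hp0 : 0 < p := by linarith
  have hL0 : 0 < s.L := by linarith
  obtain ⟨hℓ, hlogp⟩ := logb_budget_le hΔ h0 hΔ2 hp0 hS hcard hgap
  have hlam := one_le_logb_card_div (hcard.trans_le (Finset.card_le_card hS)) hδ hδ1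
  have hψ := psiStar_nonneg X θ xs
  -- The budget grows at least fourfold per batch, so `2 n ≤ log₂ p ≤ 8 ℓ`. This bounds the batch
  -- index by `5 ℓ ≤ K`.
  have hn : (2 * n : ℝ) ≤ Real.logb 2 p := by
    rw [Real.le_logb_iff_rpow_le (by norm_num) hp0, show (2 : ℝ) * n = ((2 * n : ℕ) : ℝ) by
      push_cast; ring, Real.rpow_natCast, pow_mul]
    norm_num; exact hp
  have hn1 : (n + 1 : ℝ) ≤ 5 * Real.logb 2 (1 / Δ₂) := by linarith
  have hK8 : 8 ≤ K := by linarith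
  have hlogn : Real.logb 2 ((n + 1 : ℕ) : ℝ) ≤ Real.logb 2 K :=
    Real.logb_le_logb_of_le (by norm_num) (by positivity) (by push_cast; linarith)
  have hB := batchSize_le hS hcard hd hδ hδ1 hL0.le (Nat.succ_le_succ (Nat.zero_le n))
  set ψ := psiStar X θ xs
  set Λ := Real.logb 2 (X.card / δ)
  set a := s.L * rho X (diffs s.active)
  have ha0 : 0 ≤ a := mul_nonneg hL0.le (rho_nonneg _ _)
  have hlogK : 0 ≤ Real.logb 2 K := Real.logb_nonneg (by norm_num) (by linarith)
  have hB' : (batchSize X s.active δ s.L (n + 1) : ℝ) ≤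
      16 * (Λ + Real.logb 2 K) * a + 5 * d := by
    refine hB.trans ?_
    have := mul_le_mul_of_nonneg_right hlogn ha0
    linarith
  have hg : a ≤ 144 * ψ * (s.L / p) := by
    have h1 := mul_rho_diffs_le_psiStar hxs hΔ h0 hS (by norm_num : (0 : ℝ) < 6) hp0 hgap
    have h2 : a = p * rho X (diffs s.active) * (s.L / p) := by
      simp only [a]; field_simp
    rw [h2]
    refine mul_le_mul_of_nonneg_right ?_ (by positivity)
    linarith
  have hg4 : 4 ≤ s.L / p := (le_div_iff₀ hp0).mpr hpL
  -- The previous batch bounds the cost by the ratio of budgets, the budget rule bounds it by `K`;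
  -- both are needed. Then `48000 = 16 · 2000 · 3/2`.
  have hmin : a ≤ 2000 * ψ * min (s.L / p) K := by
    rcases min_choice (s.L / p) K with h | h <;> rw [h]
    · refine hg.trans ?_
      have : 0 ≤ ψ * (s.L / p) := by positivity
      linarith
    · exact hcost
  refine ⟨hn1, by linarith, ?_, ?_⟩
  · rw [← Real.logb_div hL0.ne' hp0.ne']
    have h1 := add_log_mul_min_le hg4 hK8 hlam
    have h2 : (Λ + Real.logb 2 K) * a ≤
        2000 * ψ * ((Λ + Real.logb 2 K) * min (s.L / p) K) := by
      have := mul_le_mul_of_nonneg_left hmin (by linarith : 0 ≤ Λ + Real.logb 2 K)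
      linarith
    have h3 := mul_le_mul_of_nonneg_left h1 (by positivity : 0 ≤ 2000 * ψ)
    linarith
  · have h1 := add_log_le hK8 hlam
    have h2 : (Λ + Real.logb 2 K) * a ≤ (3 / 2 * (Λ * K)) * (2000 * ψ * K) :=
      mul_le_mul h1 hcost ha0 (by positivity)
    linarith

/-- The bound on past pulls telescopes in the logarithm of the budget. The last batch is charged
separately: its budget need not be bounded in terms of `Δ₂`, since `logb_budget_le` controls a
budget only when two arms survive its batch. Hence the factor 2 in `2 D K`. -/
lemma pullBound_of_batchStep (hxs : xs ∈ X)
    (hΔ : IsLeast ((gap θ xs) '' {x | x ∈ X ∧ x ≠ xs}) Δ₂) (h0 : 0 < Δ₂) (hΔ2 : Δ₂ ≤ 1 / 2)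
    (hd : 1 ≤ d) (hδ : 0 < δ) (hδ1 : δ < 1) {K D : ℝ} (hK : K = 8 * Real.logb 2 (1 / Δ₂))
    (hD : D = 48000 * psiStar X θ xs * (Real.logb 2 (X.card / δ) * K))
    (hs : GoodState X θ xs n s) (hcard : 1 < s.active.card)
    (hst : BatchStep X δ e s s') (he : ∀ x ∈ s.active, |e x - gap θ xs x| ≤ 1 / √s.L)
    (hP : PullBound X θ xs D K n s) :
    (1 < s'.active.card → PullBound X θ xs D K (n + 1) s') ∧
    (s'.pulls : ℝ) ≤ 2 * (D * K) + 25 * (d * Real.logb 2 (1 / Δ₂)) := by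
  obtain ⟨p, hp, hpL, hgap, hpulls, hcost⟩ := hP
  obtain ⟨hn, hlogp, hB1, hB2⟩ := batchSize_le_of_pullBound hxs hΔ h0 hΔ2 hd hδ hδ1 hK hs.sub
    hcard hp hpL hgap hcost
  rw [← hD] at hB1 hB2
  have hp1 : 1 ≤ p := (one_le_pow₀ (by norm_num)).trans hp
  have hψ := psiStar_nonneg X θ xs
  have hlam := one_le_logb_card_div (hcard.trans_le (Finset.card_le_card hs.sub)) hδ hδ1
  have hℓ := (logb_budget_le hΔ h0 hΔ2 (by linarith) hs.sub hcard hgap).1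
  have hD0 : 0 ≤ D := by rw [hD, hK]; positivity
  have hN : (s'.pulls : ℝ) = s.pulls + batchSize X s.active δ s.L (n + 1) := by
    rw [hst.pulls, hs.batches]; push_cast; rfl
  constructor
  · intro hcard'
    refine ⟨s.L, ?_, ?_, fun x hx => gap_le_of_batchStep hst he hx, ?_, ?_⟩
    · rw [pow_succ]; linarith
    · rw [hst.budget]
      have : 0 ≤ (∑ t ∈ Finset.Icc 1 ⌊Real.logb 4 s.L⌋₊, 4 ^ t * rho X (diffs
          (X \ {y ∈ X \ s'.active | 25 * √(((4 : ℝ) ^ t)⁻¹) < s'.eps y}))) /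
          rho X (diffs s'.active) :=
        div_nonneg (Finset.sum_nonneg fun t _ => mul_nonneg (by positivity) (rho_nonneg _ _))
          (rho_nonneg _ _)
      linarith
    · rw [hN]; push_cast; linarith
    · refine (budget_mul_rho_le hs hst he hxs hΔ h0 hcard').trans ?_
      have hL1 := hs.one_le_budget
      have h1 := (logb_budget_le hΔ h0 hΔ2 (by linarith) (subset_of_batchStep hs hst) hcard'
        fun x hx => gap_le_of_batchStep hst he hx).2
      have h2 := Nat.floor_le (Real.logb_nonneg (b := 4) (by norm_num) hL1)
      have h3 : Real.logb 4 s.L = Real.logb 2 s.L / 2 := by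
        rw [Real.logb, Real.logb, show (4 : ℝ) = 2 ^ (2 : ℕ) by norm_num, Real.log_pow]
        push_cast
        rw [div_div, mul_comm]
      -- `⌊log₄ L⌋ ≤ K / 2`, and `576 ≤ 200 K` because `K ≥ 8`.
      have h4 : 576 + 3600 * (⌊Real.logb 4 s.L⌋₊ : ℝ) ≤ 2000 * K := by linarith
      have := mul_le_mul_of_nonneg_right h4 hψ
      linarith
  · have h1 := mul_le_mul_of_nonneg_left hlogp hD0
    have h2 := mul_le_mul_of_nonneg_left hn (by positivity : (0 : ℝ) ≤ 5 * d)
    rw [hN]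
    linarith

end PullStep

/-- The analysis of a run in which every batch estimates the gaps of its active arms up to
`1 / √L`. -/
theorem exists_terminal_state (hxs : xs ∈ X)
    (hΔ : IsLeast ((gap θ xs) '' {x | x ∈ X ∧ x ≠ xs}) Δ₂) (h0 : 0 < Δ₂) {R : ℕ}
    (hR : 1 ≤ R ∧ U X θ xs R = X.erase xs) (hδ : 0 < δ) (hδ1 : δ < 1) (s : ℕ → State d)
    (hs0 : s 0 = ⟨X, 4, fun _ => 0, 0, 0⟩)
    (hstep : ∀ n, 1 < (s n).active.card → (s n).batches = n → xs ∈ (s n).active →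
      (s n).active ⊆ X → 1 ≤ (s n).L → ∃ e, BatchStep X δ e (s n) (s (n + 1)) ∧
        ∀ x ∈ (s n).active, |e x - gap θ xs x| ≤ 1 / √(s n).L) :
    ∃ n, (s n).active = {xs} ∧ (s n).batches ≤ R ∧
      (Δ₂ ≤ 1 / 2 → (∀ x ∈ X, gap θ xs x ≤ 2) →
        ((s n).pulls : ℝ) ≤ 6144000 *
          (psiStar X θ xs * Real.logb 2 (1 / Δ₂) ^ 2 * Real.logb 2 (X.card / δ) +
            d * Real.logb 2 (1 / Δ₂))) := by
  -- Without a good final state every state would be good with at least two active arms, which is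
  -- impossible at `n = R`.
  by_contra hcon
  obtain ⟨x₀, hx₀, hne₀, -⟩ := exists_gap_eq_minGap hΔ
  have hXcard : 1 < X.card := Finset.one_lt_card.mpr ⟨x₀, hx₀, xs, hxs, hne₀⟩
  have hd : 1 ≤ d := by
    by_contra hd
    obtain rfl : d = 0 := by omega
    exact hne₀ (Subsingleton.elim _ _)
  have hlt : ∀ n, GoodState X θ xs n (s n) → 1 < (s n).active.card → n < R := by
    intro n hg hcard
    by_contra! hle
    obtain ⟨x, hx, hne⟩ := Finset.exists_mem_ne hcard xs
    have h1 := hg.near (hR.1.trans hle) hx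
    rw [← sdiff_U] at h1
    obtain ⟨h2, h3⟩ := Finset.mem_sdiff.mp h1
    exact h3 (U_mono hle (hR.2 ▸ Finset.mem_erase.mpr ⟨hne, h2⟩))
  set K := 8 * Real.logb 2 (1 / Δ₂) with hK
  set D := 48000 * psiStar X θ xs * (Real.logb 2 (X.card / δ) * K) with hD
  have key : ∀ n, GoodState X θ xs n (s n) ∧ 1 < (s n).active.card ∧
      (Δ₂ ≤ 1 / 2 → (∀ x ∈ X, gap θ xs x ≤ 2) → PullBound X θ xs D K n (s n)) := by
    intro n
    induction n with
    | zero =>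
      rw [hs0]
      refine ⟨⟨rfl, hxs, subset_rfl, ?_, by omega, fun x hx hn => absurd hx hn⟩, hXcard, ?_⟩
      · simp [Tbar_one]
      · intro hΔ2 h2
        -- A fictitious previous budget 1: it fits because `L_1 = 4` and all gaps are at most `2 ≤
        -- 6`.
        refine ⟨1, by norm_num, by norm_num, fun x hx => ?_, by simp, ?_⟩
        · have := h2 x hx; norm_num; linarith
        · have h1 := rho_diffs_le_psiStar hxs hΔ h0 subset_rfl (by norm_num : (0 : ℝ) < 2) h2
          have hℓ1 : 1 ≤ Real.logb 2 (1 / Δ₂) := by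
            rw [Real.le_logb_iff_rpow_le (by norm_num) (by positivity), Real.rpow_one,
              le_div_comm₀ (by norm_num) h0]
            exact hΔ2
          have hψ := psiStar_nonneg X θ xs
          have : psiStar X θ xs ≤ psiStar X θ xs * Real.logb 2 (1 / Δ₂) :=
            le_mul_of_one_le_right hψ hℓ1
          simp only [hK]
          linarith
    | succ n ih =>
      obtain ⟨hg, hcard, hP⟩ := ih
      obtain ⟨e, hst, he⟩ := hstep n hcard hg.batches hg.mem hg.sub hg.one_le_budget
      have hmem := mem_active_of_batchStep hg hst he
      have hpb := fun hΔ2 h2 => pullBound_of_batchStep hxs hΔ h0 hΔ2 hd hδ hδ1 hK hD hg hcard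
        hst he (hP hΔ2 h2)
      have hcard' : 1 < (s (n + 1)).active.card := by
        by_contra hc
        refine hcon ⟨n + 1, ?_, ?_, fun hΔ2 h2 => ?_⟩
        · have : (s (n + 1)).active.card = 1 :=
            le_antisymm (not_lt.mp hc) (Finset.card_pos.mpr ⟨xs, hmem⟩)
          obtain ⟨y, hy⟩ := Finset.card_eq_one.mp this
          rw [hy] at hmem ⊢
          rw [Finset.mem_singleton.mp hmem]
        · rw [hst.batches, hg.batches]
          exact hlt n hg hcard
        · refine (hpb hΔ2 h2).2.trans ?_
          have hℓ0 : 0 ≤ Real.logb 2 (1 / Δ₂) := Real.logb_nonneg (by norm_num)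
            ((le_div_iff₀ h0).mpr (by linarith))
          have : 0 ≤ d * Real.logb 2 (1 / Δ₂) := by positivity
          -- The constant is `2 · 48000 · 8² = 6144000`.
          rw [hD, hK]
          linarith
      exact ⟨goodState_of_batchStep hg hst he hcard', hcard', fun hΔ2 h2 => (hpb hΔ2 h2).1 hcard'⟩
  obtain ⟨hg, hcard, -⟩ := key R
  exact absurd (hlt R hg hcard) (lt_irrefl R)

end Algorithm

/-! ### Least squares errors in estimable directions. -/

section LeastSquares

variable {d : ℕ}

/-- The normal equations are solvable. -/
lemma sampleMatrix_mulVec_olsEstimate {N : ℕ} (x : Fin N → Vec d) (c : Fin N → ℝ) :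
    sampleMatrix x *ᵥ olsEstimate x c = ∑ i, c i • x i := by
  have hM := posSemidef_sampleMatrix x
  rcases exists_mulVec_eq_or hM.1 (∑ i, c i • x i) with h | ⟨v, hv, hne⟩
  · exact Classical.epsilon_spec h
  · refine absurd ?_ hne
    have h1 := quad_sampleMatrix x v
    rw [hv, dotProduct_zero] at h1
    have h2 := (Finset.sum_eq_zero_iff_of_nonneg fun i _ => sq_nonneg (x i ⬝ᵥ v)).mp h1.symm
    rw [dotProduct_sum]
    refine Finset.sum_eq_zero fun i hi => ?_
    rw [dotProduct_smul, dotProduct_comm, pow_eq_zero_iff two_ne_zero |>.mp (h2 i hi), smul_zero]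

/-- In a direction from the range of the sample matrix the value does not depend on which least
squares solution is chosen, and it is linear in the rewards. -/
lemma dotProduct_olsEstimate {N : ℕ} (x : Fin N → Vec d) (c : Fin N → ℝ) {w y : Vec d}
    (h : sampleMatrix x *ᵥ w = y) :
    y ⬝ᵥ olsEstimate x c = ∑ i, c i * (x i ⬝ᵥ w) := by
  rw [← h, dotProduct_comm, isHermitian_dotProduct_comm (posSemidef_sampleMatrix x).1,
    sampleMatrix_mulVec_olsEstimate, dotProduct_sum]
  refine Finset.sum_congr rfl fun i _ => ?_
  rw [dotProduct_smul, dotProduct_comm, smul_eq_mul]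

lemma dotProduct_olsEstimate_sub {N : ℕ} (x : Fin N → Vec d) (θ : Vec d) (η : Fin N → ℝ)
    {w y : Vec d} (h : sampleMatrix x *ᵥ w = y) :
    y ⬝ᵥ (olsEstimate x (fun i => x i ⬝ᵥ θ + η i) - θ) = ∑ i, η i * (x i ⬝ᵥ w) := by
  have hθ : y ⬝ᵥ θ = ∑ i, (x i ⬝ᵥ θ) * (x i ⬝ᵥ w) := by
    rw [← h, sampleMatrix, sum_mulVec, sum_dotProduct]
    refine Finset.sum_congr rfl fun i _ => ?_
    rw [vecMulVec_mulVec, smul_dotProduct]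
    simp
  rw [dotProduct_sub, dotProduct_olsEstimate x _ h, hθ, ← Finset.sum_sub_distrib]
  exact Finset.sum_congr rfl fun i _ => by ring

/-- A vector `w` with `M w = y`, if there is one. -/
noncomputable def dualVec (M : Matrix (Fin d) (Fin d) ℝ) (y : Vec d) : Vec d :=
  Classical.epsilon fun w => M *ᵥ w = y

/-- The variance bound that rounding gives for the directions in `diffs S`. -/
lemma dualVec_spec {X S : Finset (Vec d)} {lam : Finset (Vec d) → Vec d → ℝ} {rnd : Rounding d}
    (hlam : ∀ A, IsOptimalDesign X A (lam A)) (hrnd : IsRounding rnd) (hX : X.Nonempty)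
    (hS : S ⊆ X) {N : ℕ} (hN : 4 * d ≤ N) (hN0 : 0 < N) {y : Vec d} (hy : y ∈ diffs S) :
    sampleMatrix (rnd (lam (diffs S)) N X (diffs S)) *ᵥ
        dualVec (sampleMatrix (rnd (lam (diffs S)) N X (diffs S))) y = y ∧
    N * ∑ i, (rnd (lam (diffs S)) N X (diffs S) i ⬝ᵥ
        dualVec (sampleMatrix (rnd (lam (diffs S)) N X (diffs S))) y) ^ 2 ≤
      4 * rho X (diffs S) := by
  set x := rnd (lam (diffs S)) N X (diffs S)
  have h1 := (hrnd (lam (diffs S)) N X (diffs S) (hlam _).1 hN).2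
  rw [(hlam (diffs S)).eq_rho (estimable_diffs hX hS)] at h1
  have h2 : (N : ℝ≥0∞) * invNormSq (sampleMatrix x) y ≤
      ENNReal.ofReal (4 * rho X (diffs S)) := by
    rw [ENNReal.ofReal_mul (by norm_num), ENNReal.ofReal_ofNat]
    exact (mul_le_mul_right (Finset.le_sup hy) _).trans h1
  have hex : ∃ w, sampleMatrix x *ᵥ w = y := by
    by_contra hcon
    -- Outside the range the inverse norm is `∞`, which the finite rounding bound excludes as `N >
    -- 0`.
    have htop : invNormSq (sampleMatrix x) y = ∞ := by
      rw [invNormSq]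
      simp only [iInf_eq_top]
      exact fun w hw => absurd ⟨w, hw⟩ hcon
    rw [htop, ENNReal.mul_top (by exact_mod_cast hN0.ne')] at h2
    exact absurd h2 (not_le.mpr ENNReal.ofReal_lt_top)
  have hw : sampleMatrix x *ᵥ dualVec (sampleMatrix x) y = y := Classical.epsilon_spec hex
  refine ⟨hw, ?_⟩
  rw [invNormSq_of_mulVec_eq (posSemidef_sampleMatrix x).1 hw, quad_sampleMatrix,
    ← ENNReal.ofReal_natCast, ← ENNReal.ofReal_mul (by positivity),
    ENNReal.ofReal_le_ofReal_iff (mul_nonneg (by norm_num) (rho_nonneg _ _))] at h2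
  exact h2

end LeastSquares

/-! ### Measurability through countable case distinctions. -/

section Measurability

/-- A function that is measurable on each piece of a countable measurable cover is measurable. -/
lemma measurable_of_countable_cover {Ω β ι : Type*} [MeasurableSpace Ω] [MeasurableSpace β]
    [Countable ι] {f : Ω → β} (E : ι → Set Ω) (hE : ∀ i, MeasurableSet (E i))
    (hcov : ∀ ω, ∃ i, ω ∈ E i) (g : ι → Ω → β)
    (hg : ∀ i, (E i).Nonempty → Measurable (g i)) (hfg : ∀ i, ∀ ω ∈ E i, f ω = g i ω) :
    Measurable f := by
  intro A hA
  have h : f ⁻¹' A = ⋃ i, E i ∩ g i ⁻¹' A := by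
    ext ω
    simp only [Set.mem_preimage, Set.mem_iUnion, Set.mem_inter_iff]
    constructor
    · intro hω
      obtain ⟨i, hi⟩ := hcov ω
      exact ⟨i, hi, hfg i ω hi ▸ hω⟩
    · rintro ⟨i, hi, hω⟩
      rwa [hfg i ω hi]
  rw [h]
  refine MeasurableSet.iUnion fun i => ?_
  rcases (E i).eq_empty_or_nonempty with h0 | h0
  · rw [h0, Set.empty_inter]; exact MeasurableSet.empty
  · exact (hE i).inter (hg i h0 hA)

variable {Ω α : Type*} [MeasurableSpace Ω] {F : Ω → Finset α} {X : Finset α}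

lemma measurableSet_eq_finset (hF : ∀ ω, F ω ⊆ X) (hm : ∀ y, MeasurableSet {ω | y ∈ F ω})
    (S : Finset α) : MeasurableSet {ω | F ω = S} := by
  by_cases hS : S ⊆ X
  · have h : {ω | F ω = S} = ⋂ y ∈ X, {ω | y ∈ F ω ↔ y ∈ S} := by
      ext ω
      simp only [Set.mem_iInter, Set.mem_ofPred_eq]
      constructor
      · rintro h y -; rw [h]
      · intro h
        ext y
        by_cases hy : y ∈ X
        · exact h y hy
        · exact ⟨fun h' => absurd (hF ω h') hy, fun h' => absurd (hS h') hy⟩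
    rw [h]
    refine Finset.measurableSet_biInter _ fun y _ => ?_
    by_cases hy : y ∈ S
    · simpa [hy] using hm y
    · simp only [hy, iff_false]
      exact (hm y).compl
  · have h : {ω | F ω = S} = ∅ := by
      ext ω
      simp only [Set.mem_ofPred_eq, Set.mem_empty_iff_false, iff_false]
      rintro rfl
      exact hS (hF ω)
    rw [h]; exact MeasurableSet.empty

lemma measurable_comp_finset {β : Type*} [MeasurableSpace β] (hF : ∀ ω, F ω ⊆ X)
    (hm : ∀ y, MeasurableSet {ω | y ∈ F ω}) (g : Finset α → β) :
    Measurable fun ω => g (F ω) :=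
  measurable_of_countable_cover (ι := {S // S ∈ X.powerset}) (fun S => {ω | F ω = S})
    (fun S => measurableSet_eq_finset hF hm S)
    (fun ω => ⟨⟨F ω, Finset.mem_powerset.mpr (hF ω)⟩, rfl⟩)
    (fun S _ => g S) (fun _ _ => measurable_const) (fun S ω h => by
      have : F ω = S := h
      rw [this])

lemma measurable_sum_Icc {T : Ω → ℕ} (hT : Measurable T) {f : ℕ → Ω → ℝ}
    (hf : ∀ t, Measurable (f t)) : Measurable fun ω => ∑ t ∈ Finset.Icc 1 (T ω), f t ω :=
  measurable_of_countable_cover (fun k : ℕ => {ω | T ω = k})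
    (fun k => hT (measurableSet_singleton k)) (fun ω => ⟨T ω, rfl⟩)
    (fun k ω => ∑ t ∈ Finset.Icc 1 k, f t ω)
    (fun k _ => Finset.measurable_sum _ fun t _ => hf t) (fun k ω h => by
      have : T ω = k := h
      rw [this])

end Measurability

/-! ### Measurability of the state of the algorithm. -/

section StateMeasurability

variable {d : ℕ} {X : Finset (Vec d)} {θ : Vec d} {δ : ℝ}
  {lam : Finset (Vec d) → Vec d → ℝ} {rnd : Rounding d} {Ω : Type*} [MeasurableSpace Ω]

lemma four_mul_le_batchSize {S : Finset (Vec d)} {L : ℝ} {r : ℕ} :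
    4 * d ≤ batchSize X S δ L r := by
  have h := Nat.le_ceil (4 * max (2 * Real.logb 2 ((S.card : ℝ) ^ 2 / (δ / (r : ℝ) ^ 2)) *
    rho X (diffs S) * L) (d : ℝ))
  have h2 := le_max_right (2 * Real.logb 2 ((S.card : ℝ) ^ 2 / (δ / (r : ℝ) ^ 2)) *
    rho X (diffs S) * L) (d : ℝ)
  have h3 : (4 * d : ℝ) ≤ batchSize X S δ L r := by
    rw [batchSize]; linarith
  exact_mod_cast h3

lemma measurable_batchSize {S : Finset (Vec d)} {r : ℕ} {L : Ω → ℝ} (hL : Measurable L) :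
    Measurable fun ω => batchSize X S δ (L ω) r :=
  (((hL.const_mul _).max measurable_const).const_mul 4).nat_ceil

/-- The chosen least squares solution itself need not be measurable. The estimated gap uses it only
in directions `z - y`, where it is linear in the noise. -/
lemma measurable_estGap (hlam : ∀ A, IsOptimalDesign X A (lam A)) (hrnd : IsRounding rnd)
    (hd : 1 ≤ d) {S : Finset (Vec d)} (hS : S ⊆ X) {N : ℕ} (hN : 4 * d ≤ N)
    {η : ℕ → Ω → ℝ} (hη : ∀ i, Measurable (η i)) {y : Vec d} (hy : y ∈ S) :
    Measurable fun ω => estGap S (batchEstimate lam rnd X θ S N fun i => η i ω) y := by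
  have hne : S.Nonempty := ⟨y, hy⟩
  set x := rnd (lam (diffs S)) N X (diffs S) with hx
  have hw : ∀ z ∈ S, ∃ w, sampleMatrix x *ᵥ w = z - y := by
    intro z hz
    by_cases hzy : z = y
    · exact ⟨0, by rw [mulVec_zero, hzy, sub_self]⟩
    · exact ⟨_, (dualVec_spec hlam hrnd ⟨y, hS hy⟩ hS hN (by omega)
        (mem_diffs.mpr ⟨z, hz, y, hy, hzy, rfl⟩)).1⟩
  choose! w hw using hw
  have h : (fun ω => estGap S (batchEstimate lam rnd X θ S N fun i => η i ω) y) =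
      fun ω => S.sup' hne fun z => ∑ i : Fin N, (x i ⬝ᵥ θ + η i ω) * (x i ⬝ᵥ w z) := by
    ext ω
    set ϑ := batchEstimate lam rnd X θ S N fun i => η i ω with hϑ
    have h1 : ∀ z ∈ S, ∑ i : Fin N, (x i ⬝ᵥ θ + η i ω) * (x i ⬝ᵥ w z) = ϑ ⬝ᵥ z - ϑ ⬝ᵥ y := by
      intro z hz
      rw [← dotProduct_olsEstimate x (fun i => x i ⬝ᵥ θ + η i ω) (hw z hz), ← dotProduct_sub,
        dotProduct_comm]
      rfl
    rw [estGap, dif_pos hne, Finset.sup'_congr hne rfl h1]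
    apply le_antisymm
    · rw [sub_le_iff_le_add]
      refine Finset.sup'_le hne _ fun z hz => ?_
      rw [← sub_le_iff_le_add]
      exact Finset.le_sup' (fun z => ϑ ⬝ᵥ z - ϑ ⬝ᵥ y) hz
    · exact Finset.sup'_le hne _ fun z hz =>
        sub_le_sub_right (Finset.le_sup' (fun z => ϑ ⬝ᵥ z) hz) _
  rw [h]
  have := Finset.measurable_sup' hne (f := fun z ω =>
    ∑ i : Fin N, (x i ⬝ᵥ θ + η i ω) * (x i ⬝ᵥ w z)) fun z _ =>
      Finset.measurable_sum _ fun i _ => ((hη i).const_add _).mul_const _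
  convert this using 1
  ext ω
  simp

lemma run_succ {noise : ℕ → ℕ → ℝ} (n : ℕ) :
    run 5 25 4 δ lam rnd X θ noise (n + 1) =
      step 5 25 4 δ lam rnd X θ noise (run 5 25 4 δ lam rnd X θ noise n) :=
  Function.iterate_succ_apply' _ _ _

lemma batches_run {noise : ℕ → ℕ → ℝ} (n : ℕ)
    (h : 1 < (run 5 25 4 δ lam rnd X θ noise n).active.card) :
    (run 5 25 4 δ lam rnd X θ noise n).batches = n := by
  induction n with
  | zero => rfl
  | succ n ih =>
    rw [run_succ] at h ⊢
    by_cases hc : 1 < (run 5 25 4 δ lam rnd X θ noise n).active.card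
    · rw [(batchStep_step hc).batches, ih hc]
    · rw [step_eq_self hc] at h
      exact absurd h hc

/-- Measurability of a random state with active set in `X`. -/
structure MeasurableState (X : Finset (Vec d)) (s : Ω → State d) : Prop where
  sub : ∀ ω, (s ω).active ⊆ X
  active : ∀ y, MeasurableSet {ω | y ∈ (s ω).active}
  L : Measurable fun ω => (s ω).L
  eps : ∀ y, Measurable fun ω => (s ω).eps y

lemma MeasurableState.measurableSet_cell {s : Ω → State d} (hs : MeasurableState X s)
    (S : Finset (Vec d)) (N r : ℕ) :
    MeasurableSet {ω | (s ω).active = S ∧ batchSize X S δ (s ω).L r = N} :=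
  (measurableSet_eq_finset hs.sub hs.active S).inter
    (measurable_batchSize hs.L (measurableSet_singleton N))

/-- The state after `n` batches depends measurably on the noise of the first `n` batches. -/
lemma measurableState_run (hlam : ∀ A, IsOptimalDesign X A (lam A)) (hrnd : IsRounding rnd)
    (hd : 1 ≤ d) {noise : ℕ → ℕ → Ω → ℝ} (n : ℕ)
    (hnoise : ∀ r ≤ n, ∀ i, Measurable (noise r i)) :
    MeasurableState X fun ω => run 5 25 4 δ lam rnd X θ (fun r i => noise r i ω) n := by
  induction n with
  | zero =>
    exact ⟨fun _ => subset_rfl, fun y => MeasurableSet.const (y ∈ X), measurable_const,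
      fun _ => measurable_const⟩
  | succ n ih =>
    have ih := ih fun r hr => hnoise r (hr.trans (Nat.le_succ n))
    set s : Ω → State d := fun ω => run 5 25 4 δ lam rnd X θ (fun r i => noise r i ω) n with hs
    set s' : Ω → State d := fun ω =>
      run 5 25 4 δ lam rnd X θ (fun r i => noise r i ω) (n + 1) with hs'
    -- On a cell with fixed active set and fixed batch size the pulled arms are deterministic.
    let E : {S // S ∈ X.powerset} × ℕ → Set Ω := fun c =>
      {ω | (s ω).active = c.1 ∧ batchSize X c.1 δ (s ω).L (n + 1) = c.2}
    have hE : ∀ c, MeasurableSet (E c) := fun c => ih.measurableSet_cell c.1 c.2 (n + 1)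
    have hcov : ∀ ω, ∃ c, ω ∈ E c := fun ω =>
      ⟨(⟨(s ω).active, Finset.mem_powerset.mpr (ih.sub ω)⟩,
        batchSize X (s ω).active δ (s ω).L (n + 1)), rfl, rfl⟩
    let e : {S // S ∈ X.powerset} × ℕ → Vec d → Ω → ℝ := fun c y ω =>
      estGap c.1 (batchEstimate lam rnd X θ c.1 c.2 fun i => noise (n + 1) i ω) y
    -- Nonemptiness gives `N ≥ 4 d`, without which rounding guarantees nothing.
    have he : ∀ c, (E c).Nonempty → ∀ y ∈ c.1.1, Measurable (e c y) := by
      rintro c ⟨ω, hω⟩ y hy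
      exact measurable_estGap hlam hrnd hd (Finset.mem_powerset.mp c.1.2)
        (hω.2 ▸ four_mul_le_batchSize) (fun i => hnoise (n + 1) le_rfl i) hy
    have hidle : ∀ ω, ¬ 1 < (s ω).active.card → s' ω = s ω := fun ω h => by
      simp only [hs', hs]
      rw [run_succ, step_eq_self h]
    have hrun : ∀ c, ∀ ω ∈ E c, 1 < c.1.1.card →
        BatchStep X δ (fun y => e c y ω) (s ω) (s' ω) := by
      rintro c ω ⟨h1, h2⟩ hcard
      have hc : 1 < (s ω).active.card := by rw [h1]; exact hcard
      have h3 := batchStep_step (X := X) (δ := δ) (lam := lam) (rnd := rnd) (θ := θ)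
        (noise := fun r i => noise r i ω) hc
      rw [batches_run n hc, h1, h2] at h3
      simp only [hs']
      rw [run_succ]
      exact h3
    have hsub : ∀ ω, (s' ω).active ⊆ X := by
      intro ω
      obtain ⟨c, hc⟩ := hcov ω
      by_cases hcard : 1 < c.1.1.card
      · exact fun y hy => ih.sub ω (((hrun c ω hc hcard).active y).mp hy).1
      · rw [hidle ω (by rw [hc.1]; exact hcard)]
        exact ih.sub ω
    have hdiv : Measurable fun ω => 5 / √(s ω).L := measurable_const.div ih.L.sqrt
    have hactive : ∀ y, MeasurableSet {ω | y ∈ (s' ω).active} := by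
      intro y
      refine measurableSet_setOfPred.mpr (measurable_of_countable_cover E hE hcov
        (fun c ω => if 1 < c.1.1.card then y ∈ c.1.1 ∧ e c y ω < 5 / √(s ω).L
          else y ∈ c.1.1) ?_ ?_)
      · intro c hne
        by_cases hcard : 1 < c.1.1.card
        · simp only [hcard, if_true]
          by_cases hy : y ∈ c.1.1
          · simp only [hy, true_and]
            exact measurableSet_setOfPred.mp (measurableSet_lt (he c hne y hy) hdiv)
          · simp only [hy, false_and]
            exact measurable_const
        · simp only [hcard, if_false]
          exact measurable_const
      · intro c ω hω
        by_cases hcard : 1 < c.1.1.card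
        · rw [if_pos hcard, ← hω.1]
          exact propext ((hrun c ω hω hcard).active y)
        · rw [if_neg hcard, hidle ω (by rw [hω.1]; exact hcard), hω.1]
    have heps : ∀ y, Measurable fun ω => (s' ω).eps y := by
      intro y
      refine measurable_of_countable_cover E hE hcov
        (fun c ω => if 1 < c.1.1.card ∧ y ∈ c.1.1 then
          (if 5 / √(s ω).L ≤ e c y ω then e c y ω else (s ω).eps y) else (s ω).eps y) ?_ ?_
      · intro c hne
        by_cases hc : 1 < c.1.1.card ∧ y ∈ c.1.1
        · simp only [hc, and_self, if_true]
          exact Measurable.ite (measurableSet_le hdiv (he c hne y hc.2)) (he c hne y hc.2)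
            (ih.eps y)
        · simp only [hc, if_false]
          exact ih.eps y
      · intro c ω hω
        by_cases hcard : 1 < c.1.1.card
        · have hst := hrun c ω hω hcard
          by_cases hy : y ∈ c.1.1
          · rw [if_pos ⟨hcard, hy⟩]
            split_ifs with hle
            · exact hst.eps_of_eliminated y (by rw [hω.1]; exact hy) hle
            · exact hst.eps_of_not_eliminated y fun h => hle h.2
          · rw [if_neg (fun h => hy h.2)]
            exact hst.eps_of_not_eliminated y fun h => hy (hω.1 ▸ h.1)
        · rw [if_neg (fun h => hcard h.1), hidle ω (by rw [hω.1]; exact hcard)]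
    refine ⟨hsub, hactive, ?_, heps⟩
    refine measurable_of_countable_cover E hE hcov (fun c ω => if 1 < c.1.1.card then
      4 * (s ω).L + (∑ t ∈ Finset.Icc 1 ⌊Real.logb 4 (s ω).L⌋₊, 4 ^ t * rho X (diffs
        (X \ {y ∈ X \ (s' ω).active | 25 * √(((4 : ℝ) ^ t)⁻¹) < (s' ω).eps y})))
        / rho X (diffs (s' ω).active) else (s ω).L) ?_ ?_
    · intro c _
      by_cases hcard : 1 < c.1.1.card
      · simp only [hcard, if_true]
        refine (ih.L.const_mul 4).add ((measurable_sum_Icc ?_ fun t => ?_).div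
          (measurable_comp_finset hsub hactive fun S => rho X (diffs S)))
        · exact ((Real.measurable_log.comp ih.L).div_const _).nat_floor
        · refine (measurable_comp_finset (X := X) (fun _ => Finset.sdiff_subset) (fun y => ?_)
            fun S => rho X (diffs S)).const_mul _
          by_cases hy : y ∈ X
          · simp only [Finset.mem_sdiff, Finset.mem_filter, hy, true_and]
            exact ((hactive y).compl.inter (measurableSet_lt measurable_const (heps y))).compl
          · simp only [Finset.mem_sdiff, hy, false_and]
            exact MeasurableSet.const False
      · simp only [hcard, if_false]
        exact ih.L
    · intro c ω hω
      by_cases hcard : 1 < c.1.1.card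
      · rw [if_pos hcard]
        exact (hrun c ω hω hcard).budget
      · rw [if_neg hcard, hidle ω (by rw [hω.1]; exact hcard)]

end StateMeasurability

/-! ### Gaussian tails. -/

section Tail

variable {Ω : Type*} [MeasurableSpace Ω] {P : Measure Ω}

lemma hasSubgaussianMGF_of_map_eq_gaussianReal {f : Ω → ℝ} (hf : Measurable f)
    (h : P.map f = gaussianReal 0 1) : HasSubgaussianMGF f 1 P where
  integrable_exp_mul t := by
    have h1 := integrable_exp_mul_gaussianReal (μ := 0) (v := 1) t
    rw [← h] at h1
    exact h1.comp_measurable hf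
  mgf_le t := by
    rw [mgf_gaussianReal h]
    simp

/-- The Gaussian tail bound for linear combinations of independent standard Gaussians. -/
lemma measure_le_sum_mul_le [IsProbabilityMeasure P] {noise : ℕ × ℕ → Ω → ℝ}
    (hm : ∀ k, Measurable (noise k)) (hg : ∀ k, P.map (noise k) = gaussianReal 0 1)
    (hi : iIndepFun noise P) (r : ℕ) {N : ℕ} (a : Fin N → ℝ) {τ : ℝ} (hτ : 0 ≤ τ) :
    P {ω | τ ≤ ∑ i : Fin N, noise (r, i) ω * a i} ≤
      ENNReal.ofReal (Real.exp (-τ ^ 2 / (2 * ∑ i, a i ^ 2))) := by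
  have h1 : iIndepFun (fun (i : Fin N) ω => noise (r, i) ω) P :=
    hi.precomp (g := fun i : Fin N => (r, (i : ℕ))) fun i j hij => Fin.ext (Prod.ext_iff.mp hij).2
  have h2 : iIndepFun (fun (i : Fin N) ω => a i * noise (r, i) ω) P :=
    h1.comp (fun i x => a i * x) fun i => measurable_const_mul (a i)
  have h3 := HasSubgaussianMGF.measure_sum_ge_le_of_iIndepFun h2 (s := Finset.univ)
    (fun i _ => (hasSubgaussianMGF_of_map_eq_gaussianReal (hm (r, i)) (hg (r, i))).const_mul (a i))
    hτ
  rw [← ENNReal.ofReal_toReal (measure_ne_top P _)]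
  refine ENNReal.ofReal_le_ofReal ?_
  simp only [mul_comm (noise _ _)]
  refine h3.trans (le_of_eq ?_)
  congr 3
  rw [NNReal.coe_sum]
  exact Finset.sum_congr rfl fun i _ => (NNReal.coe_mul _ _).trans (mul_one _)

end Tail

/-! ### Failure probability of a batch and of the whole run. -/

section RoundFailure

variable {d : ℕ} {X S : Finset (Vec d)} {θ : Vec d} {δ : ℝ}
  {lam : Finset (Vec d) → Vec d → ℝ} {rnd : Rounding d} {Ω : Type*}

/-- The accuracy guaranteed by `N` pulls in batch `r` with active set `S`. -/
noncomputable def accuracy (X S : Finset (Vec d)) (δ : ℝ) (N r : ℕ) : ℝ :=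
  √(8 * Real.logb 2 ((S.card : ℝ) ^ 2 / (δ / (r : ℝ) ^ 2)) * rho X (diffs S) / N)

/-- Some direction in `diffs S` is estimated with an error of at least `accuracy`. -/
def batchFailure (lam : Finset (Vec d) → Vec d → ℝ) (rnd : Rounding d) (X S : Finset (Vec d))
    (δ : ℝ) (N r : ℕ) (noise : ℕ × ℕ → Ω → ℝ) : Set Ω :=
  ⋃ y ∈ diffs S, {ω | accuracy X S δ N r ≤ ∑ i : Fin N, noise (r, i) ω *
    (rnd (lam (diffs S)) N X (diffs S) i ⬝ᵥ
      dualVec (sampleMatrix (rnd (lam (diffs S)) N X (diffs S))) y)}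

lemma measurableSet_batchFailure [MeasurableSpace Ω] {N r : ℕ} {noise : ℕ × ℕ → Ω → ℝ}
    (hm : ∀ i, Measurable (noise (r, i))) :
    MeasurableSet (batchFailure lam rnd X S δ N r noise) :=
  Finset.measurableSet_biUnion _ fun _ _ => measurableSet_le measurable_const
    (Finset.measurable_sum _ fun i _ => (hm i).mul_const _)

lemma four_le_card_sq_div (hcard : 1 < S.card) (hδ : 0 < δ) (hδ1 : δ < 1) {r : ℕ} (hr : 1 ≤ r) :
    4 ≤ (S.card : ℝ) ^ 2 / (δ / (r : ℝ) ^ 2) := by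
  have h1 : (2 : ℝ) ≤ S.card := by exact_mod_cast hcard
  have h2 : (1 : ℝ) ≤ r := by exact_mod_cast hr
  rw [div_div_eq_mul_div, le_div_iff₀ hδ]
  have h3 : (4 : ℝ) ≤ (S.card : ℝ) ^ 2 := by nlinarith
  have h4 : (1 : ℝ) ≤ (r : ℝ) ^ 2 := one_le_pow₀ h2
  nlinarith

lemma accuracy_le {L : ℝ} (hL : 0 < L) {r : ℕ} (hpos : 0 < batchSize X S δ L r) :
    accuracy X S δ (batchSize X S δ L r) r ≤ 1 / √L := by
  rw [accuracy, ← Real.sqrt_one, ← Real.sqrt_div zero_le_one]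
  refine Real.sqrt_le_sqrt ?_
  have hN : (0 : ℝ) < batchSize X S δ L r := by exact_mod_cast hpos
  rw [div_le_div_iff₀ hN hL, one_mul]
  have h := Nat.le_ceil (4 * max (2 * Real.logb 2 ((S.card : ℝ) ^ 2 / (δ / (r : ℝ) ^ 2)) *
    rho X (diffs S) * L) (d : ℝ))
  have h2 := le_max_left (2 * Real.logb 2 ((S.card : ℝ) ^ 2 / (δ / (r : ℝ) ^ 2)) *
    rho X (diffs S) * L) (d : ℝ)
  rw [batchSize]
  linarith

lemma dotProduct_batchEstimate_sub_le (hlam : ∀ A, IsOptimalDesign X A (lam A))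
    (hrnd : IsRounding rnd) (hd : 1 ≤ d) (hX : X.Nonempty) (hS : S ⊆ X) {L : ℝ} (hL : 0 < L)
    {r : ℕ} {noise : ℕ × ℕ → Ω → ℝ} {ω : Ω}
    (hω : ω ∉ batchFailure lam rnd X S δ (batchSize X S δ L r) r noise) {y : Vec d}
    (hy : y ∈ diffs S) :
    y ⬝ᵥ (batchEstimate lam rnd X θ S (batchSize X S δ L r) (fun i => noise (r, i) ω) - θ) ≤
      1 / √L := by
  have hN : 4 * d ≤ batchSize X S δ L r := four_mul_le_batchSize
  have hpos : 0 < batchSize X S δ L r := by omega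
  refine le_trans ?_ (accuracy_le hL hpos)
  have h1 := (dualVec_spec hlam hrnd hX hS hN hpos hy).1
  rw [batchEstimate, dotProduct_olsEstimate_sub _ θ _ h1]
  refine le_of_not_ge fun h => hω ?_
  exact Set.mem_biUnion hy h

lemma card_diffs_le (S : Finset (Vec d)) : ((diffs S).card : ℝ) ≤ (S.card : ℝ) ^ 2 := by
  have h : (diffs S).card ≤ S.card * S.card := by
    refine Finset.card_image_le.trans ?_
    rw [Finset.offDiag_card]
    exact Nat.sub_le _ _
  rw [sq]
  exact_mod_cast h

/-- Since `1 / log 2 ≥ 7/5`, the left side is at most `Q^(-2/5) ≤ 4^(-2/5)`, and `4^(-2) ≤ (3/5)^5`.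
The gain over 1 makes the sum over batches fit into `δ`. -/
lemma mul_exp_neg_logb_le {Q : ℝ} (hQ : 4 ≤ Q) : Q * Real.exp (-Real.logb 2 Q) ≤ 3 / 5 := by
  have hQ0 : 0 < Q := by linarith
  have hlog : 0 ≤ Real.log Q := Real.log_nonneg (by linarith)
  have h1 : 7 / 5 * Real.log Q ≤ Real.logb 2 Q := by
    rw [Real.logb, le_div_iff₀ (Real.log_pos (by norm_num))]
    have := Real.log_two_lt_d9
    nlinarith
  have h2 : Real.log 4 ≤ Real.log Q := Real.log_le_log (by norm_num) hQ
  have h3 : Q * Real.exp (-Real.logb 2 Q) = Real.exp (Real.log Q - Real.logb 2 Q) := by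
    rw [sub_eq_add_neg, Real.exp_add, Real.exp_log hQ0]
  rw [h3, ← Real.le_log_iff_exp_le (by norm_num)]
  have h4 : -(2 / 5) * Real.log 4 ≤ Real.log (3 / 5) := by
    have h5 : Real.log ((1 / 16 : ℝ)) ≤ Real.log ((3 / 5) ^ (5 : ℕ)) :=
      Real.log_le_log (by norm_num) (by norm_num)
    rw [Real.log_pow, show (1 / 16 : ℝ) = (4 ^ (2 : ℕ))⁻¹ by norm_num, Real.log_inv,
      Real.log_pow] at h5
    push_cast at h5
    linarith
  linarith

/-- A batch fails with probability at most `0.6 δ / r²`. -/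
lemma measure_batchFailure_le [MeasurableSpace Ω] {P : Measure Ω} [IsProbabilityMeasure P]
    {noise : ℕ × ℕ → Ω → ℝ} (hm : ∀ k, Measurable (noise k))
    (hg : ∀ k, P.map (noise k) = gaussianReal 0 1) (hi : iIndepFun noise P)
    (hlam : ∀ A, IsOptimalDesign X A (lam A)) (hrnd : IsRounding rnd) (hd : 1 ≤ d)
    (hX : X.Nonempty) (hS : S ⊆ X) (hcard : 1 < S.card) (hδ : 0 < δ) (hδ1 : δ < 1)
    {N r : ℕ} (hN : 4 * d ≤ N) (hr : 1 ≤ r) :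
    P (batchFailure lam rnd X S δ N r noise) ≤ ENNReal.ofReal (3 / 5 * δ * (1 / (r : ℝ) ^ 2)) := by
  set Q := (S.card : ℝ) ^ 2 / (δ / (r : ℝ) ^ 2) with hQ
  have hQ4 : 4 ≤ Q := four_le_card_sq_div hcard hδ hδ1 hr
  have hr0 : (0 : ℝ) < r := by exact_mod_cast hr
  have hN0 : (0 : ℝ) < N := by
    have : 0 < N := by omega
    exact_mod_cast this
  have hlogQ : 0 ≤ Real.logb 2 Q := Real.logb_nonneg (by norm_num) (by linarith)
  have key : ∀ y ∈ diffs S, P {ω | accuracy X S δ N r ≤ ∑ i : Fin N, noise (r, i) ω *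
      (rnd (lam (diffs S)) N X (diffs S) i ⬝ᵥ
        dualVec (sampleMatrix (rnd (lam (diffs S)) N X (diffs S))) y)} ≤
      ENNReal.ofReal (Real.exp (-Real.logb 2 Q)) := by
    intro y hy
    refine (measure_le_sum_mul_le hm hg hi r _ (Real.sqrt_nonneg _)).trans
      (ENNReal.ofReal_le_ofReal (Real.exp_le_exp.mpr ?_))
    obtain ⟨h1, h2⟩ := dualVec_spec hlam hrnd hX hS hN (by omega) hy
    have hy0 : y ≠ 0 := by
      obtain ⟨a, -, b, -, hab, rfl⟩ := mem_diffs.mp hy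
      exact sub_ne_zero.mpr hab
    have h3 := invNormSq_pos (posSemidef_sampleMatrix (rnd (lam (diffs S)) N X (diffs S))) hy0
    rw [invNormSq_of_mulVec_eq (posSemidef_sampleMatrix _).1 h1, quad_sampleMatrix,
      ENNReal.ofReal_pos] at h3
    -- The squared accuracy is `8 log₂ Q · ρ / N`, and twice the variance is at most `8 ρ / N`. The
    -- variance is positive by `h3`, which matters because a division by zero would make the
    -- exponent 0.
    rw [neg_div, neg_le_neg_iff, Real.sq_sqrt (div_nonneg (mul_nonneg (by positivity)
      (rho_nonneg _ _)) hN0.le), le_div_iff₀ (by linarith), le_div_iff₀ hN0, ← hQ]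
    have := mul_le_mul_of_nonneg_left h2 hlogQ
    linarith
  refine (measure_biUnion_finset_le _ _).trans ((Finset.sum_le_sum key).trans ?_)
  rw [Finset.sum_const, nsmul_eq_mul, ← ENNReal.ofReal_natCast,
    ← ENNReal.ofReal_mul (by positivity)]
  refine ENNReal.ofReal_le_ofReal ?_
  have h1 : (S.card : ℝ) ^ 2 = Q * (δ / (r : ℝ) ^ 2) := by
    rw [hQ, div_mul_cancel₀ _ (by positivity)]
  calc ((diffs S).card : ℝ) * Real.exp (-Real.logb 2 Q)
      ≤ (S.card : ℝ) ^ 2 * Real.exp (-Real.logb 2 Q) :=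
        mul_le_mul_of_nonneg_right (card_diffs_le S) (Real.exp_pos _).le
    _ = (Q * Real.exp (-Real.logb 2 Q)) * (δ / (r : ℝ) ^ 2) := by rw [h1]; ring
    _ ≤ 3 / 5 * (δ / (r : ℝ) ^ 2) :=
        mul_le_mul_of_nonneg_right (mul_exp_neg_logb_le hQ4) (by positivity)
    _ = _ := by ring

/-- The event that the active set is `S` and the batch size is `N` in batch `n + 1`. -/
def batchCell (δ : ℝ) (lam : Finset (Vec d) → Vec d → ℝ) (rnd : Rounding d) (X : Finset (Vec d))
    (θ : Vec d) (noise : ℕ × ℕ → Ω → ℝ) (n : ℕ) (S : Finset (Vec d)) (N : ℕ) : Set Ω :=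
  {ω | (run 5 25 4 δ lam rnd X θ (fun r i => noise (r, i) ω) n).active = S ∧
    batchSize X S δ (run 5 25 4 δ lam rnd X θ (fun r i => noise (r, i) ω) n).L (n + 1) = N}

/-- What happened before a batch is independent of its failure. -/
lemma measure_batchCell_inter_batchFailure [MeasurableSpace Ω] {P : Measure Ω}
    {noise : ℕ × ℕ → Ω → ℝ} (hm : ∀ k, Measurable (noise k)) (hi : iIndepFun noise P)
    (hlam : ∀ A, IsOptimalDesign X A (lam A)) (hrnd : IsRounding rnd) (hd : 1 ≤ d)
    (n : ℕ) (S : Finset (Vec d)) (N : ℕ) :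
    P (batchCell δ lam rnd X θ noise n S N ∩ batchFailure lam rnd X S δ N (n + 1) noise) =
      P (batchCell δ lam rnd X θ noise n S N) *
        P (batchFailure lam rnd X S δ N (n + 1) noise) := by
  have hdisj : Disjoint {k : ℕ × ℕ | k.1 ≤ n} {k : ℕ × ℕ | k.1 = n + 1} :=
    Set.disjoint_left.mpr fun k hk hk' => by
      have h1 : k.1 ≤ n := hk
      have h2 : k.1 = n + 1 := hk'
      omega
  have hind := indep_iSup_of_disjoint (fun k => (hm k).comap_le) hi.iIndep hdisj
  refine (Indep_iff _ _ _).mp hind _ _ ?_ ?_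
  -- Measurability of the run is applied with the σ-algebra generated by the noise of the first
  -- batches in place of the ambient one.
  · exact @MeasurableState.measurableSet_cell d X δ Ω
      (⨆ k ∈ {k : ℕ × ℕ | k.1 ≤ n}, MeasurableSpace.comap (noise k) inferInstance) _ (@measurableState_run d X θ δ lam rnd Ω
      (⨆ k ∈ {k : ℕ × ℕ | k.1 ≤ n}, MeasurableSpace.comap (noise k) inferInstance)
      hlam hrnd hd (fun r i => noise (r, i)) n fun r hr i =>
        (comap_measurable (noise (r, i))).mono
          (le_iSup₂_of_le (f := fun k (_ : k ∈ {k : ℕ × ℕ | k.1 ≤ n}) =>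
            MeasurableSpace.comap (noise k) inferInstance) (r, i) hr le_rfl) le_rfl) S N (n + 1)
  · exact @measurableSet_batchFailure d X S δ lam rnd Ω
      (⨆ k ∈ {k : ℕ × ℕ | k.1 = n + 1}, MeasurableSpace.comap (noise k) inferInstance)
      N (n + 1) noise fun i =>
        (comap_measurable (noise (n + 1, i))).mono
          (le_iSup₂_of_le (f := fun k (_ : k ∈ {k : ℕ × ℕ | k.1 = n + 1}) =>
            MeasurableSpace.comap (noise k) inferInstance) (n + 1, i) rfl le_rfl) le_rfl

/-- `(3/5) · π²/6 ≤ 1` because `π² ≤ 10`. -/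
lemma tsum_failure_le (hδ : 0 ≤ δ) :
    ∑' n : ℕ, ENNReal.ofReal (3 / 5 * δ * (1 / ((n + 1 : ℕ) : ℝ) ^ 2)) ≤ ENNReal.ofReal δ := by
  have h1 : HasSum (fun n : ℕ => (1 : ℝ) / ((n + 1 : ℕ) : ℝ) ^ 2) (Real.pi ^ 2 / 6) := by
    have := (hasSum_nat_add_iff' 1).mpr hasSum_zeta_two
    simpa using this
  have h2 := h1.mul_left (3 / 5 * δ)
  rw [← ENNReal.ofReal_tsum_of_nonneg (fun n => by positivity) h2.summable, h2.tsum_eq]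
  refine ENNReal.ofReal_le_ofReal ?_
  have h3 : Real.pi ^ 2 ≤ 10 := by nlinarith [Real.pi_lt_d2, Real.pi_pos]
  nlinarith

/-- Some batch with at least two active arms fails. -/
def runFailure (δ : ℝ) (lam : Finset (Vec d) → Vec d → ℝ) (rnd : Rounding d)
    (X : Finset (Vec d)) (θ : Vec d) (noise : ℕ × ℕ → Ω → ℝ) : Set Ω :=
  ⋃ n : ℕ, ⋃ c : {S : Finset (Vec d) // S ∈ X.powerset ∧ 1 < S.card} × ℕ,
    batchCell δ lam rnd X θ noise n c.1 c.2 ∩ batchFailure lam rnd X c.1 δ c.2 (n + 1) noise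

/-- For fixed `n` the cells are disjoint, so their probabilities sum to at most 1; by independence,
batch `n + 1` fails with no more than the bound for a fixed active set and batch size. -/
lemma measure_runFailure_le [MeasurableSpace Ω] {P : Measure Ω} [IsProbabilityMeasure P]
    {noise : ℕ × ℕ → Ω → ℝ} (hm : ∀ k, Measurable (noise k))
    (hg : ∀ k, P.map (noise k) = gaussianReal 0 1) (hi : iIndepFun noise P)
    (hlam : ∀ A, IsOptimalDesign X A (lam A)) (hrnd : IsRounding rnd) (hd : 1 ≤ d)
    (hX : X.Nonempty) (hδ : 0 < δ) (hδ1 : δ < 1) :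
    P (runFailure δ lam rnd X θ noise) ≤ ENNReal.ofReal δ := by
  have : Countable {S : Finset (Vec d) // S ∈ X.powerset ∧ 1 < S.card} :=
    ((X.powerset.finite_toSet.subset fun _ h => h.1 :
      {S : Finset (Vec d) | S ∈ X.powerset ∧ 1 < S.card}.Finite).countable).to_subtype
  refine (measure_iUnion_le _).trans (le_trans (ENNReal.tsum_le_tsum fun n => ?_)
    (tsum_failure_le hδ.le))
  set b := ENNReal.ofReal (3 / 5 * δ * (1 / ((n + 1 : ℕ) : ℝ) ^ 2))
  have h1 : ∀ c : {S : Finset (Vec d) // S ∈ X.powerset ∧ 1 < S.card} × ℕ,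
      P (batchCell δ lam rnd X θ noise n c.1 c.2 ∩
        batchFailure lam rnd X c.1 δ c.2 (n + 1) noise) ≤
      P (batchCell δ lam rnd X θ noise n c.1 c.2) * b := by
    intro c
    rw [measure_batchCell_inter_batchFailure hm hi hlam hrnd hd]
    rcases (batchCell δ lam rnd X θ noise n c.1.1 c.2).eq_empty_or_nonempty with h | ⟨ω, hω⟩
    · rw [h, measure_empty, zero_mul, zero_mul]
    · refine mul_le_mul_right (measure_batchFailure_le hm hg hi hlam hrnd hd hX
        (Finset.mem_powerset.mp c.1.2.1) c.1.2.2 hδ hδ1 ?_ (by omega)) _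
      rw [← hω.2]
      exact four_mul_le_batchSize
  refine (measure_iUnion_le _).trans ((ENNReal.tsum_le_tsum h1).trans ?_)
  rw [ENNReal.tsum_mul_right, ← measure_iUnion]
  · exact mul_le_of_le_one_left (zero_le) prob_le_one
  · intro c c' hne
    refine Set.disjoint_left.mpr fun ω h h' => hne ?_
    have hS : c.1 = c'.1 := Subtype.ext (h.1.symm.trans h'.1)
    refine Prod.ext hS ?_
    have h2 := h.2
    rw [hS] at h2
    exact h2.symm.trans h'.2
  · intro c
    exact MeasurableState.measurableSet_cell (measurableState_run hlam hrnd hd n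
      fun r _ i => hm (r, i)) _ _ _

end RoundFailure

end LinBandit

/-- First the procedures called by the algorithm exist: optimal designs and roundings. Then, with a
universal constant `C`, for every instance with a unique best arm `xs` and smallest gap `Δ₂`:
the bound on `ρ` of the near-optimal arms, the existence and the bound of the batch complexity `R`,
and the guarantees on the algorithm (the probability of the complementary event is at most `δ`). -/
theorem theorem2 :
    (∀ (d : ℕ) (X : Finset (Vec d)), X.Nonempty →
      ∃ lam : Finset (Vec d) → Vec d → ℝ, ∀ A, IsOptimalDesign X A (lam A)) ∧
    (∀ d : ℕ, ∃ rnd : Rounding d, IsRounding rnd) ∧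
    ∃ C : ℝ, 0 < C ∧
      ∀ (d : ℕ) (X : Finset (Vec d)) (θ xs : Vec d) (Δ₂ : ℝ),
        xs ∈ X →
        IsLeast ((gap θ xs) '' {x | x ∈ X ∧ x ≠ xs}) Δ₂ →
        0 < Δ₂ →
        (∀ L : ℝ, 0 < L →
          L * rho X (diffs {z ∈ X | gap θ xs z ≤ 15 / √L}) ≤ 900 * psiStar X θ xs) ∧
        ∃ R : ℕ, IsLeast {r : ℕ | 1 ≤ r ∧ U X θ xs r = X.erase xs} R ∧
          (Δ₂ ≤ 1 / 2 → (∀ x ∈ X, gap θ xs x ≤ 2) →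
            (R : ℝ) ≤ (((Finset.Icc 1 R).image (U X θ xs)).card : ℝ) +
              Real.logb (5 / 4)
                (900 * Real.logb 2 (1 / Δ₂) * psiStar X θ xs / rho X (diffsFrom xs X))) ∧
          ∀ (δ : ℝ) (lam : Finset (Vec d) → Vec d → ℝ) (rnd : Rounding d),
            0 < δ → δ < 1 → (∀ A, IsOptimalDesign X A (lam A)) → IsRounding rnd →
            ∀ (Ω : Type*) [MeasurableSpace Ω] (P : Measure Ω) [IsProbabilityMeasure P]
              (noise : ℕ × ℕ → Ω → ℝ),
              (∀ k, Measurable (noise k)) →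
              (∀ k, P.map (noise k) = gaussianReal 0 1) →
              iIndepFun noise P →
              P {ω | ¬ ∃ n : ℕ,
                  let s := run 5 25 4 δ lam rnd X θ (fun r i => noise (r, i) ω) n
                  s.active = {xs} ∧ s.batches ≤ R ∧
                  (Δ₂ ≤ 1 / 2 → (∀ x ∈ X, gap θ xs x ≤ 2) →
                    (s.pulls : ℝ) ≤ C *
                      (psiStar X θ xs * Real.logb 2 (1 / Δ₂) ^ 2 * Real.logb 2 (X.card / δ) +
                        d * Real.logb 2 (1 / Δ₂)))}
                ≤ ENNReal.ofReal δ := by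
  refine ⟨fun d X hX => ⟨fun A => (exists_isOptimalDesign hX A).choose,
    fun A => (exists_isOptimalDesign hX A).choose_spec⟩, exists_isRounding, 6144000, by norm_num,
    fun d X θ xs Δ₂ hxs hΔ h0 => ⟨fun L hL => ?_, ?_⟩⟩
  · have := mul_rho_diffs_le_psiStar hxs hΔ h0 (S := {z ∈ X | gap θ xs z ≤ 15 / √L})
      (Finset.filter_subset _ _) (by norm_num : (0 : ℝ) < 15) hL
      fun x hx => (Finset.mem_filter.mp hx).2
    linarith
  obtain ⟨R, hR⟩ := exists_isLeast_batches (θ := θ) (xs := xs) hΔ h0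
  refine ⟨R, hR, batches_le hxs hΔ h0 hR, ?_⟩
  intro δ lam rnd hδ hδ1 hlam hrnd Ω _ P _ noise hm hg hi
  obtain ⟨x₀, -, hne₀, -⟩ := exists_gap_eq_minGap hΔ
  have hd : 1 ≤ d := by
    by_contra hd
    obtain rfl : d = 0 := by omega
    exact hne₀ (Subsingleton.elim _ _)
  -- The bad event need not be measurable; it is enough that it lies in `runFailure`.
  refine (measure_mono ?_).trans (measure_runFailure_le (θ := θ) hm hg hi hlam hrnd hd ⟨xs, hxs⟩
    hδ hδ1)
  intro ω hω
  by_contra hgood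
  refine hω (exists_terminal_state hxs hΔ h0 hR.1 hδ hδ1
    (fun n => run 5 25 4 δ lam rnd X θ (fun r i => noise (r, i) ω) n) rfl ?_)
  intro n hcard hb hmem hsub hL
  refine ⟨_, run_succ (δ := δ) (lam := lam) (rnd := rnd) (X := X) (θ := θ) n ▸
    batchStep_step hcard, fun x hx => ?_⟩
  refine abs_estGap_sub_gap_le hmem (fun x hx => gap_nonneg hΔ h0 (hsub hx)) (by positivity)
    (fun y hy => ?_) hx
  rw [hb]
  refine dotProduct_batchEstimate_sub_le (noise := noise) hlam hrnd hd ⟨xs, hxs⟩ hsub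
    (by linarith) (fun hf => hgood ?_) hy
  exact Set.mem_iUnion.mpr ⟨n, Set.mem_iUnion.mpr
    ⟨(⟨_, Finset.mem_powerset.mpr hsub, hcard⟩, _), ⟨rfl, rfl⟩, hf⟩⟩
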